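/- All links are unoriented links in $S^3$, considered up to orientation-preserving homeomorphism of $S^3$ and represented by diagrams. An H(2)-move replaces, inside a disc in which a diagram consists of two parallel arcs $)($, these two arcs by $\asymp$ (a band surgery); it may be performed in either direction, on any diagram of the link, and it may change the number of components. The H(2)-unknotting number $u_2(L)$ is the minimal number of H(2)-moves that change $L$ into the unknot. For integers $a_1,\dots,a_n$ let $[a_1,\dots,a_n]=a_1+\cfrac{1}{a_2+\cdots+\cfrac{1}{a_n}}\in\mathbb{Q}\cup\{1/0\}$. Let the rational tangle $T(a_1,\dots,a_n)$ be the tangle with four endpoints, numbered $1,2,3,4$ from left to right at the top, that is obtained as follows. Start with two arcs without crossings, joining $1$ to $2$ and $3$ to $4$ if $n$ is even, and $1$ to $4$ and $2$ to $3$ if $n$ is odd. Then add successively $a_n, a_{n-1},\dots,a_1$ half twists, where $a_i$ twists the endpoints $1,2$ if $i$ is odd and the endpoints $2,3$ if $i$ is even; for $i$ odd, a crossing counted by $a_i>0$ has as over-strand the one running from lower left to upper right, and for $i$ even the one running from lower right to upper left (so the diagram is alternating if all $a_i>0$). Let $T_0$ be the tangle of two arcs without crossings that join $1$ to $2$ and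 $3$ to $4$. For coprime integers $p,q$ with $p/q=[a_1,\dots,a_n]$, the 2-bridge link $S(p,q)$ is the link with diagram $C(a_1,\dots,a_n)$ obtained from $T(a_1,\dots,a_n)$ by joining the endpoint $1$ to $4$ and $2$ to $3$ by two nested arcs without crossings. A link $K$ is a $(p,q)$-tangle unknotting number one link if, for some $a_1,\dots,a_n$ with $p/q=[a_1,\dots,a_n]$, there is a tangle decomposition $K=T_1\cup T_2$ such that $T_1=T(a_1,\dots,a_n)$ and $T_0\cup T_2$ is the unknot. **Proposition.** Let $p,q$ be coprime integers, let $K_1$ be the 2-bridge link $S(q,p)$, and let $K_2$ be a $(p,q)$-tangle unknotting number one link. Assume that $K_1$ and $K_2$ are not both the unknot. Then every connected sum $K_1\sharp K_2$ (for any choice of the components that are joined and of the way of joining them) satisfies $u_2(K_1\sharp K_2)=1$. -/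

import Mathlib

namespace HTwo

/-! Link and tangle diagrams are written in sliced (Morse) form: a diagram is read from bottom to top
as a finite list of elementary slices.  Each slice consists of one elementary piece together with a
number of vertical strands on its left and on its right.  Two diagrams represent the same tangle if
they are related by planar isotopy and Reidemeister moves, which for sliced diagrams are the finitely
many local moves below (the Turaev moves).  All links are unoriented links in the 3-sphere. -/

/-- The elementary pieces, read upwards: `cup` is a local minimum (two strands are born), `cap` is a
local maximum (two neighbouring strands are joined), `pos` is the crossing whose over-strand runs from
the lower left to the upper right, `neg` the crossing whose over-strand runs from the lower right to
the upper left. -/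
inductive Piece where
  | cup
  | cap
  | pos
  | neg
  deriving DecidableEq

namespace Piece

/-- The number of endpoints at the bottom. -/
def bot : Piece → ℕ
  | cup => 0
  | cap => 2
  | pos => 2
  | neg => 2

/-- The number of endpoints at the top. -/
def top : Piece → ℕ
  | cup => 2
  | cap => 0
  | pos => 2
  | neg => 2

end Piece

/-- A slice: an elementary piece with `left` vertical strands on its left. -/
structure Slice where
  piece : Piece
  left : ℕ
  deriving DecidableEq

/-- `cup i` creates two new strands, in positions `i` and `i + 1` (positions count from `0`). -/
abbrev cup (i : ℕ) : Slice := ⟨Piece.cup, i⟩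

/-- `cap i` joins the strands in positions `i` and `i + 1`. -/
abbrev cap (i : ℕ) : Slice := ⟨Piece.cap, i⟩

/-- `pos i` is a crossing of type `Piece.pos` of the strands in positions `i` and `i + 1`. -/
abbrev pos (i : ℕ) : Slice := ⟨Piece.pos, i⟩

/-- `neg i` is a crossing of type `Piece.neg` of the strands in positions `i` and `i + 1`. -/
abbrev neg (i : ℕ) : Slice := ⟨Piece.neg, i⟩

/-- `IsDiagram m w n`: the slices of `w`, stacked upwards, fit together to a tangle diagram with
`m` endpoints at the bottom and `n` endpoints at the top.  In `cons`, `k` is the number of vertical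
strands on the right of the piece. -/
inductive IsDiagram : ℕ → List Slice → ℕ → Prop where
  | nil (n : ℕ) : IsDiagram n [] n
  | cons (e : Piece) (i k : ℕ) (w : List Slice) (n : ℕ) (h : IsDiagram (i + e.top + k) w n) :
      IsDiagram (i + e.bot + k) (⟨e, i⟩ :: w) n

theorem IsDiagram.append {l m n : ℕ} {u v : List Slice} (hu : IsDiagram l u m)
    (hv : IsDiagram m v n) : IsDiagram l (u ++ v) n := by
  induction hu with
  | nil _ => exact hv
  | cons e i k w n _ ih => exact IsDiagram.cons e i k _ _ (ih hv)

theorem IsDiagram.cons' {m m' n : ℕ} (e : Piece) (i k : ℕ) {w : List Slice}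
    (h : IsDiagram m' w n) (hm : m = i + e.bot + k) (hm' : m' = i + e.top + k) :
    IsDiagram m (⟨e, i⟩ :: w) n := by
  subst hm hm'
  exact IsDiagram.cons e i k w n h

/-- Tangle diagrams with `m` endpoints at the bottom and `n` endpoints at the top. -/
structure Diagram (m n : ℕ) where
  word : List Slice
  valid : IsDiagram m word n

/-- Stacking: `D.comp E` is `D` with `E` put on top of it. -/
def Diagram.comp {l m n : ℕ} (D : Diagram l m) (E : Diagram m n) : Diagram l n :=
  ⟨D.word ++ E.word, D.valid.append E.valid⟩

/-- The local moves on sliced diagrams. -/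
inductive LocalMove : List Slice → List Slice → Prop where
  /-- Planar isotopy: pieces that lie side by side may be slid past each other in height. -/
  | exchange (e f : Piece) (i k : ℕ) :
      LocalMove [⟨e, i⟩, ⟨f, i + e.top + k⟩] [⟨f, i + e.bot + k⟩, ⟨e, i⟩]
  /-- Planar isotopy: straightening a strand. -/
  | zigzag_left (i : ℕ) : LocalMove [cup i, cap (i + 1)] []
  | zigzag_right (i : ℕ) : LocalMove [cup (i + 1), cap i] []
  /-- Planar isotopy: turning a crossing between a strand and a minimum or a maximum. -/
  | cup_pos (i : ℕ) : LocalMove [cup i, pos (i + 1)] [cup (i + 1), neg i]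
  | cup_neg (i : ℕ) : LocalMove [cup i, neg (i + 1)] [cup (i + 1), pos i]
  | cap_pos (i : ℕ) : LocalMove [pos (i + 1), cap i] [neg i, cap (i + 1)]
  | cap_neg (i : ℕ) : LocalMove [neg (i + 1), cap i] [pos i, cap (i + 1)]
  /-- First Reidemeister move. -/
  | r1_cup_pos (i : ℕ) : LocalMove [cup i, pos i] [cup i]
  | r1_cup_neg (i : ℕ) : LocalMove [cup i, neg i] [cup i]
  | r1_cap_pos (i : ℕ) : LocalMove [pos i, cap i] [cap i]
  | r1_cap_neg (i : ℕ) : LocalMove [neg i, cap i] [cap i]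
  /-- Second Reidemeister move. -/
  | r2_pos_neg (i : ℕ) : LocalMove [pos i, neg i] []
  | r2_neg_pos (i : ℕ) : LocalMove [neg i, pos i] []
  /-- Third Reidemeister move. -/
  | r3 (i : ℕ) : LocalMove [pos i, pos (i + 1), pos i] [pos (i + 1), pos i, pos (i + 1)]

/-- `E` is obtained from `D` by replacing one block of slices according to a local move. -/
def Step {m n : ℕ} (D E : Diagram m n) : Prop :=
  ∃ u l r v : List Slice, LocalMove l r ∧ D.word = u ++ l ++ v ∧ E.word = u ++ r ++ v

/-- Isotopy of tangle diagrams (relative to the endpoints): finitely many local moves and inverses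
of local moves. -/
def isotopy (m n : ℕ) : Setoid (Diagram m n) := Relation.EqvGen.setoid Step

/-- Unoriented links in the 3-sphere up to equivalence: closed diagrams up to isotopy. -/
def Link : Type := Quotient (isotopy 0 0)

/-- The link represented by a closed diagram. -/
def Diagram.link (D : Diagram 0 0) : Link := Quotient.mk (isotopy 0 0) D

/-- The closure of a diagram with one endpoint at the bottom and one at the top: these two endpoints
are joined by an arc which runs on the right of the diagram. -/
def Diagram.closure (t : Diagram 1 1) : Diagram 0 0 :=
  ⟨cup 0 :: (t.word ++ [cap 0]), by
    refine IsDiagram.cons' Piece.cup 0 0 (m' := 2) ?_ rfl rfl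
    have key : ∀ {a : ℕ} {w : List Slice} {b : ℕ}, IsDiagram a w b →
        IsDiagram (a + 1) w (b + 1) := by
      intro a w b h
      induction h with
      | nil _ => exact IsDiagram.nil _
      | cons e i k w n _ ih =>
        exact IsDiagram.cons' e i (k + 1) ih (by omega) (by omega)
    exact (key t.valid).append (IsDiagram.cons' Piece.cap 0 0 (IsDiagram.nil 0) rfl rfl)⟩

/-- The unknot: a circle without crossings. -/
def unknot : Link := (Diagram.closure ⟨[], IsDiagram.nil 1⟩).link

/-- `K` is a connected sum of `K₁` and `K₂`: some sphere meets `K` in two points, and closing up the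
two tangles into which it cuts `K` gives `K₁` and `K₂`.  (For links this depends on the choice of the
components that are joined and of the way of joining them; all choices are allowed.) -/
def IsConnectedSum (K₁ K₂ K : Link) : Prop :=
  ∃ s t : Diagram 1 1, s.closure.link = K₁ ∧ t.closure.link = K₂ ∧ (s.comp t).closure.link = K

/-- Band surgery on diagrams: somewhere in `D` two neighbouring parallel vertical strands are replaced
by a maximum with a minimum above it. -/
def Smooth (D E : Diagram 0 0) : Prop :=
  ∃ (u v : List Slice) (i : ℕ), D.word = u ++ v ∧ E.word = u ++ [cap i, cup i] ++ v

/-- `K` and `K'` are related by one H(2)-move (which may be performed in either direction, on any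
diagrams of the links). -/
def HTwoMove (K K' : Link) : Prop :=
  ∃ D E : Diagram 0 0, D.link = K ∧ E.link = K' ∧ (Smooth D E ∨ Smooth E D)

/-- `K'` is obtained from `K` by a sequence of exactly `n` H(2)-moves. -/
def HTwoReach : ℕ → Link → Link → Prop
  | 0, K, K' => K = K'
  | n + 1, K, K' => ∃ K'' : Link, HTwoMove K K'' ∧ HTwoReach n K'' K'

/-- The H(2)-unknotting number: the minimal number of H(2)-moves that change `K` into the unknot
(infinite if there were no such sequence of moves). -/
noncomputable def unknottingNumber (K : Link) : ℕ∞ :=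
  ⨅ (n : ℕ) (_ : HTwoReach n K unknot), (n : ℕ∞)

/-- `a` half twists of the strands in positions `i` and `i + 1`; `-a` mirror-image half twists if
`a` is negative. -/
def halfTwists (i : ℕ) (a : ℤ) : List Slice :=
  if 0 ≤ a then List.replicate a.natAbs (pos i) else List.replicate a.natAbs (neg i)

theorem isDiagram_halfTwists (i k : ℕ) (a : ℤ) :
    IsDiagram (i + 2 + k) (halfTwists i a) (i + 2 + k) := by
  unfold halfTwists
  generalize a.natAbs = c
  split
  · induction c with
    | zero => exact IsDiagram.nil _
    | succ c ih => exact IsDiagram.cons Piece.pos i k _ _ ih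
  · induction c with
    | zero => exact IsDiagram.nil _
    | succ c ih => exact IsDiagram.cons Piece.neg i k _ _ ih

/-- The slices of the rational tangle with four endpoints at the top.  The twists
`a₁, a₂, a₃, …` are listed from the outside to the inside and are applied alternately to the strands
in positions `0, 1` and `1, 2`, in such a way that the diagram is alternating if all `aᵢ` have the same
sign.  The Boolean says whether the next twists are those of positions `0, 1`.  The innermost tangle
is the crossingless one on which the next twists would have no effect. -/
def rationalWord : Bool → List ℤ → List Slice
  | true, [] => [cup 0, cup 2]
  | false, [] => [cup 0, cup 1]
  | true, a :: l => rationalWord false l ++ halfTwists 0 a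
  | false, a :: l => rationalWord true l ++ halfTwists 1 (-a)

theorem isDiagram_rationalWord (l : List ℤ) (b : Bool) : IsDiagram 0 (rationalWord b l) 4 := by
  induction l generalizing b with
  | nil =>
    cases b
    · exact IsDiagram.cons' Piece.cup 0 0 (IsDiagram.cons' (m' := 4) Piece.cup 1 1
        (IsDiagram.nil 4) rfl rfl) rfl rfl
    · exact IsDiagram.cons' Piece.cup 0 0 (IsDiagram.cons' (m' := 4) Piece.cup 2 0
        (IsDiagram.nil 4) rfl rfl) rfl rfl
  | cons a l ih =>
    cases b
    · exact (ih true).append (isDiagram_halfTwists 1 1 (-a))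
    · exact (ih false).append (isDiagram_halfTwists 0 2 a)

/-- The rational tangle with Conway notation `(a₁, …, aₙ)`. -/
def rationalTangle (l : List ℤ) : Diagram 0 4 :=
  ⟨rationalWord true l, isDiagram_rationalWord l true⟩

/-- The trivial tangle `T₀`: two arcs without crossings, joining the endpoints `0, 1` and the endpoints
`2, 3`.  It is the tangle on which the outermost twists `a₁` of a rational tangle have no effect, and
corresponds to the fraction `1/0`. -/
def trivialTangle : Diagram 0 4 :=
  ⟨[cup 0, cup 2], IsDiagram.cons' Piece.cup 0 0 (IsDiagram.cons' (m' := 4) Piece.cup 2 0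
        (IsDiagram.nil 4) rfl rfl) rfl rfl⟩

/-- The two nested maxima that close a rational tangle to a 2-bridge link; they join the endpoints
`0, 3` and the endpoints `1, 2`. -/
def nestedCaps : Diagram 4 0 :=
  ⟨[cap 1, cap 0], IsDiagram.cons' (m' := 2) Piece.cap 1 1 (IsDiagram.cons' Piece.cap 0 0
        (IsDiagram.nil 0) rfl rfl) rfl rfl⟩

/-- The diagram `C(a₁, …, aₙ)`. -/
def conwayDiagram (l : List ℤ) : Diagram 0 0 := (rationalTangle l).comp nestedCaps

/-- Numerator and denominator of the continued fraction
`[a₁, …, aₙ] = a₁ + 1 / (a₂ + ⋯ + 1 / aₙ)`; a denominator `0` stands for the value `∞ = 1/0`, which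
is also the value of the empty continued fraction. -/
def contFrac : List ℤ → ℤ × ℤ
  | [] => (1, 0)
  | a :: l => (a * (contFrac l).1 + (contFrac l).2, (contFrac l).1)

/-- `p` and `q` are coprime and `p / q = [a₁, …, aₙ]`. -/
def IsContFrac (p q : ℤ) (l : List ℤ) : Prop :=
  IsCoprime p q ∧ p * (contFrac l).2 = q * (contFrac l).1

/-- `K` is the 2-bridge link `S(p, q)`. -/
def IsTwoBridge (p q : ℤ) (K : Link) : Prop :=
  ∃ l : List ℤ, IsContFrac p q l ∧ (conwayDiagram l).link = K

/-- `K` is a `(p, q)`-tangle unknotting number one link: it decomposes into a rational tangle with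
`p / q = [a₁, …, aₙ]` and a tangle `T` such that replacing the rational tangle by `T₀` gives the
unknot. -/
def IsTangleUnknottingOne (p q : ℤ) (K : Link) : Prop :=
  ∃ (l : List ℤ) (T : Diagram 4 0), IsContFrac p q l ∧
    ((rationalTangle l).comp T).link = K ∧ (trivialTangle.comp T).link = unknot

end HTwo

namespace HTwo

/-! ### Sliced words and their isotopies -/

/-! Diagrams are read upwards and products are stackings.

Upper bound. The rational tangle of fraction p/q is T₀·β for a braid β on the first three of four
strands (`exists_isThreeBraid`), so K₂ is T₀·β·T, where T₀·T is the unknot. By the classification of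
rational tangles by fractions and by flypes, S(q,p) is T₀·β⁻¹ closed by two maxima
(`iso_conwayDiagram`). Put this diagram below that of K₂ and join one of its maxima to a minimum of
K₂. The sum is T₀·β⁻¹·cap·cup·β·T, where the cap and the cup are the other maximum and minimum. The
band surgery that replaces cap·cup by two vertical strands lets β⁻¹β cancel and leaves T₀·T, the
unknot (`hTwoMove_of_isConnectedSum`).

All connected sums have this form. A choice of summing point and direction is a `Mark`, and two
marks are equivalent if tying any 1-1 tangle into them gives isotopic diagrams. Marks slide along
strands and are carried along by isotopies (`Mark.exists_equiv_of_iso`). On a 2-bridge link all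
marks are equivalent, by the symmetries of rational tangles (`Mark.equiv_maxima`). On K₂ every mark
slides to a minimum of T₀: otherwise T would have a closed component, and T₀·T would have more than
two colourings modulo 2, which the unknot does not (`Mark.exists_equiv_boundary`).

Lower bound. Suppose the sum is the unknot. A 1-1 tangle returns the colour that enters it, so
numbers of Fox colourings multiply in a connected sum for each fixed colour at the joint; hence a
summand of the unknot has at most n colourings modulo n. But S(q,p) has n² of them when n divides q.
So q = ±1 (`natAbs_eq_one_of_isConnectedSum`), K₁ is trivial, and the sum is K₂, which is then
trivial too, against the assumption. -/

theorem isDiagram_nil_iff {m n : ℕ} : IsDiagram m [] n ↔ m = n := by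
  constructor
  · intro h; cases h; rfl
  · rintro rfl; exact IsDiagram.nil _

theorem isDiagram_cons_iff {m n : ℕ} {e : Piece} {i : ℕ} {w : List Slice} :
    IsDiagram m (⟨e, i⟩ :: w) n ↔
      i + e.bot ≤ m ∧ IsDiagram (m - e.bot + e.top) w n := by
  constructor
  · intro h
    cases h with
    | cons e i k w n h =>
      refine ⟨by omega, ?_⟩
      have : i + e.bot + k - e.bot + e.top = i + e.top + k := by omega
      rw [this]; exact h
  · rintro ⟨h1, h2⟩
    exact IsDiagram.cons' e i (m - (i + e.bot)) h2 (by omega) (by omega)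

@[simp] theorem bot_cup : Piece.cup.bot = 0 := rfl
@[simp] theorem bot_cap : Piece.cap.bot = 2 := rfl
@[simp] theorem bot_pos : Piece.pos.bot = 2 := rfl
@[simp] theorem bot_neg : Piece.neg.bot = 2 := rfl
@[simp] theorem top_cup : Piece.cup.top = 2 := rfl
@[simp] theorem top_cap : Piece.cap.top = 0 := rfl
@[simp] theorem top_pos : Piece.pos.top = 2 := rfl
@[simp] theorem top_neg : Piece.neg.top = 2 := rfl

theorem IsDiagram.unique {m n n' : ℕ} {w : List Slice} (h : IsDiagram m w n)
    (h' : IsDiagram m w n') : n = n' := by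
  induction w generalizing m with
  | nil => rw [isDiagram_nil_iff] at h h'; omega
  | cons s w ih =>
    obtain ⟨e, i⟩ := s
    rw [isDiagram_cons_iff] at h h'
    exact ih h.2 h'.2

theorem isDiagram_append_iff {m n : ℕ} {u v : List Slice} :
    IsDiagram m (u ++ v) n ↔ ∃ a, IsDiagram m u a ∧ IsDiagram a v n := by
  constructor
  · intro h
    induction u generalizing m with
    | nil => exact ⟨m, IsDiagram.nil m, h⟩
    | cons s w ih =>
      obtain ⟨e, i⟩ := s
      rw [List.cons_append, isDiagram_cons_iff] at h
      obtain ⟨a, h1, h2⟩ := ih h.2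
      exact ⟨a, isDiagram_cons_iff.2 ⟨h.1, h1⟩, h2⟩
  · rintro ⟨a, h1, h2⟩
    exact h1.append h2

theorem IsDiagram.add_right {m n : ℕ} {w : List Slice} (h : IsDiagram m w n) (k : ℕ) :
    IsDiagram (m + k) w (n + k) := by
  induction h with
  | nil _ => exact IsDiagram.nil _
  | cons e i j w n _ ih => exact IsDiagram.cons' e i (j + k) ih (by omega) (by omega)

/-- `shift k w` is `w` with `k` vertical strands added on the left. -/
def shift (k : ℕ) (w : List Slice) : List Slice := w.map fun s => ⟨s.piece, s.left + k⟩

@[simp] theorem shift_nil (k : ℕ) : shift k [] = [] := rfl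

@[simp] theorem shift_cons (k : ℕ) (e : Piece) (i : ℕ) (w : List Slice) :
    shift k (⟨e, i⟩ :: w) = ⟨e, i + k⟩ :: shift k w := rfl

@[simp] theorem shift_append (k : ℕ) (u v : List Slice) :
    shift k (u ++ v) = shift k u ++ shift k v := List.map_append

@[simp] theorem shift_zero (w : List Slice) : shift 0 w = w := by
  simp [shift]

theorem shift_shift (j k : ℕ) (w : List Slice) : shift j (shift k w) = shift (k + j) w := by
  simp [shift, Function.comp_def, add_assoc]

theorem IsDiagram.shift {m n : ℕ} {w : List Slice} (h : IsDiagram m w n) (k : ℕ) :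
    IsDiagram (m + k) (shift k w) (n + k) := by
  induction h with
  | nil _ => exact IsDiagram.nil _
  | cons e i j w n _ ih => exact IsDiagram.cons' e (i + k) j ih (by omega) (by omega)

/-! ### Isotopy of words with a fixed number of strands at the bottom -/

/-- One local move performed inside a word that starts with `m` strands. -/
def WStep (m : ℕ) (w w' : List Slice) : Prop :=
  ∃ (u l r v : List Slice) (a b : ℕ), LocalMove l r ∧ IsDiagram m u a ∧ IsDiagram a l b ∧
    IsDiagram a r b ∧ w = u ++ l ++ v ∧ w' = u ++ r ++ v

/-- Isotopy of words that start with `m` strands. -/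
def Iso (m : ℕ) : List Slice → List Slice → Prop := Relation.EqvGen (WStep m)

namespace Iso

variable {m n : ℕ} {w w' w'' : List Slice}

theorem refl (w : List Slice) : Iso m w w := Relation.EqvGen.refl w

theorem symm (h : Iso m w w') : Iso m w' w := Relation.EqvGen.symm _ _ h

theorem trans (h : Iso m w w') (h' : Iso m w' w'') : Iso m w w'' :=
  Relation.EqvGen.trans _ _ _ h h'

/-- Isotopies may be lifted along maps of words that respect local moves. -/
theorem lift {m' : ℕ} (f : List Slice → List Slice)
    (hf : ∀ x y, WStep m x y → Iso m' (f x) (f y)) (h : Iso m w w') : Iso m' (f w) (f w') := by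
  induction h with
  | rel x y h => exact hf x y h
  | refl x => exact refl _
  | symm x y _ ih => exact ih.symm
  | trans x y z _ _ ih1 ih2 => exact ih1.trans ih2

theorem append_right (h : Iso m w w') (v : List Slice) : Iso m (w ++ v) (w' ++ v) := by
  refine lift (· ++ v) ?_ h
  rintro x y ⟨u, l, r, v', a, b, hm, hu, hl, hr, rfl, rfl⟩
  exact Relation.EqvGen.rel _ _ ⟨u, l, r, v' ++ v, a, b, hm, hu, hl, hr, by simp, by simp⟩

theorem append_left {u : List Slice} (hu : IsDiagram m u n) (h : Iso n w w') :
    Iso m (u ++ w) (u ++ w') := by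
  refine lift (u ++ ·) ?_ h
  rintro x y ⟨u', l, r, v', a, b, hm, hu', hl, hr, rfl, rfl⟩
  exact Relation.EqvGen.rel _ _
    ⟨u ++ u', l, r, v', a, b, hm, hu.append hu', hl, hr, by simp, by simp⟩

theorem append_both {u : List Slice} (hu : IsDiagram m u n) (h : Iso n w w') (v : List Slice) :
    Iso m (u ++ (w ++ v)) (u ++ (w' ++ v)) :=
  append_left hu (h.append_right v)

theorem add_right (h : Iso m w w') (k : ℕ) : Iso (m + k) w w' := by
  refine lift id ?_ h
  rintro x y ⟨u', l, r, v', a, b, hm, hu', hl, hr, rfl, rfl⟩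
  exact Relation.EqvGen.rel _ _ ⟨u', l, r, v', a + k, b + k, hm, hu'.add_right k, hl.add_right k,
    hr.add_right k, rfl, rfl⟩

theorem mono (h : Iso m w w') (hmn : m ≤ n) : Iso n w w' := by
  obtain ⟨k, rfl⟩ := Nat.exists_eq_add_of_le hmn
  exact h.add_right k

end Iso

theorem LocalMove.shift_iso {l r : List Slice} (h : LocalMove l r) (k : ℕ) :
    LocalMove (shift k l) (shift k r) := by
  cases h with
  | exchange e f i j =>
    have h1 : i + e.top + j + k = i + k + e.top + j := by omega
    have h2 : i + e.bot + j + k = i + k + e.bot + j := by omega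
    simp only [shift_cons, shift_nil, h1, h2]
    exact LocalMove.exchange e f (i + k) j
  | zigzag_left i =>
    simp only [shift_cons, shift_nil, Nat.add_right_comm i 1 k]; exact LocalMove.zigzag_left _
  | zigzag_right i =>
    simp only [shift_cons, shift_nil, Nat.add_right_comm i 1 k]; exact LocalMove.zigzag_right _
  | cup_pos i =>
    simp only [shift_cons, shift_nil, Nat.add_right_comm i 1 k]; exact LocalMove.cup_pos _
  | cup_neg i =>
    simp only [shift_cons, shift_nil, Nat.add_right_comm i 1 k]; exact LocalMove.cup_neg _
  | cap_pos i =>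
    simp only [shift_cons, shift_nil, Nat.add_right_comm i 1 k]; exact LocalMove.cap_pos _
  | cap_neg i =>
    simp only [shift_cons, shift_nil, Nat.add_right_comm i 1 k]; exact LocalMove.cap_neg _
  | r1_cup_pos i => exact LocalMove.r1_cup_pos _
  | r1_cup_neg i => exact LocalMove.r1_cup_neg _
  | r1_cap_pos i => exact LocalMove.r1_cap_pos _
  | r1_cap_neg i => exact LocalMove.r1_cap_neg _
  | r2_pos_neg i => exact LocalMove.r2_pos_neg _
  | r2_neg_pos i => exact LocalMove.r2_neg_pos _
  | r3 i =>
    simp only [shift_cons, shift_nil, Nat.add_right_comm i 1 k]; exact LocalMove.r3 _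

theorem Iso.shift {m : ℕ} {w w' : List Slice} (h : Iso m w w') (k : ℕ) :
    Iso (m + k) (shift k w) (shift k w') := by
  refine Iso.lift (HTwo.shift k) ?_ h
  rintro x y ⟨u, l, r, v, a, b, hm, hu, hl, hr, rfl, rfl⟩
  exact Relation.EqvGen.rel _ _ ⟨HTwo.shift k u, HTwo.shift k l, HTwo.shift k r, HTwo.shift k v,
    a + k, b + k, hm.shift_iso k, hu.shift k, hl.shift k, hr.shift k, by simp, by simp⟩

theorem Iso.isDiagram_iff {m n : ℕ} {w w' : List Slice} (h : Iso m w w') :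
    IsDiagram m w n ↔ IsDiagram m w' n := by
  induction h with
  | rel x y h =>
    obtain ⟨u, l, r, v, a, b, -, hu, hl, hr, rfl, rfl⟩ := h
    simp only [isDiagram_append_iff]
    constructor
    · rintro ⟨b', ⟨a', h1, h2⟩, h3⟩
      obtain rfl := hu.unique h1
      obtain rfl := hl.unique h2
      exact ⟨_, ⟨_, hu, hr⟩, h3⟩
    · rintro ⟨b', ⟨a', h1, h2⟩, h3⟩
      obtain rfl := hu.unique h1
      obtain rfl := hr.unique h2
      exact ⟨_, ⟨_, hu, hl⟩, h3⟩
  | refl x => rfl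
  | symm x y _ ih => exact ih.symm
  | trans x y z _ _ ih1 ih2 => exact ih1.trans ih2

theorem Iso.isDiagram {m n : ℕ} {w w' : List Slice} (h : Iso m w w') (hw : IsDiagram m w n) :
    IsDiagram m w' n := h.isDiagram_iff.1 hw

theorem Iso.isotopy {m n : ℕ} {w w' : List Slice} (h : Iso m w w') (hw : IsDiagram m w n)
    (hw' : IsDiagram m w' n) : isotopy m n ⟨w, hw⟩ ⟨w', hw'⟩ := by
  induction h with
  | rel x y h =>
    obtain ⟨u, l, r, v, a, b, hm, -, -, -, rfl, rfl⟩ := h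
    exact Relation.EqvGen.rel _ _ ⟨u, l, r, v, hm, rfl, rfl⟩
  | refl x => exact Relation.EqvGen.refl _
  | symm x y _ ih => exact Relation.EqvGen.symm _ _ (ih hw' hw)
  | trans x y z h1 h2 ih1 ih2 =>
    exact Relation.EqvGen.trans _ _ _ (ih1 hw (Iso.isDiagram h1 hw))
      (ih2 (Iso.isDiagram h1 hw) hw')

/-- Both sides of a local move create and destroy the same number of endpoints on balance. This lets
a `Step`, which records no widths, be read as a `WStep`, which does. -/
theorem LocalMove.isDiagram_eq {l r : List Slice} (h : LocalMove l r) {a b b' : ℕ}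
    (hl : IsDiagram a l b) (hr : IsDiagram a r b') : b = b' := by
  have key : ∀ {w : List Slice} {a b : ℕ}, IsDiagram a w b →
      b + (w.map fun s => s.piece.bot).sum = a + (w.map fun s => s.piece.top).sum := by
    intro w a b h
    induction h with
    | nil _ => rfl
    | cons e i k w n _ ih => simp only [List.map_cons, List.sum_cons]; omega
  have h1 := key hl
  have h2 := key hr
  cases h <;> simp at h1 h2 <;> omega

theorem iso_of_isotopy {m n : ℕ} {D E : Diagram m n} (h : isotopy m n D E) :
    Iso m D.word E.word := by
  change Relation.EqvGen Step D E at h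
  induction h with
  | rel D E h =>
    obtain ⟨u, l, r, v, hm, hD, hE⟩ := h
    have h1 := D.valid
    have h2 := E.valid
    rw [hD, isDiagram_append_iff] at h1
    rw [hE, isDiagram_append_iff] at h2
    obtain ⟨b, h1, -⟩ := h1
    obtain ⟨b', h2, -⟩ := h2
    rw [isDiagram_append_iff] at h1 h2
    obtain ⟨a, hu, hl⟩ := h1
    obtain ⟨a', hu', hr⟩ := h2
    obtain rfl := hu.unique hu'
    obtain rfl := hm.isDiagram_eq hl hr
    exact Relation.EqvGen.rel _ _ ⟨u, l, r, v, a, b, hm, hu, hl, hr, hD, hE⟩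
  | refl x => exact Iso.refl _
  | symm x y _ ih => exact ih.symm
  | trans x y z _ _ ih1 ih2 => exact ih1.trans ih2

theorem link_eq_iff {D E : Diagram 0 0} : D.link = E.link ↔ Iso 0 D.word E.word := by
  constructor
  · intro h; exact iso_of_isotopy (Quotient.exact h)
  · intro h; exact Quotient.sound (h.isotopy D.valid E.valid)

/-- A local move in a word starting with enough strands. -/
theorem LocalMove.iso {l r : List Slice} (h : LocalMove l r) {m : ℕ} (b : ℕ)
    (hl : IsDiagram m l b) (hr : IsDiagram m r b) : Iso m l r :=
  Relation.EqvGen.rel _ _ ⟨[], l, r, [], m, b, h, IsDiagram.nil _, hl, hr, by simp, by simp⟩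

/-! ### The local moves with their width conditions -/

section moves
variable {m : ℕ}

theorem iso_exchange (e f : Piece) (i k : ℕ) (h : i + e.bot + k + f.bot ≤ m) :
    Iso m [⟨e, i⟩, ⟨f, i + e.top + k⟩] [⟨f, i + e.bot + k⟩, ⟨e, i⟩] := by
  refine (LocalMove.exchange e f i k).iso (m - e.bot - f.bot + e.top + f.top) ?_ ?_ <;>
  · simp only [isDiagram_cons_iff, isDiagram_nil_iff]; omega

theorem iso_zigzag_left (i : ℕ) (h : i + 1 ≤ m) : Iso m [cup i, cap (i + 1)] [] := by
  refine (LocalMove.zigzag_left i).iso m ?_ ?_ <;>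
  · simp [isDiagram_cons_iff, isDiagram_nil_iff]; try omega

theorem iso_zigzag_right (i : ℕ) (h : i + 1 ≤ m) : Iso m [cup (i + 1), cap i] [] := by
  refine (LocalMove.zigzag_right i).iso m ?_ ?_ <;>
  · simp [isDiagram_cons_iff, isDiagram_nil_iff]; try omega

theorem iso_cup_pos (i : ℕ) (h : i + 1 ≤ m) :
    Iso m [cup i, pos (i + 1)] [cup (i + 1), neg i] := by
  refine (LocalMove.cup_pos i).iso (m + 2) ?_ ?_ <;>
  · simp [isDiagram_cons_iff, isDiagram_nil_iff]; try omega

theorem iso_cup_neg (i : ℕ) (h : i + 1 ≤ m) :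
    Iso m [cup i, neg (i + 1)] [cup (i + 1), pos i] := by
  refine (LocalMove.cup_neg i).iso (m + 2) ?_ ?_ <;>
  · simp [isDiagram_cons_iff, isDiagram_nil_iff]; try omega

theorem iso_cap_pos (i : ℕ) (h : i + 3 ≤ m) :
    Iso m [pos (i + 1), cap i] [neg i, cap (i + 1)] := by
  refine (LocalMove.cap_pos i).iso (m - 2) ?_ ?_ <;>
  · simp [isDiagram_cons_iff, isDiagram_nil_iff]; try omega

theorem iso_r1_cup_pos (i : ℕ) (h : i ≤ m) : Iso m [cup i, pos i] [cup i] := by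
  refine (LocalMove.r1_cup_pos i).iso (m + 2) ?_ ?_ <;>
  · simp [isDiagram_cons_iff, isDiagram_nil_iff]; try omega

theorem iso_r1_cap_pos (i : ℕ) (h : i + 2 ≤ m) : Iso m [pos i, cap i] [cap i] := by
  refine (LocalMove.r1_cap_pos i).iso (m - 2) ?_ ?_ <;>
  · simp [isDiagram_cons_iff, isDiagram_nil_iff]; try omega

theorem iso_r1_cap_neg (i : ℕ) (h : i + 2 ≤ m) : Iso m [neg i, cap i] [cap i] := by
  refine (LocalMove.r1_cap_neg i).iso (m - 2) ?_ ?_ <;>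
  · simp [isDiagram_cons_iff, isDiagram_nil_iff]; try omega

theorem iso_pos_neg (i : ℕ) (h : i + 2 ≤ m) : Iso m [pos i, neg i] [] := by
  refine (LocalMove.r2_pos_neg i).iso m ?_ ?_ <;>
  · simp [isDiagram_cons_iff, isDiagram_nil_iff]; try omega

theorem iso_neg_pos (i : ℕ) (h : i + 2 ≤ m) : Iso m [neg i, pos i] [] := by
  refine (LocalMove.r2_neg_pos i).iso m ?_ ?_ <;>
  · simp [isDiagram_cons_iff, isDiagram_nil_iff]; try omega

theorem iso_r3 (i : ℕ) (h : i + 3 ≤ m) :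
    Iso m [pos i, pos (i + 1), pos i] [pos (i + 1), pos i, pos (i + 1)] := by
  refine (LocalMove.r3 i).iso m ?_ ?_ <;>
  · simp [isDiagram_cons_iff, isDiagram_nil_iff]; try omega

end moves

/-! ### Sliding distant pieces past each other -/

/-- One exchange per slice of `t`; `k` counts the strands between `t` and the piece, a number that
does not change on the way. -/
theorem iso_slice_right {a b : ℕ} {t : List Slice} (ht : IsDiagram a t b) (f : Piece) (k : ℕ)
    {m : ℕ} (hm : a + k + f.bot ≤ m) :
    Iso m (t ++ [⟨f, b + k⟩]) (⟨f, a + k⟩ :: t) := by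
  induction ht generalizing m with
  | nil _ => exact Iso.refl _
  | cons e i j w n _ ih =>
    have h1 := ih (m := m - e.bot + e.top) (by omega)
    have hd : IsDiagram m [⟨e, i⟩] (m - e.bot + e.top) := by
      rw [isDiagram_cons_iff, isDiagram_nil_iff]; omega
    refine (Iso.append_left hd h1).trans ?_
    have h2 := (iso_exchange (m := m) e f i (j + k) (by omega)).append_right w
    simpa only [List.cons_append, List.nil_append, add_assoc] using h2

theorem iso_slice_left {a b : ℕ} {t : List Slice} (ht : IsDiagram a t b) (e : Piece) (i k : ℕ)
    {m : ℕ} (hm : i + e.bot + k + a ≤ m) :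
    Iso m (⟨e, i⟩ :: shift (i + e.top + k) t) (shift (i + e.bot + k) t ++ [⟨e, i⟩]) := by
  induction ht generalizing m with
  | nil _ => exact Iso.refl _
  | cons f j l w n _ ih =>
    have h1 := ih (m := m - f.bot + f.top) (by omega)
    have hd : IsDiagram m [⟨f, j + (i + e.bot + k)⟩] (m - f.bot + f.top) := by
      rw [isDiagram_cons_iff, isDiagram_nil_iff]; omega
    refine Iso.trans ?_ (Iso.append_left hd h1 : Iso m ([_] ++ _) ([_] ++ _))
    have h2 := (iso_exchange (m := m) e f i (j + k) (by omega)).append_right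
      (shift (i + e.top + k) w)
    have e1 : i + e.top + (j + k) = j + (i + e.top + k) := by omega
    have e2 : i + e.bot + (j + k) = j + (i + e.bot + k) := by omega
    rw [e1, e2] at h2
    exact h2

/-! ### Turning a diagram upside down and reflecting it in the plane of projection -/

/-- The piece seen after a rotation by `π` about a horizontal axis. -/
def Piece.dual : Piece → Piece
  | cup => cap
  | cap => cup
  | pos => pos
  | neg => neg

/-- The piece with its crossing changed. -/
def Piece.mirror : Piece → Piece
  | cup => cup
  | cap => cap
  | pos => neg
  | neg => pos

@[simp] theorem Piece.dual_dual (e : Piece) : e.dual.dual = e := by cases e <;> rfl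
@[simp] theorem Piece.bot_dual (e : Piece) : e.dual.bot = e.top := by cases e <;> rfl
@[simp] theorem Piece.top_dual (e : Piece) : e.dual.top = e.bot := by cases e <;> rfl
@[simp] theorem Piece.mirror_mirror (e : Piece) : e.mirror.mirror = e := by cases e <;> rfl
@[simp] theorem Piece.bot_mirror (e : Piece) : e.mirror.bot = e.bot := by cases e <;> rfl
@[simp] theorem Piece.top_mirror (e : Piece) : e.mirror.top = e.top := by cases e <;> rfl

/-- The word rotated by `π` about a horizontal axis. -/
def flip (w : List Slice) : List Slice := (w.map fun s => ⟨s.piece.dual, s.left⟩).reverse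

@[simp] theorem flip_nil : flip [] = [] := rfl
@[simp] theorem flip_cons (e : Piece) (i : ℕ) (w : List Slice) :
    flip (⟨e, i⟩ :: w) = flip w ++ [⟨e.dual, i⟩] := by simp [flip]
@[simp] theorem flip_append (u v : List Slice) : flip (u ++ v) = flip v ++ flip u := by simp [flip]

/-- The mirror image of a word in the plane of projection. -/
def mirror (w : List Slice) : List Slice := w.map fun s => ⟨s.piece.mirror, s.left⟩

@[simp] theorem mirror_nil : mirror [] = [] := rfl
@[simp] theorem mirror_cons (e : Piece) (i : ℕ) (w : List Slice) :
    mirror (⟨e, i⟩ :: w) = ⟨e.mirror, i⟩ :: mirror w := rfl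
@[simp] theorem mirror_append (u v : List Slice) : mirror (u ++ v) = mirror u ++ mirror v := by
  simp [mirror]
@[simp] theorem mirror_mirror (w : List Slice) : mirror (mirror w) = w := by
  simp [mirror, Function.comp_def]
theorem mirror_shift (k : ℕ) (w : List Slice) : mirror (shift k w) = shift k (mirror w) := by
  simp [mirror, shift, Function.comp_def]

theorem IsDiagram.flip {m n : ℕ} {w : List Slice} (h : IsDiagram m w n) :
    IsDiagram n (flip w) m := by
  induction h with
  | nil _ => exact IsDiagram.nil _
  | cons e i k w n _ ih =>
    rw [flip_cons]
    exact ih.append (IsDiagram.cons' _ i k (IsDiagram.nil _) (by simp) (by simp))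

theorem IsDiagram.mirror {m n : ℕ} {w : List Slice} (h : IsDiagram m w n) :
    IsDiagram m (mirror w) n := by
  induction h with
  | nil _ => exact IsDiagram.nil _
  | cons e i k w n _ ih => exact IsDiagram.cons' _ i k ih (by simp) (by simp)

theorem LocalMove.flip {l r : List Slice} (h : LocalMove l r) :
    LocalMove (flip l) (flip r) ∨ LocalMove (flip r) (flip l) := by
  cases h with
  | exchange e f i k =>
    right
    have := LocalMove.exchange e.dual f.dual i k
    simpa using this
  | zigzag_left i => left; exact LocalMove.zigzag_right i
  | zigzag_right i => left; exact LocalMove.zigzag_left i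
  | cup_pos i => left; exact LocalMove.cap_pos i
  | cup_neg i => left; exact LocalMove.cap_neg i
  | cap_pos i => left; exact LocalMove.cup_pos i
  | cap_neg i => left; exact LocalMove.cup_neg i
  | r1_cup_pos i => left; exact LocalMove.r1_cap_pos i
  | r1_cup_neg i => left; exact LocalMove.r1_cap_neg i
  | r1_cap_pos i => left; exact LocalMove.r1_cup_pos i
  | r1_cap_neg i => left; exact LocalMove.r1_cup_neg i
  | r2_pos_neg i => left; exact LocalMove.r2_neg_pos i
  | r2_neg_pos i => left; exact LocalMove.r2_pos_neg i
  | r3 i => left; exact LocalMove.r3 i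

theorem Iso.flip {m n : ℕ} {w w' : List Slice} (h : Iso m w w') (hw : IsDiagram m w n) :
    Iso n (flip w) (flip w') := by
  induction h with
  | rel x y h =>
    obtain ⟨u, l, r, v, a, b, hm, hu, hl, hr, rfl, rfl⟩ := h
    rw [isDiagram_append_iff] at hw
    obtain ⟨b', h1, hv⟩ := hw
    obtain rfl := h1.unique (hu.append hl)
    rcases hm.flip with h | h
    · exact Relation.EqvGen.rel _ _ ⟨HTwo.flip v, _, _, HTwo.flip u, _, _, h, hv.flip, hl.flip,
        hr.flip, by simp, by simp⟩
    · exact Relation.EqvGen.symm _ _ (Relation.EqvGen.rel _ _ ⟨HTwo.flip v, _, _, HTwo.flip u, _, _,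
        h, hv.flip, hr.flip, hl.flip, by simp, by simp⟩)
  | refl x => exact Iso.refl _
  | symm x y h ih => exact (ih (Iso.isDiagram (Iso.symm h) hw)).symm
  | trans x y z h1 h2 ih1 ih2 => exact (ih1 hw).trans (ih2 (Iso.isDiagram h1 hw))

/-! ### Braid words -/

/-- All pieces of the word are crossings. -/
def IsBraid (w : List Slice) : Prop := ∀ s ∈ w, s.piece = Piece.pos ∨ s.piece = Piece.neg

theorem IsBraid.mirror {w : List Slice} (h : IsBraid w) : IsBraid (mirror w) := by
  intro s hs
  simp only [HTwo.mirror, List.mem_map] at hs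
  obtain ⟨s', hs', rfl⟩ := hs
  rcases h s' hs' with h | h <;> simp [h, Piece.mirror]

theorem IsBraid.reverse {w : List Slice} (h : IsBraid w) : IsBraid w.reverse :=
  fun s hs => h s (List.mem_reverse.1 hs)

/-- The inverse braid word. -/
def inv (w : List Slice) : List Slice := (mirror w).reverse

@[simp] theorem inv_cons (e : Piece) (i : ℕ) (w : List Slice) :
    inv (⟨e, i⟩ :: w) = inv w ++ [⟨e.mirror, i⟩] := by simp [inv]
@[simp] theorem inv_inv (w : List Slice) : inv (inv w) = w := by
  simp [inv, mirror, Function.comp_def]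

theorem IsBraid.inv {w : List Slice} (h : IsBraid w) : IsBraid (inv w) := h.mirror.reverse

theorem IsBraid.isDiagram_inv {w : List Slice} (h : IsBraid w) {m n : ℕ} (hw : IsDiagram m w n) :
    n = m ∧ IsDiagram m (HTwo.inv w) m := by
  induction hw with
  | nil _ => exact ⟨rfl, IsDiagram.nil _⟩
  | cons e i k w n _ ih =>
    have he : e.bot = 2 ∧ e.top = 2 := by
      rcases h ⟨e, i⟩ (by simp) with h | h <;> simp only at h <;> subst h <;> simp
    obtain ⟨rfl, h2⟩ := ih fun s hs => h s (by simp [hs])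
    rw [inv_cons]
    refine ⟨by omega, ?_⟩
    have := h2.append (IsDiagram.cons' (m' := i + 2 + k) e.mirror i k (IsDiagram.nil _)
      (by simp [he]) (by simp [he]))
    simpa [he] using this

theorem IsBraid.iso_append_inv {w : List Slice} (h : IsBraid w) {m n : ℕ}
    (hw : IsDiagram m w n) : Iso m (w ++ HTwo.inv w) [] := by
  induction hw with
  | nil _ => exact Iso.refl _
  | cons e i k w n hd ih =>
    have h1 := ih fun s hs => h s (by simp [hs])
    rw [inv_cons]
    have hd : IsDiagram (i + e.bot + k) [⟨e, i⟩] (i + e.top + k) :=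
      IsDiagram.cons _ _ _ _ _ (IsDiagram.nil _)
    have h2 := Iso.append_both hd h1 [⟨e.mirror, i⟩]
    have h3 : Iso (i + e.bot + k) [⟨e, i⟩, ⟨e.mirror, i⟩] [] := by
      rcases h ⟨e, i⟩ (by simp) with h | h <;> simp only at h <;> subst h
      · exact iso_pos_neg i (by simp)
      · exact iso_neg_pos i (by simp)
    simpa using h2.trans h3

theorem IsBraid.iso_inv_append {w : List Slice} (h : IsBraid w) {m n : ℕ}
    (hw : IsDiagram m w n) : Iso m (HTwo.inv w ++ w) [] := by
  simpa using h.inv.iso_append_inv (h.isDiagram_inv hw).2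

theorem Iso.cancel_right {m n k : ℕ} {u v w : List Slice} (hw : IsBraid w) (hu : IsDiagram m u n)
    (hv : IsDiagram m v n) (hwd : IsDiagram n w k) (h : Iso m (u ++ w) (v ++ w)) : Iso m u v := by
  have h1 := hw.iso_append_inv hwd
  have h2 := (Iso.append_left hu h1).symm
  have h3 := Iso.append_left hv h1
  have h4 := h.append_right (HTwo.inv w)
  simp only [List.append_nil, List.append_assoc] at h2 h3 h4
  exact h2.trans (h4.trans h3)

/-- The third Reidemeister move with mixed signs comes from the positive one by multiplying with an
inverse crossing at each end and cancelling. -/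
theorem iso_pos_pos_neg {m : ℕ} (i : ℕ) (h : i + 3 ≤ m) :
    Iso m [pos i, pos (i + 1), neg i] [neg (i + 1), pos i, pos (i + 1)] := by
  have hd : IsDiagram m [pos (i + 1), pos i, pos (i + 1)] m := by
    simp [isDiagram_cons_iff, isDiagram_nil_iff]; omega
  have hd1 : IsDiagram m [neg (i + 1)] m := by
    simp [isDiagram_cons_iff, isDiagram_nil_iff]; omega
  have hd2 : IsDiagram m [pos i, pos (i + 1)] m := by
    simp [isDiagram_cons_iff, isDiagram_nil_iff]; omega
  have h1 : Iso m [neg (i + 1), pos (i + 1), pos i, pos (i + 1), neg i]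
      [neg (i + 1), pos i, pos (i + 1), pos i, neg i] :=
    Iso.append_both hd1 (iso_r3 i h).symm [neg i]
  have h2 : Iso m [neg (i + 1), pos (i + 1), pos i, pos (i + 1), neg i]
      [pos i, pos (i + 1), neg i] :=
    (iso_neg_pos (i + 1) (by omega)).append_right _
  have h3 : Iso m [neg (i + 1), pos i, pos (i + 1), pos i, neg i]
      [neg (i + 1), pos i, pos (i + 1)] :=
    Iso.append_left (hd1.append hd2) (iso_pos_neg i (by omega))
  exact h2.symm.trans (h1.trans h3)

/-- The left side is inverse to one side of the positive relation and the right side to the other,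
so both cancel against the same word. This is the one case in which the mirror image of a local move
is not itself a local move. -/
theorem iso_r3_neg {m : ℕ} (i : ℕ) (h : i + 3 ≤ m) :
    Iso m [neg i, neg (i + 1), neg i] [neg (i + 1), neg i, neg (i + 1)] := by
  have hb : IsBraid [pos i, pos (i + 1), pos i] := by intro s hs; fin_cases hs <;> simp
  refine Iso.cancel_right (n := m) (k := m) hb ?_ ?_ ?_ ?_
  · simp [isDiagram_cons_iff, isDiagram_nil_iff]; omega
  · simp [isDiagram_cons_iff, isDiagram_nil_iff]; omega
  · simp [isDiagram_cons_iff, isDiagram_nil_iff]; omega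
  · have hd : IsDiagram m [neg (i + 1), neg i, neg (i + 1)] m := by
      simp [isDiagram_cons_iff, isDiagram_nil_iff]; omega
    have h1 := hb.iso_inv_append (m := m) (n := m)
      (by simp [isDiagram_cons_iff, isDiagram_nil_iff]; omega)
    have hb' : IsBraid [pos (i + 1), pos i, pos (i + 1)] := by intro s hs; fin_cases hs <;> simp
    have h2 := hb'.iso_inv_append (m := m) (n := m)
      (by simp [isDiagram_cons_iff, isDiagram_nil_iff]; omega)
    exact h1.trans (h2.symm.trans (Iso.append_left hd (iso_r3 i h).symm))

theorem LocalMove.mirror {l r : List Slice} (h : LocalMove l r) {a b : ℕ}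
    (hl : IsDiagram a l b) (hr : IsDiagram a r b) : Iso a (mirror l) (mirror r) := by
  have hl' := hl.mirror
  have hr' := hr.mirror
  cases h with
  | exchange e f i k =>
    have := LocalMove.exchange e.mirror f.mirror i k
    refine LocalMove.iso ?_ b hl' hr'
    simpa using this
  | zigzag_left i => exact LocalMove.iso (.zigzag_left i) b hl' hr'
  | zigzag_right i => exact LocalMove.iso (.zigzag_right i) b hl' hr'
  | cup_pos i => exact LocalMove.iso (.cup_neg i) b hl' hr'
  | cup_neg i => exact LocalMove.iso (.cup_pos i) b hl' hr'
  | cap_pos i => exact LocalMove.iso (.cap_neg i) b hl' hr'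
  | cap_neg i => exact LocalMove.iso (.cap_pos i) b hl' hr'
  | r1_cup_pos i => exact LocalMove.iso (.r1_cup_neg i) b hl' hr'
  | r1_cup_neg i => exact LocalMove.iso (.r1_cup_pos i) b hl' hr'
  | r1_cap_pos i => exact LocalMove.iso (.r1_cap_neg i) b hl' hr'
  | r1_cap_neg i => exact LocalMove.iso (.r1_cap_pos i) b hl' hr'
  | r2_pos_neg i => exact LocalMove.iso (.r2_neg_pos i) b hl' hr'
  | r2_neg_pos i => exact LocalMove.iso (.r2_pos_neg i) b hl' hr'
  | r3 i =>
    simp [isDiagram_cons_iff] at hl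
    exact iso_r3_neg i (by omega)

theorem Iso.mirror {m : ℕ} {w w' : List Slice} (h : Iso m w w') :
    Iso m (mirror w) (mirror w') := by
  refine Iso.lift HTwo.mirror ?_ h
  rintro x y ⟨u, l, r, v, a, b, hm, hu, hl, hr, rfl, rfl⟩
  simp only [mirror_append, List.append_assoc]
  exact Iso.append_both hu.mirror (hm.mirror hl hr) _

/-! ### A strand passing over or under a tangle -/

/-- The leftmost strand passes over the next `n` strands. -/
def posRun (n : ℕ) : List Slice := (List.range n).map pos

theorem posRun_succ (n : ℕ) : posRun (n + 1) = posRun n ++ [pos n] := by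
  simp [posRun, List.range_succ]

theorem posRun_add (n k : ℕ) : posRun (n + k) = posRun n ++ shift n (posRun k) := by
  induction k with
  | zero => simp [posRun]
  | succ k ih => rw [← add_assoc, posRun_succ, ih, posRun_succ]; simp [add_comm]

theorem isDiagram_posRun (n : ℕ) : IsDiagram (n + 1) (posRun n) (n + 1) := by
  induction n with
  | zero => exact IsDiagram.nil _
  | succ n ih =>
    rw [posRun_succ]
    exact (ih.add_right 1).append (IsDiagram.cons' _ n 0 (IsDiagram.nil _) (by simp) (by simp))

/-- The run is cut into its crossings with the strands to the left of the piece, at the piece, and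
to the right of it. The outer parts pass the piece by planar isotopy; only the middle part uses
Reidemeister moves. -/
theorem iso_slice_posRun (e : Piece) (i k : ℕ) :
    Iso (i + e.bot + k + 1) (⟨e, i + 1⟩ :: posRun (i + e.top + k))
      (posRun (i + e.bot + k) ++ [⟨e, i⟩]) := by
  have hi := isDiagram_posRun i
  have hR : IsDiagram (i + e.bot + k + 1) (posRun i) (i + e.bot + k + 1) := by
    have := hi.add_right (e.bot + k)
    convert this using 1 <;> omega
  have hB : IsDiagram (i + e.bot + k + 1) (shift i (posRun e.bot)) (i + e.bot + k + 1) := by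
    have := ((isDiagram_posRun e.bot).shift i).add_right k
    convert this using 1 <;> omega
  have h1 := (iso_slice_right (m := i + e.bot + k + 1) hi e 0 (by omega)).symm
  -- For a minimum or a maximum, turning a crossing creates a pair removed by the second
  -- Reidemeister move; for the two crossings this is the third move with equal and with mixed
  -- signs.
  have core : Iso (i + e.bot + k + 1) ([⟨e, i + 1⟩] ++ shift i (posRun e.top))
      (shift i (posRun e.bot) ++ [⟨e, i⟩]) := by
    cases e
    · have a := (iso_cup_neg (m := i + k + 1) i (by omega)).append_right [pos (i + 1)]
      have b : Iso (i + k + 1) ([cup i] ++ [neg (i + 1), pos (i + 1)]) ([cup i] ++ []) :=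
        Iso.append_left (n := i + k + 3)
          (by simp [isDiagram_cons_iff, isDiagram_nil_iff]; omega)
          (iso_neg_pos (i + 1) (by omega))
      simpa [posRun, List.range_succ, add_comm] using a.symm.trans b
    · have a : Iso (i + 2 + k + 1) ([pos i] ++ [pos (i + 1), cap i])
          ([pos i] ++ [neg i, cap (i + 1)]) :=
        Iso.append_left (n := i + 2 + k + 1)
          (by simp [isDiagram_cons_iff, isDiagram_nil_iff]; omega)
          (iso_cap_pos i (by omega))
      have b := (iso_pos_neg (m := i + 2 + k + 1) i (by omega)).append_right [cap (i + 1)]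
      simpa [posRun, List.range_succ, add_comm] using (a.trans b).symm
    · have a := (iso_r3 (m := i + 2 + k + 1) i (by omega)).symm
      simpa [posRun, List.range_succ, add_comm] using a
    · have a := (iso_pos_pos_neg (m := i + 2 + k + 1) i (by omega)).symm
      simpa [posRun, List.range_succ, add_comm] using a
  have h3 := iso_slice_left (m := i + e.bot + k + 1) (isDiagram_posRun k) e i 0 (by omega)
  rw [posRun_add, posRun_add, posRun_add, posRun_add]
  simp only [add_zero] at h1 h3
  have s1 := h1.append_right (shift i (posRun e.top) ++ shift (i + e.top) (posRun k))
  have s2 := Iso.append_left hR (core.append_right (shift (i + e.top) (posRun k)))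
  have s3 := Iso.append_left (hR.append hB) h3
  simp only [List.append_assoc, List.cons_append, List.nil_append] at s1 s2 s3 ⊢
  exact s1.trans (s2.trans s3)

theorem iso_posRun {a b : ℕ} {t : List Slice} (ht : IsDiagram a t b) :
    Iso (a + 1) (shift 1 t ++ posRun b) (posRun a ++ t) := by
  induction ht with
  | nil n => simpa using Iso.refl _
  | cons e i k w n _ ih =>
    have h0 : IsDiagram (i + e.bot + k + 1) [⟨e, i + 1⟩] (i + e.top + k + 1) :=
      IsDiagram.cons' e (i + 1) k (IsDiagram.nil _) (by omega) (by omega)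
    have h1 := Iso.append_left h0 ih
    have h2 := (iso_slice_posRun e i k).append_right w
    simp only [List.append_assoc, List.cons_append, List.nil_append] at h1 h2 ⊢
    exact h1.trans h2

/-- Here `t` travels along the under-strand of the crossing, which is the case of a single strand in
`iso_posRun`; mirroring gives the over-strand of `neg 0`. -/
theorem iso_tangle_pos {t : List Slice} (ht : IsDiagram 1 t 1) :
    Iso 2 (shift 1 t ++ [pos 0]) (pos 0 :: t) := iso_posRun ht

theorem iso_tangle_neg {t : List Slice} (ht : IsDiagram 1 t 1) :
    Iso 2 (shift 1 t ++ [neg 0]) (neg 0 :: t) := by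
  have h := (iso_tangle_pos ht.mirror).mirror
  simpa [mirror_shift, Piece.mirror] using h

/-- Here `t` travels along the over-strand. After multiplication with `neg 0` the claim follows from
`iso_tangle_neg`, so no separate run of strands passing underneath is needed. -/
theorem iso_pos_tangle {t : List Slice} (ht : IsDiagram 1 t 1) :
    Iso 2 (pos 0 :: shift 1 t) (t ++ [pos 0]) := by
  have hp : IsDiagram 2 [pos 0] 2 := by simp [isDiagram_cons_iff, isDiagram_nil_iff]
  have hn : IsDiagram 2 [neg 0] 2 := by simp [isDiagram_cons_iff, isDiagram_nil_iff]
  refine Iso.cancel_right (n := 2) (k := 2) (w := [neg 0]) (by intro s hs; fin_cases hs; simp)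
    (hp.append (ht.shift 1)) ((ht.add_right 1).append hp) hn ?_
  have h1 := Iso.append_left hp (iso_tangle_neg ht)
  have h2 := (iso_pos_neg (m := 2) 0 (by omega)).append_right t
  have h3 := Iso.append_left (ht.add_right 1) (iso_pos_neg (m := 2) 0 (by omega))
  simp only [List.append_assoc, List.cons_append, List.nil_append, List.append_nil] at h1 h2 h3 ⊢
  exact h1.trans (h2.trans h3.symm)

theorem iso_neg_tangle {t : List Slice} (ht : IsDiagram 1 t 1) :
    Iso 2 (neg 0 :: shift 1 t) (t ++ [neg 0]) := by
  have h := (iso_pos_tangle ht.mirror).mirror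
  simpa [mirror_shift, Piece.mirror] using h

/-! ### Rotation in the plane -/

/-- The word `w`, starting with `m` strands, rotated by `π` in the plane of projection. -/
def rot : ℕ → List Slice → List Slice
  | _, [] => []
  | m, s :: w => rot (m - s.piece.bot + s.piece.top) w ++ [⟨s.piece.dual, m - s.left - s.piece.bot⟩]

theorem IsDiagram.rot {a b : ℕ} {t : List Slice} (h : IsDiagram a t b) :
    IsDiagram b (rot a t) a := by
  induction h with
  | nil _ => exact IsDiagram.nil _
  | cons e i k w n _ ih =>
    have e1 : i + e.bot + k - e.bot + e.top = i + e.top + k := by omega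
    have e2 : i + e.bot + k - i - e.bot = k := by omega
    simp only [HTwo.rot, e1, e2]
    exact ih.append (IsDiagram.cons' _ k i (IsDiagram.nil _) (by simp; omega) (by simp; omega))

/-- `n` nested minima. -/
def cups (n : ℕ) : List Slice := (List.range n).map cup

theorem cups_succ (n : ℕ) : cups (n + 1) = cups n ++ [cup n] := by
  simp [cups, List.range_succ]

theorem cups_add (n k : ℕ) : cups (n + k) = cups n ++ shift n (cups k) := by
  induction k with
  | zero => simp [cups]
  | succ k ih => rw [← add_assoc, cups_succ, ih, cups_succ]; simp [add_comm]

theorem isDiagram_cups (n : ℕ) : IsDiagram 0 (cups n) (n + n) := by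
  induction n with
  | zero => exact IsDiagram.nil _
  | succ n ih =>
    rw [cups_succ]
    exact ih.append (IsDiagram.cons' _ n n (IsDiagram.nil _) (by simp) (by simp; omega))

/-- Both sides equal two minima side by side whose neighbouring legs cross once: a crossing of the
left legs of nested minima can be carried round to their right legs. Flypes of rational tangles
start from this. -/
theorem iso_nested_pos {m : ℕ} (i : ℕ) (h : i ≤ m) :
    Iso m [cup i, cup (i + 1), pos i] [cup i, cup (i + 1), pos (i + 2)] := by
  have hd : IsDiagram m [cup i] (m + 2) := by
    simp [isDiagram_cons_iff, isDiagram_nil_iff]; omega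
  have a : Iso m [cup i, cup (i + 1), pos i] [cup i, cup i, neg (i + 1)] :=
    (Iso.append_left hd (iso_cup_neg i (by omega))).symm
  have b : Iso m [cup i, cup (i + 2), neg (i + 1)] [cup i, cup i, neg (i + 1)] :=
    (iso_exchange Piece.cup Piece.cup i 0 (by simpa using h)).append_right [neg (i + 1)]
  have c : Iso m [cup i, cup (i + 1), pos (i + 2)] [cup i, cup (i + 2), neg (i + 1)] :=
    Iso.append_left hd (iso_cup_pos (i + 1) (by omega))
  exact a.trans (b.symm.trans c.symm)

/-- A slice on the left legs of nested minima moves round to the right legs and is thereby turned by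
π. The minima outside and inside of it stay planar; in the core, a minimum or a maximum straightens
a zigzag and a crossing uses `iso_nested_pos`. -/
theorem iso_cups_slice (e : Piece) (i k : ℕ) :
    Iso 0 (cups (i + e.bot + k) ++ [⟨e, i⟩])
      (cups (i + e.top + k) ++ [⟨e.dual, i + e.top + k + k⟩]) := by
  have hk := isDiagram_cups k
  have hi := isDiagram_cups i
  have hB : IsDiagram (i + i) (shift i (cups e.bot)) (i + e.bot + (i + e.bot)) := by
    have := ((isDiagram_cups e.bot).shift i).add_right i
    convert this using 1 <;> omega
  have hT : IsDiagram (i + i) (shift i (cups e.top)) (i + e.top + (i + e.top)) := by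
    have := ((isDiagram_cups e.top).shift i).add_right i
    convert this using 1 <;> omega
  have h1 := (iso_slice_left (m := i + e.bot + (i + e.bot)) hk e i 0 (by omega)).symm
  have core : Iso (i + i) (shift i (cups e.bot) ++ [⟨e, i⟩])
      (shift i (cups e.top) ++ [⟨e.dual, i + e.top⟩]) := by
    cases e
    · have a : Iso (i + i) ([cup i] ++ [cup (i + 1), cap (i + 2)]) ([cup i] ++ []) :=
        Iso.append_left (n := i + i + 2)
          (by simp [isDiagram_cons_iff, isDiagram_nil_iff])
          (iso_zigzag_left (i + 1) (by omega))
      simpa [cups, List.range_succ, add_comm, Piece.dual] using a.symm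
    · have a : Iso (i + i) ([cup i] ++ [cup (i + 1), cap i]) ([cup i] ++ []) :=
        Iso.append_left (n := i + i + 2)
          (by simp [isDiagram_cons_iff, isDiagram_nil_iff])
          (iso_zigzag_right i (by omega))
      simpa [cups, List.range_succ, add_comm, Piece.dual] using a
    · simpa [cups, List.range_succ, add_comm, Piece.dual] using
        iso_nested_pos (m := i + i) i (by omega)
    · simpa [cups, List.range_succ, add_comm, Piece.dual, mirror, Piece.mirror] using
        (iso_nested_pos (m := i + i) i (by omega)).mirror
  have h3 := (iso_slice_right (m := i + e.top + (i + e.top)) (hk.shift (i + e.top)) e.dual 0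
    (by simp)).symm
  simp only [add_zero, zero_add] at h1 h3
  have e3 : k + k + (i + e.top) = i + e.top + k + k := by omega
  rw [e3] at h3
  rw [cups_add, cups_add, cups_add (i + e.top), cups_add i e.top]
  have s1 := Iso.append_left (hi.append hB) h1
  have s2 := Iso.append_left hi (core.append_right (shift (i + e.top) (cups k)))
  have s3 := Iso.append_left (hi.append hT) h3
  simp only [List.append_assoc, List.cons_append, List.nil_append] at s1 s2 s3 ⊢
  exact s1.trans (s2.trans s3)

/-- The slices are carried round one after the other. The lowest slice ends up highest, in
accordance with the order in `rot`. -/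
theorem iso_cups {a b : ℕ} {t : List Slice} (ht : IsDiagram a t b) :
    Iso 0 (cups a ++ t) (cups b ++ shift b (rot a t)) := by
  induction ht with
  | nil n => simpa [rot] using Iso.refl _
  | cons e i k w n hw ih =>
    have e1 : i + e.bot + k - e.bot + e.top = i + e.top + k := by omega
    have e2 : i + e.bot + k - i - e.bot = k := by omega
    simp only [rot, e1, e2, shift_append, shift_cons, shift_nil]
    have h1 := (iso_cups_slice e i k).append_right w
    have h2 := Iso.append_left (isDiagram_cups (i + e.top + k))
      (iso_slice_right hw e.dual k (m := i + e.top + k + (i + e.top + k)) (by simp; omega)).symm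
    have h3 := ih.append_right [⟨e.dual, k + n⟩]
    rw [add_comm n k] at h2
    rw [add_comm (i + e.top + k) k] at h1 h2
    simp only [List.append_assoc, List.cons_append, List.nil_append] at h1 h2 h3 ⊢
    exact h1.trans (h2.trans h3)

/-- Rotating a closed diagram by `π` does not change the link. -/
theorem iso_rot {w : List Slice} (hw : IsDiagram 0 w 0) : Iso 0 w (rot 0 w) := by
  simpa [cups] using iso_cups hw

theorem iso_caps_slice (e : Piece) (i k : ℕ) :
    Iso (i + e.bot + k + (i + e.top + k)) (⟨e, i⟩ :: flip (cups (i + e.top + k)))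
      (⟨e.dual, i + e.bot + k + k⟩ :: flip (cups (i + e.bot + k))) := by
  have h := iso_cups_slice e.dual i k
  simp only [Piece.bot_dual, Piece.top_dual, Piece.dual_dual] at h
  have hd : IsDiagram 0 (cups (i + e.top + k) ++ [⟨e.dual, i⟩])
      (i + e.bot + k + (i + e.top + k)) :=
    (isDiagram_cups _).append
      (IsDiagram.cons' _ i (k + (i + e.top + k)) (IsDiagram.nil _) (by simp; omega)
        (by simp; omega))
  simpa using h.flip hd

theorem iso_caps {a b : ℕ} {t : List Slice} (ht : IsDiagram a t b) :
    Iso (a + b) (t ++ flip (cups b)) (shift a (rot a t) ++ flip (cups a)) := by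
  induction ht with
  | nil n => simpa [rot] using Iso.refl _
  | cons e i k w n hw ih =>
    have e1 : i + e.bot + k - e.bot + e.top = i + e.top + k := by omega
    have e2 : i + e.bot + k - i - e.bot = k := by omega
    simp only [rot, e1, e2, shift_append, shift_cons, shift_nil]
    have hd : IsDiagram (i + e.bot + k + n) [⟨e, i⟩] (i + e.top + k + n) :=
      IsDiagram.cons' _ i (k + n) (IsDiagram.nil _) (by omega) (by omega)
    have hr : IsDiagram (i + e.bot + k + n) (shift (i + e.bot + k) (rot (i + e.top + k) w))
        (i + e.bot + k + (i + e.top + k)) := by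
      have := hw.rot.shift (i + e.bot + k)
      convert this using 1 <;> omega
    have h1 := Iso.append_left hd ih
    have h2 := (iso_slice_left (m := i + e.bot + k + n) hw.rot e i k (by omega)).append_right
      (flip (cups (i + e.top + k)))
    have h3 := Iso.append_left hr (iso_caps_slice e i k)
    rw [add_comm (i + e.bot + k) k] at h3
    simp only [List.append_assoc, List.cons_append, List.nil_append] at h1 h2 h3 ⊢
    exact h1.trans (h2.trans h3)

theorem iso_cup_tangle {t : List Slice} (ht : IsDiagram 1 t 1) :
    Iso 0 (cup 0 :: t) (cup 0 :: shift 1 (rot 1 t)) := iso_cups ht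

theorem iso_tangle_cap {t : List Slice} (ht : IsDiagram 1 t 1) :
    Iso 2 (t ++ [cap 0]) (shift 1 (rot 1 t) ++ [cap 0]) := iso_caps ht

/-! ### Diagrams with a marked point, into which a tangle may be inserted -/

/-- A point of a diagram together with a direction (up or down). -/
structure Mark where
  below : List Slice
  above : List Slice
  strand : ℕ
  up : Bool

namespace Mark

/-- The tangle `t`, turned over if the direction is down. -/
def orient (d : Bool) (t : List Slice) : List Slice := if d then t else rot 1 t

/-- The diagram with the tangle `t` inserted at the marked point. -/
def fill (M : Mark) (t : List Slice) : List Slice :=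
  M.below ++ (shift M.strand (orient M.up t) ++ M.above)

/-- The marked point lies on a strand. -/
def Valid (M : Mark) : Prop := ∃ a, IsDiagram 0 M.below a ∧ M.strand < a

/-- Inserting a tangle gives isotopic diagrams for both marks. -/
def Equiv (M M' : Mark) : Prop := ∀ t, IsDiagram 1 t 1 → Iso 0 (M.fill t) (M'.fill t)

theorem Equiv.refl (M : Mark) : M.Equiv M := fun _ _ => Iso.refl _

theorem Equiv.symm {M M' : Mark} (h : M.Equiv M') : M'.Equiv M := fun t ht => (h t ht).symm

theorem Equiv.trans {M M' M'' : Mark} (h : M.Equiv M') (h' : M'.Equiv M'') : M.Equiv M'' :=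
  fun t ht => (h t ht).trans (h' t ht)

theorem isDiagram_orient {t : List Slice} (ht : IsDiagram 1 t 1) (d : Bool) :
    IsDiagram 1 (orient d t) 1 := by
  cases d
  · exact ht.rot
  · exact ht

theorem isDiagram_ins {t : List Slice} (ht : IsDiagram 1 t 1) {i a : ℕ} (d : Bool) (h : i < a) :
    IsDiagram a (shift i (orient d t)) a := by
  have := ((isDiagram_orient ht d).shift i).add_right (a - 1 - i)
  convert this using 1 <;> omega

theorem equiv_of_iso_above {u v v' : List Slice} {a : ℕ} (hu : IsDiagram 0 u a) {i : ℕ}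
    (hi : i < a) (d : Bool) (h : Iso a v v') : Equiv ⟨u, v, i, d⟩ ⟨u, v', i, d⟩ := by
  intro t ht
  exact Iso.append_left hu (Iso.append_left (isDiagram_ins ht d hi) h)

theorem equiv_of_iso_below {u u' v : List Slice} (i : ℕ) (d : Bool) (h : Iso 0 u u') :
    Equiv ⟨u, v, i, d⟩ ⟨u', v, i, d⟩ := by
  intro t ht
  exact h.append_right _

/-! ### Sliding the marked point along its strand -/

theorem equiv_slide {u v : List Slice} {a : ℕ} (hu : IsDiagram 0 u a) {s : Slice} {i i' : ℕ}
    (d : Bool)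
    (h : ∀ t, IsDiagram 1 t 1 → Iso a ([s] ++ shift i t) (shift i' t ++ [s])) :
    Equiv ⟨u ++ [s], v, i, d⟩ ⟨u, s :: v, i', d⟩ := by
  intro t ht
  have := Iso.append_left hu ((h _ (isDiagram_orient ht d)).append_right v)
  simpa [fill] using this

theorem slide_left {u v : List Slice} {a : ℕ} (hu : IsDiagram 0 u a) {e : Piece} {i j : ℕ}
    (d : Bool) (hj : j + e.bot ≤ a) (hi : i < j) :
    Equiv ⟨u ++ [⟨e, j⟩], v, i, d⟩ ⟨u, ⟨e, j⟩ :: v, i, d⟩ := by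
  refine equiv_slide hu d fun t ht => ?_
  have := iso_slice_right (m := a) (ht.shift i) e (j - i - 1) (by omega)
  have e1 : 1 + i + (j - i - 1) = j := by omega
  rw [e1] at this
  exact this.symm

theorem slide_right {u v : List Slice} {a : ℕ} (hu : IsDiagram 0 u a) {e : Piece} {i i' j : ℕ}
    (d : Bool) (ha : i' < a) (hj : j + e.bot ≤ i') (hi : i + e.bot = i' + e.top) :
    Equiv ⟨u ++ [⟨e, j⟩], v, i, d⟩ ⟨u, ⟨e, j⟩ :: v, i', d⟩ := by
  refine equiv_slide hu d fun t ht => ?_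
  have := iso_slice_left (m := a) ht e j (i' - j - e.bot) (by omega)
  have e1 : j + e.top + (i' - j - e.bot) = i := by omega
  have e2 : j + e.bot + (i' - j - e.bot) = i' := by omega
  rw [e1, e2] at this
  exact this

theorem slide_crossing_left {u v : List Slice} {a : ℕ} (hu : IsDiagram 0 u a) {e : Piece} {j : ℕ}
    (d : Bool) (he : e = Piece.pos ∨ e = Piece.neg) (hj : j + 2 ≤ a) :
    Equiv ⟨u ++ [⟨e, j⟩], v, j, d⟩ ⟨u, ⟨e, j⟩ :: v, j + 1, d⟩ := by
  refine equiv_slide hu d fun t ht => ?_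
  have h : Iso 2 (shift 1 t ++ [⟨e, 0⟩]) (⟨e, 0⟩ :: t) := by
    rcases he with rfl | rfl
    · exact iso_tangle_pos ht
    · exact iso_tangle_neg ht
  have := (h.shift j).mono (n := a) (by omega)
  simp only [shift_append, shift_shift, shift_cons, shift_nil, zero_add, add_comm 1 j] at this
  exact this.symm

theorem slide_crossing_right {u v : List Slice} {a : ℕ} (hu : IsDiagram 0 u a) {e : Piece} {j : ℕ}
    (d : Bool) (he : e = Piece.pos ∨ e = Piece.neg) (hj : j + 2 ≤ a) :
    Equiv ⟨u ++ [⟨e, j⟩], v, j + 1, d⟩ ⟨u, ⟨e, j⟩ :: v, j, d⟩ := by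
  refine equiv_slide hu d fun t ht => ?_
  have h : Iso 2 (⟨e, 0⟩ :: shift 1 t) (t ++ [⟨e, 0⟩]) := by
    rcases he with rfl | rfl
    · exact iso_pos_tangle ht
    · exact iso_neg_tangle ht
  have := (h.shift j).mono (n := a) (by omega)
  simp only [shift_append, shift_shift, shift_cons, shift_nil, zero_add, add_comm 1 j] at this
  exact this

theorem slide_cup_true {u v : List Slice} {a : ℕ} (hu : IsDiagram 0 u a) {j : ℕ} (hj : j ≤ a) :
    Equiv ⟨u ++ [cup j], v, j, true⟩ ⟨u ++ [cup j], v, j + 1, false⟩ := by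
  intro t ht
  have := ((iso_cup_tangle ht).shift j).mono (n := a) (by omega)
  simp only [shift_shift, shift_cons, zero_add, add_comm 1 j] at this
  have h2 := Iso.append_left hu (this.append_right v)
  simpa [fill, orient] using h2

theorem slide_cap_true {u v : List Slice} {a : ℕ} (hu : IsDiagram 0 u a) {j : ℕ}
    (hj : j + 2 ≤ a) :
    Equiv ⟨u, cap j :: v, j, true⟩ ⟨u, cap j :: v, j + 1, false⟩ := by
  intro t ht
  have := ((iso_tangle_cap ht).shift j).mono (n := a) (by omega)
  simp only [shift_append, shift_shift, shift_cons, shift_nil, zero_add, add_comm 1 j] at this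
  have h2 := Iso.append_left hu (this.append_right v)
  simpa [fill, orient] using h2

theorem equiv_below_crossing {u v : List Slice} {a : ℕ} (hu : IsDiagram 0 u a) {j : ℕ}
    (i : ℕ) (d : Bool) (h : Iso a [cup j, pos j] [cup j]) :
    Equiv ⟨u ++ [cup j] ++ [pos j], v, i, d⟩ ⟨u ++ [cup j], v, i, d⟩ := by
  have := Iso.append_left hu h
  exact equiv_of_iso_below i d (by simpa using this)

/-- The upward case is the rotation of a tangle carried round a minimum. A kink exchanges the two
legs, so inserting one, moving the mark through it and removing it turns the upward case into the
downward case; that rotating twice is the identity is never needed. -/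
theorem slide_cup {u v : List Slice} {a : ℕ} (hu : IsDiagram 0 u a) {j : ℕ} (hj : j ≤ a)
    (d : Bool) : Equiv ⟨u ++ [cup j], v, j, d⟩ ⟨u ++ [cup j], v, j + 1, !d⟩ := by
  cases d
  · have hu' : IsDiagram 0 (u ++ [cup j]) (a + 2) :=
      hu.append (IsDiagram.cons' _ j (a - j) (IsDiagram.nil _) (by simp; omega) (by simp; omega))
    have hc := fun i d => equiv_below_crossing (v := v) hu i d (iso_r1_cup_pos j hj)
    have h1 := slide_crossing_left (v := v) hu' (e := Piece.pos) (j := j) false (by simp)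
      (by omega)
    have h2 := slide_crossing_right (v := v) hu' (e := Piece.pos) (j := j) true (by simp)
      (by omega)
    have h3 := slide_cup_true (v := pos j :: v) hu hj
    exact (hc _ _).symm.trans (h1.trans (h3.symm.trans (h2.symm.trans (hc _ _))))
  · exact slide_cup_true hu hj

theorem slide_cap {u v : List Slice} {a : ℕ} (hu : IsDiagram 0 u a) {j : ℕ} (hj : j + 2 ≤ a)
    (d : Bool) : Equiv ⟨u, cap j :: v, j, d⟩ ⟨u, cap j :: v, j + 1, !d⟩ := by
  cases d
  · have hc := fun i d (hi : i < a) => equiv_of_iso_above hu hi d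
      ((iso_r1_cap_pos j hj).append_right v)
    have hu' : IsDiagram 0 (u ++ [pos j]) a :=
      hu.append (IsDiagram.cons' _ j (a - j - 2) (IsDiagram.nil _) (by simp; omega)
        (by simp; omega))
    have h1 := slide_crossing_left (v := cap j :: v) hu (e := Piece.pos) (j := j) true (by simp)
      (by omega)
    have h2 := slide_crossing_right (v := cap j :: v) hu (e := Piece.pos) (j := j) false (by simp)
      (by omega)
    have h3 := slide_cap_true (v := v) hu' hj
    exact (hc j _ (by omega)).symm.trans
      (h2.symm.trans (h3.symm.trans (h1.trans (hc (j + 1) _ (by omega)))))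
  · exact slide_cap_true hu hj

/-- The only obstruction to moving down past a slice is a mark sitting on a leg of a minimum; this
is what `hs` excludes. -/
theorem exists_slide_down {u v : List Slice} {s : Slice} {i : ℕ} {d : Bool}
    (h : Valid ⟨u ++ [s], v, i, d⟩)
    (hs : s.piece ≠ Piece.cup ∨ i < s.left ∨ s.left + 2 ≤ i) :
    ∃ i', Valid ⟨u, s :: v, i', d⟩ ∧ Equiv ⟨u ++ [s], v, i, d⟩ ⟨u, s :: v, i', d⟩ := by
  obtain ⟨b, hb, hi⟩ := h
  obtain ⟨a, hu, hb⟩ := isDiagram_append_iff.1 hb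
  obtain ⟨e, j⟩ := s
  rw [isDiagram_cons_iff, isDiagram_nil_iff] at hb
  obtain ⟨hj, rfl⟩ := hb
  simp only at hi hs
  by_cases h1 : i < j
  · exact ⟨i, ⟨a, hu, by simp only; omega⟩, slide_left hu d hj h1⟩
  by_cases h2 : j + e.top ≤ i
  · have ht : i - e.top + e.bot < a := by omega
    exact ⟨i - e.top + e.bot, ⟨a, hu, ht⟩, slide_right hu d ht (by omega) (by omega)⟩
  have he : e = Piece.pos ∨ e = Piece.neg := by
    cases e <;> simp at hs h2 ⊢ <;> omega
  have hb : e.bot = 2 ∧ e.top = 2 := by rcases he with rfl | rfl <;> simp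
  by_cases h3 : i = j
  · subst h3
    exact ⟨i + 1, ⟨a, hu, by simp only; omega⟩, slide_crossing_left hu d he (by omega)⟩
  · obtain rfl : i = j + 1 := by omega
    exact ⟨j, ⟨a, hu, by simp only; omega⟩, slide_crossing_right hu d he (by omega)⟩

theorem exists_slide_up {u v : List Slice} {s : Slice} {i n : ℕ} {d : Bool}
    (hd : IsDiagram 0 (u ++ [s]) n) (h : Valid ⟨u, s :: v, i, d⟩)
    (hs : s.piece ≠ Piece.cap ∨ i < s.left ∨ s.left + 2 ≤ i) :
    ∃ i', Valid ⟨u ++ [s], v, i', d⟩ ∧ Equiv ⟨u, s :: v, i, d⟩ ⟨u ++ [s], v, i', d⟩ := by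
  obtain ⟨a, hu, hi⟩ := h
  obtain ⟨a', hu', hb⟩ := isDiagram_append_iff.1 hd
  obtain rfl := hu.unique hu'
  obtain ⟨e, j⟩ := s
  rw [isDiagram_cons_iff, isDiagram_nil_iff] at hb
  obtain ⟨hj, rfl⟩ := hb
  simp only at hi hs hu
  by_cases h1 : i < j
  · exact ⟨i, ⟨_, hd, by simp only; omega⟩, (slide_left hu d hj h1).symm⟩
  by_cases h2 : j + e.bot ≤ i
  · exact ⟨i - e.bot + e.top, ⟨_, hd, by simp only; omega⟩,
      (slide_right hu d hi (by omega) (by omega)).symm⟩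
  have he : e = Piece.pos ∨ e = Piece.neg := by
    cases e <;> simp at hs h2 ⊢ <;> omega
  have hb : e.bot = 2 ∧ e.top = 2 := by rcases he with rfl | rfl <;> simp
  by_cases h3 : i = j
  · subst h3
    exact ⟨i + 1, ⟨_, hd, by simp only; omega⟩, (slide_crossing_right hu d he (by omega)).symm⟩
  · obtain rfl : i = j + 1 := by omega
    exact ⟨j, ⟨_, hd, by simp only; omega⟩, (slide_crossing_left hu d he (by omega)).symm⟩

theorem exists_slide_down_word {u l v : List Slice} {i : ℕ} {d : Bool}
    (h : Valid ⟨u ++ l, v, i, d⟩) (hl : ∀ s ∈ l, s.piece ≠ Piece.cup) :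
    ∃ i', Valid ⟨u, l ++ v, i', d⟩ ∧ Equiv ⟨u ++ l, v, i, d⟩ ⟨u, l ++ v, i', d⟩ := by
  induction l using List.reverseRecOn generalizing v i with
  | nil => exact ⟨i, by simpa using h, by simpa using Equiv.refl _⟩
  | append_singleton l s ih =>
    rw [← List.append_assoc] at h ⊢
    obtain ⟨i', h1, h2⟩ := exists_slide_down h (Or.inl (hl s (by simp)))
    obtain ⟨i'', h3, h4⟩ := ih h1 fun s hs => hl s (by simp [hs])
    refine ⟨i'', by simpa using h3, by simpa using h2.trans h4⟩

theorem exists_slide_up_word {u l v : List Slice} {i n : ℕ} {d : Bool}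
    (hd : IsDiagram 0 (u ++ l) n) (h : Valid ⟨u, l ++ v, i, d⟩)
    (hl : ∀ s ∈ l, s.piece ≠ Piece.cap) :
    ∃ i', Valid ⟨u ++ l, v, i', d⟩ ∧ Equiv ⟨u, l ++ v, i, d⟩ ⟨u ++ l, v, i', d⟩ := by
  induction l generalizing u i with
  | nil => exact ⟨i, by simpa using h, by simpa using Equiv.refl _⟩
  | cons s l ih =>
    have e : u ++ s :: l = u ++ [s] ++ l := by simp
    rw [e] at hd ⊢
    obtain ⟨b, hd', -⟩ := isDiagram_append_iff.1 hd
    obtain ⟨i', h1, h2⟩ := exists_slide_up hd' h (Or.inl (hl s (by simp)))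
    obtain ⟨i'', h3, h4⟩ := ih hd h1 fun s hs => hl s (by simp [hs])
    exact ⟨i'', h3, h2.trans h4⟩

/-! ### Isotopies carry marked points along -/

/-- Every point of the block `l` can be slid to an end of the block. -/
def Exits (l : List Slice) : Prop :=
  ∀ (x y l₁ l₂ : List Slice) (n i : ℕ) (d : Bool), l = l₁ ++ l₂ → IsDiagram 0 (x ++ l) n →
    Valid ⟨x ++ l₁, l₂ ++ y, i, d⟩ →
    ∃ i' d', (Valid ⟨x, l ++ y, i', d'⟩ ∧ Equiv ⟨x ++ l₁, l₂ ++ y, i, d⟩ ⟨x, l ++ y, i', d'⟩) ∨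
      (Valid ⟨x ++ l, y, i', d'⟩ ∧ Equiv ⟨x ++ l₁, l₂ ++ y, i, d⟩ ⟨x ++ l, y, i', d'⟩)

theorem exits_of_no_cup {l : List Slice} (hl : ∀ s ∈ l, s.piece ≠ Piece.cup) : Exits l := by
  rintro x y l₁ l₂ n i d rfl hd h
  obtain ⟨i', h1, h2⟩ := exists_slide_down_word h fun s hs => hl s (by simp [hs])
  exact ⟨i', d, Or.inl ⟨by simpa using h1, by simpa using h2⟩⟩

theorem exits_of_no_cap {l : List Slice} (hl : ∀ s ∈ l, s.piece ≠ Piece.cap) : Exits l := by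
  rintro x y l₁ l₂ n i d rfl hd h
  rw [← List.append_assoc] at hd
  obtain ⟨i', h1, h2⟩ := exists_slide_up_word hd h fun s hs => hl s (by simp [hs])
  exact ⟨i', d, Or.inr ⟨by simpa using h1, by simpa using h2⟩⟩

/-- Only marks between the two slices need an argument. They leave downwards unless they sit on a
minimum `s`; otherwise they leave upwards, possibly after being moved to a place that is not under a
maximum `s'`. -/
theorem exits_pair {s s' : Slice}
    (H : ∀ (x y : List Slice) (n i : ℕ) (d : Bool), IsDiagram 0 (x ++ [s] ++ [s']) n →
      Valid ⟨x ++ [s], s' :: y, i, d⟩ →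
      (s.piece ≠ Piece.cup ∨ i < s.left ∨ s.left + 2 ≤ i) ∨
      ∃ i' d', (Valid ⟨x ++ [s], s' :: y, i', d'⟩ ∧
        (s'.piece ≠ Piece.cap ∨ i' < s'.left ∨ s'.left + 2 ≤ i') ∧
        Equiv ⟨x ++ [s], s' :: y, i, d⟩ ⟨x ++ [s], s' :: y, i', d'⟩)) : Exits [s, s'] := by
  rintro x y l₁ l₂ n i d hl hd h
  have hd' : IsDiagram 0 (x ++ [s] ++ [s']) n := by simpa using hd
  match l₁, hl with
  | [], hl =>
    obtain rfl : [s, s'] = l₂ := by simpa using hl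
    exact ⟨i, d, Or.inl ⟨by simpa using h, by simpa using Equiv.refl _⟩⟩
  | [a], hl =>
    simp only [List.cons_append, List.nil_append, List.cons.injEq] at hl
    obtain ⟨rfl, rfl⟩ := hl
    rcases H x y n i d hd' h with h1 | ⟨i', d', h1, h2, h3⟩
    · obtain ⟨i', h2, h3⟩ := exists_slide_down h h1
      exact ⟨i', d, Or.inl ⟨h2, h3⟩⟩
    · obtain ⟨i'', h4, h5⟩ := exists_slide_up hd' h1 h2
      exact ⟨i'', d', Or.inr ⟨by simpa using h4, by simpa using h3.trans h5⟩⟩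
  | [a, b], hl =>
    simp only [List.cons_append, List.nil_append, List.cons.injEq] at hl
    obtain ⟨rfl, rfl, rfl⟩ := hl
    exact ⟨i, d, Or.inr ⟨by simpa using h, by simpa using Equiv.refl _⟩⟩
  | a :: b :: c :: l, hl => simp at hl

theorem exits_nil : Exits [] := exits_of_no_cup (by simp)

end Mark

open Mark in
-- Blocks without minima are left downwards and blocks without maxima upwards. This settles
-- everything except exchanges and zigzags, where a minimum and a maximum can meet.
theorem LocalMove.exits {l r : List Slice} (h : LocalMove l r) : Exits l ∧ Exits r := by
  cases h with
  | exchange e f i k =>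
    constructor
    · refine exits_pair fun x y n p d _ h => ?_
      by_cases hp : p < i ∨ i + 2 ≤ p
      · exact Or.inl (Or.inr hp)
      · by_cases he : e = Piece.cup
        · subst he
          exact Or.inr ⟨p, d, h, Or.inr (Or.inl (by simp; omega)), Mark.Equiv.refl _⟩
        · exact Or.inl (Or.inl he)
    · refine exits_pair fun x y n p d _ h => ?_
      by_cases hp : p < i + e.bot + k ∨ i + e.bot + k + 2 ≤ p
      · exact Or.inl (Or.inr hp)
      · by_cases he : e = Piece.cap
        · subst he
          exact Or.inr ⟨p, d, h, Or.inr (Or.inr (by simp at hp ⊢; omega)), Mark.Equiv.refl _⟩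
        · exact Or.inr ⟨p, d, h, Or.inl he, Mark.Equiv.refl _⟩
  | zigzag_left i =>
    refine ⟨exits_pair fun x y n p d hd h => ?_, exits_nil⟩
    by_cases hp : p < i ∨ i + 2 ≤ p
    · exact Or.inl (Or.inr hp)
    by_cases hi : p = i
    · exact Or.inr ⟨p, d, h, Or.inr (Or.inl (by simp; omega)), Mark.Equiv.refl _⟩
    -- The middle strand of the zigzag lies on the minimum and on the maximum. Going round the
    -- minimum leads to its other leg, which passes to the left of the maximum.
    · obtain rfl : p = i + 1 := by omega
      obtain ⟨b, h1, h2⟩ := isDiagram_append_iff.1 hd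
      obtain ⟨a, hx, h1⟩ := isDiagram_append_iff.1 h1
      simp [isDiagram_cons_iff, isDiagram_nil_iff] at h1 h2
      refine Or.inr ⟨i, !d, ⟨_, (isDiagram_append_iff.1 hd).choose_spec.1, ?_⟩,
        Or.inr (Or.inl (by simp)), ?_⟩
      · obtain ⟨a', ha', hi'⟩ := h
        have := ha'.unique (isDiagram_append_iff.1 hd).choose_spec.1
        simp only at hi' ⊢; omega
      · have := slide_cup (v := cap (i + 1) :: y) hx (j := i) (by omega) (!d)
        simpa using this.symm
  | zigzag_right i =>
    refine ⟨exits_pair fun x y n p d hd h => ?_, exits_nil⟩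
    by_cases hp : p < i + 1 ∨ i + 1 + 2 ≤ p
    · exact Or.inl (Or.inr hp)
    by_cases hi : p = i + 2
    · exact Or.inr ⟨p, d, h, Or.inr (Or.inr (by simp; omega)), Mark.Equiv.refl _⟩
    · obtain rfl : p = i + 1 := by omega
      obtain ⟨b, h1, h2⟩ := isDiagram_append_iff.1 hd
      obtain ⟨a, hx, h1⟩ := isDiagram_append_iff.1 h1
      have hb := hx.append h1
      simp [isDiagram_cons_iff, isDiagram_nil_iff] at h1 h2
      refine Or.inr ⟨i + 2, !d, ⟨_, hb, ?_⟩, Or.inr (Or.inr (by simp)), ?_⟩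
      · simp only; omega
      · exact slide_cup (v := cap i :: y) hx (j := i + 1) (by omega) d
  | cup_pos i => exact ⟨exits_of_no_cap (by simp), exits_of_no_cap (by simp)⟩
  | cup_neg i => exact ⟨exits_of_no_cap (by simp), exits_of_no_cap (by simp)⟩
  | cap_pos i => exact ⟨exits_of_no_cup (by simp), exits_of_no_cup (by simp)⟩
  | cap_neg i => exact ⟨exits_of_no_cup (by simp), exits_of_no_cup (by simp)⟩
  | r1_cup_pos i => exact ⟨exits_of_no_cap (by simp), exits_of_no_cap (by simp)⟩
  | r1_cup_neg i => exact ⟨exits_of_no_cap (by simp), exits_of_no_cap (by simp)⟩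
  | r1_cap_pos i => exact ⟨exits_of_no_cup (by simp), exits_of_no_cup (by simp)⟩
  | r1_cap_neg i => exact ⟨exits_of_no_cup (by simp), exits_of_no_cup (by simp)⟩
  | r2_pos_neg i => exact ⟨exits_of_no_cup (by simp), exits_nil⟩
  | r2_neg_pos i => exact ⟨exits_of_no_cup (by simp), exits_nil⟩
  | r3 i => exact ⟨exits_of_no_cup (by simp), exits_of_no_cup (by simp)⟩

namespace Mark

/-- A mark below or above the block is untouched by the replacement. A mark inside is first slid out
of the block, which `Exits` permits, and the block is replaced afterwards. -/
theorem exists_equiv_of_block {x l r y : List Slice} {a b : ℕ} (hx : IsDiagram 0 x a)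
    (hl : IsDiagram a l b) (hlr : Iso a l r) (he : Exits l) (M : Mark)
    (hM : M.below ++ M.above = x ++ l ++ y) (hv : M.Valid) :
    ∃ M' : Mark, M'.below ++ M'.above = x ++ r ++ y ∧ M'.Valid ∧ M.Equiv M' := by
  obtain ⟨u, v, i, d⟩ := M
  simp only at hM
  have bottom : ∀ i d, Valid ⟨x, l ++ y, i, d⟩ →
      Valid ⟨x, r ++ y, i, d⟩ ∧ Equiv ⟨x, l ++ y, i, d⟩ ⟨x, r ++ y, i, d⟩ := by
    rintro i d ⟨a', ha, hi⟩
    refine ⟨⟨a', ha, hi⟩, equiv_of_iso_above ha hi d ?_⟩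
    obtain rfl := hx.unique ha
    exact hlr.append_right y
  have above : ∀ (i : ℕ) (d : Bool) (z z' : List Slice), Valid ⟨x ++ l ++ z, z', i, d⟩ →
      Valid ⟨x ++ r ++ z, z', i, d⟩ ∧
        Equiv ⟨x ++ l ++ z, z', i, d⟩ ⟨x ++ r ++ z, z', i, d⟩ := by
    rintro i d z z' ⟨a', ha, hi⟩
    have h := (Iso.append_left hx hlr).append_right z
    exact ⟨⟨a', h.isDiagram ha, hi⟩, equiv_of_iso_below i d h⟩
  rcases List.append_eq_append_iff.1 hM with ⟨z, h1, h2⟩ | ⟨z, h1, h2⟩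
  · rcases List.append_eq_append_iff.1 h1.symm with ⟨z', h3, h4⟩ | ⟨z', h3, h4⟩
    rotate_left
    · subst h3 h4
      subst h2
      obtain ⟨i', d', ⟨h5, h6⟩ | ⟨h5, h6⟩⟩ := he x y z' z b i d rfl (hx.append hl) hv
      · exact ⟨⟨x, r ++ y, i', d'⟩, by simp, (bottom _ _ h5).1, h6.trans (bottom _ _ h5).2⟩
      · have h7 := above i' d' [] y (by simpa using h5)
        rw [List.append_nil, List.append_nil] at h7
        exact ⟨⟨x ++ r, y, i', d'⟩, by simp, h7.1, h6.trans h7.2⟩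
    · subst h3 h4
      subst h2
      obtain ⟨a', ha, hi⟩ := hv
      simp only at ha hi
      obtain ⟨c, hc, hz⟩ := isDiagram_append_iff.1 hx
      obtain rfl := ha.unique hc
      refine ⟨⟨u, z' ++ r ++ y, i, d⟩, by simp, ⟨a', ha, hi⟩, equiv_of_iso_above ha hi d ?_⟩
      have := (Iso.append_left hz hlr).append_right y
      simpa using this
  · subst h1 h2
    exact ⟨⟨x ++ r ++ z, v, i, d⟩, by simp, (above _ _ _ _ hv).1, (above _ _ _ _ hv).2⟩

/-- An isotopy carries every marked point along. -/
theorem exists_equiv_of_iso {w w' : List Slice} (h : Iso 0 w w') (M : Mark)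
    (hM : M.below ++ M.above = w) (hv : M.Valid) :
    ∃ M' : Mark, M'.below ++ M'.above = w' ∧ M'.Valid ∧ M.Equiv M' := by
  -- Isotopy is generated by local moves together with their inverses, so the induction needs the
  -- statement in both directions.
  suffices H : (∀ M : Mark, M.below ++ M.above = w → M.Valid →
        ∃ M' : Mark, M'.below ++ M'.above = w' ∧ M'.Valid ∧ M.Equiv M') ∧
      (∀ M : Mark, M.below ++ M.above = w' → M.Valid →
        ∃ M' : Mark, M'.below ++ M'.above = w ∧ M'.Valid ∧ M.Equiv M') from H.1 M hM hv
  clear hM hv M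
  induction h with
  | rel w w' h =>
    obtain ⟨x, l, r, y, a, b, hm, hx, hl, hr, rfl, rfl⟩ := h
    have hi := hm.iso b hl hr
    exact ⟨exists_equiv_of_block hx hl hi hm.exits.1,
      exists_equiv_of_block hx hr hi.symm hm.exits.2⟩
  | refl w => exact ⟨fun M hM hv => ⟨M, hM, hv, Equiv.refl M⟩,
      fun M hM hv => ⟨M, hM, hv, Equiv.refl M⟩⟩
  | symm w w' _ ih => exact ⟨ih.2, ih.1⟩
  | trans w w' w'' _ _ ih1 ih2 =>
    constructor
    · intro M hM hv
      obtain ⟨M', h1, h2, h3⟩ := ih1.1 M hM hv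
      obtain ⟨M'', h4, h5, h6⟩ := ih2.1 M' h1 h2
      exact ⟨M'', h4, h5, h3.trans h6⟩
    · intro M hM hv
      obtain ⟨M', h1, h2, h3⟩ := ih2.2 M hM hv
      obtain ⟨M'', h4, h5, h6⟩ := ih1.2 M' h1 h2
      exact ⟨M'', h4, h5, h3.trans h6⟩

end Mark

set_option linter.unusedSimpArgs false

/-! ### Fox colourings -/

namespace Coloring

variable {A : Type*} [AddCommGroup A]

/-- The colours after a minimum of colour `x` in position `i`. -/
def ins (i : ℕ) (x : A) (f : ℕ → A) : ℕ → A := fun j =>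
  if j < i then f j else if j < i + 2 then x else f (j - 2)

/-- The colours after a maximum in position `i`. -/
def del (i : ℕ) (f : ℕ → A) : ℕ → A := fun j => if j < i then f j else f (j + 2)

/-- The colours after a crossing `pos i`. -/
def posAct (i : ℕ) (f : ℕ → A) : ℕ → A := fun j =>
  if j = i then f i + f i - f (i + 1) else if j = i + 1 then f i else f j

/-- The colours after a crossing `neg i`. -/
def negAct (i : ℕ) (f : ℕ → A) : ℕ → A := fun j =>
  if j = i then f (i + 1) else if j = i + 1 then f (i + 1) + f (i + 1) - f i else f j

variable [Fintype A] [DecidableEq A]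

/-- All colourings of the strands above the slice that are compatible with the colouring `f` of the
strands below (there are infinitely many vertical strands on the right). -/
def act : Slice → (ℕ → A) → Multiset (ℕ → A)
  | ⟨.cup, i⟩, f => Finset.univ.val.map fun x => ins i x f
  | ⟨.cap, i⟩, f => if f i = f (i + 1) then {del i f} else 0
  | ⟨.pos, i⟩, f => {posAct i f}
  | ⟨.neg, i⟩, f => {negAct i f}

/-- The colourings at the top, counted with multiplicity, that extend a colouring at the bottom. -/
def out : List Slice → (ℕ → A) → Multiset (ℕ → A)
  | [], f => {f}
  | s :: w, f => (act s f).bind (out w)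

@[simp] theorem out_nil (f : ℕ → A) : out [] f = {f} := rfl

theorem out_append (u v : List Slice) (f : ℕ → A) : out (u ++ v) f = (out u f).bind (out v) := by
  induction u generalizing f with
  | nil => simp
  | cons s u ih =>
    simp only [List.cons_append, out, Multiset.bind_assoc]
    exact Multiset.bind_congr fun g _ => ih g

theorem out_cup (i : ℕ) (w : List Slice) (f : ℕ → A) :
    out (cup i :: w) f = ∑ x, out w (ins i x f) := by
  simp only [out, act, Multiset.bind, Multiset.map_map]
  rfl

theorem out_cap (i : ℕ) (w : List Slice) (f : ℕ → A) :
    out (cap i :: w) f = if f i = f (i + 1) then out w (del i f) else 0 := by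
  simp only [out, act]
  split_ifs <;> simp

theorem out_pos (i : ℕ) (w : List Slice) (f : ℕ → A) :
    out (pos i :: w) f = out w (posAct i f) := by
  simp [out, act]

theorem out_neg (i : ℕ) (w : List Slice) (f : ℕ → A) :
    out (neg i :: w) f = out w (negAct i f) := by
  simp [out, act]

omit [AddCommGroup A] in
theorem sum_ite_eq_point {M : Type*} [AddCommMonoid M] (p : A → Prop) [DecidablePred p]
    (a : A) (g : A → M) (hp : ∀ x, p x ↔ x = a) : (∑ x, if p x then g x else 0) = g a := by
  simp [hp]

/-- Multisets of outgoing colourings are compared, not just their sizes, so that the equality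
survives stacking further slices on top. -/
theorem out_localMove {l r : List Slice} (h : LocalMove l r) (f : ℕ → A) : out l f = out r f := by
  cases h with
  | exchange e g i k =>
    cases e <;> cases g <;> simp only [out_cup, out_cap, out_pos, out_neg, out_nil,
      bot_cup, bot_cap, bot_pos, bot_neg, top_cup, top_cap, top_pos, top_neg]
    · rw [Finset.sum_comm]
      refine Finset.sum_congr rfl fun x _ => Finset.sum_congr rfl fun y _ => ?_
      congr 1; funext j; simp only [ins]; grind
    · split_ifs with h
      · refine Finset.sum_congr rfl fun x _ => ?_
        rw [if_pos (by simp only [ins]; grind)]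
        congr 1; funext j; simp only [ins, del]; grind
      · refine Finset.sum_eq_zero fun x _ => ?_
        rw [if_neg (by simp only [ins]; grind)]
    · refine Finset.sum_congr rfl fun x _ => ?_
      congr 1; funext j; simp only [ins, posAct]; grind
    · refine Finset.sum_congr rfl fun x _ => ?_
      congr 1; funext j; simp only [ins, negAct]; grind
    · have h1 : ∀ x, ins (i + 2 + k) x f i = f i := by intro x; simp only [ins]; grind
      have h2 : ∀ x, ins (i + 2 + k) x f (i + 1) = f (i + 1) := by intro x; simp only [ins]; grind
      simp only [h1, h2]
      split_ifs with h
      · refine Finset.sum_congr rfl fun x _ => ?_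
        congr 1; funext j; simp only [ins, del]; grind
      · simp
    · have h1 : del (i + 2 + k) f i = f i := by simp only [del]; grind
      have h2 : del (i + 2 + k) f (i + 1) = f (i + 1) := by simp only [del]; grind
      have h3 : del i f (i + 0 + k) = f (i + 2 + k) := by simp only [del]; grind
      have h4 : del i f (i + 0 + k + 1) = f (i + 2 + k + 1) := by simp only [del]; grind
      simp only [h1, h2, h3, h4]
      split_ifs
      · congr 1; funext j; simp only [del]; grind
      all_goals rfl
    · have h1 : posAct (i + 2 + k) f i = f i := by simp only [posAct]; grind
      have h2 : posAct (i + 2 + k) f (i + 1) = f (i + 1) := by simp only [posAct]; grind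
      rw [h1, h2]
      split_ifs
      · congr 1; funext j; simp only [del, posAct]; grind
      · rfl
    · have h1 : negAct (i + 2 + k) f i = f i := by simp only [negAct]; grind
      have h2 : negAct (i + 2 + k) f (i + 1) = f (i + 1) := by simp only [negAct]; grind
      rw [h1, h2]
      split_ifs
      · congr 1; funext j; simp only [del, negAct]; grind
      · rfl
    · refine Finset.sum_congr rfl fun x _ => ?_
      congr 1; funext j; simp only [ins, posAct]; grind
    · have h1 : posAct i f (i + 2 + k) = f (i + 2 + k) := by simp only [posAct]; grind
      have h2 : posAct i f (i + 2 + k + 1) = f (i + 2 + k + 1) := by simp only [posAct]; grind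
      rw [h1, h2]
      split_ifs
      · congr 1; funext j; simp only [del, posAct]; grind
      · rfl
    · congr 1; funext j; simp only [posAct]; grind
    · congr 1; funext j; simp only [posAct, negAct]; grind
    · refine Finset.sum_congr rfl fun x _ => ?_
      congr 1; funext j; simp only [ins, negAct]; grind
    · have h1 : negAct i f (i + 2 + k) = f (i + 2 + k) := by simp only [negAct]; grind
      have h2 : negAct i f (i + 2 + k + 1) = f (i + 2 + k + 1) := by simp only [negAct]; grind
      rw [h1, h2]
      split_ifs
      · congr 1; funext j; simp only [del, negAct]; grind
      · rfl
    · congr 1; funext j; simp only [posAct, negAct]; grind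
    · congr 1; funext j; simp only [negAct]; grind
  | zigzag_left i =>
    simp only [out_cup, out_cap, out_nil]
    rw [sum_ite_eq_point _ (f i) _ fun x => by simp only [ins]; grind]
    congr 1; funext j; simp only [ins, del]; grind
  | zigzag_right i =>
    simp only [out_cup, out_cap, out_nil]
    rw [sum_ite_eq_point _ (f i) _ fun x => by simp only [ins]; grind]
    congr 1; funext j; simp only [ins, del]; grind
  | cup_pos i =>
    simp only [out_cup, out_pos, out_neg, out_nil]
    refine Finset.sum_congr rfl fun x _ => ?_
    congr 1; funext j; simp only [ins, posAct, negAct]; grind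
  | cup_neg i =>
    simp only [out_cup, out_pos, out_neg, out_nil]
    -- The minima on the two sides have different colours: `x` on one side is the reflection of the
    -- other in the colour of the passing strand.
    rw [← Equiv.sum_comp (Equiv.subLeft (f i + f i))]
    refine Finset.sum_congr rfl fun x _ => ?_
    congr 1; funext j; simp only [ins, posAct, negAct, Equiv.subLeft_apply]; grind
  | cap_pos i =>
    simp only [out_cap, out_pos, out_neg, out_nil]
    have h : (posAct (i + 1) f i = posAct (i + 1) f (i + 1)) ↔
        (negAct i f (i + 1) = negAct i f (i + 1 + 1)) := by simp only [posAct, negAct]; grind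
    simp only [h]
    split_ifs
    · congr 1; funext j; simp only [posAct, negAct, del]; grind
    · rfl
  | cap_neg i =>
    simp only [out_cap, out_pos, out_neg, out_nil]
    have h : (negAct (i + 1) f i = negAct (i + 1) f (i + 1)) ↔
        (posAct i f (i + 1) = posAct i f (i + 1 + 1)) := by simp only [posAct, negAct]; grind
    simp only [h]
    split_ifs with h'
    · simp only [posAct] at h'
      congr 1; funext j; simp only [posAct, negAct, del]; grind
    · rfl
  | r1_cup_pos i =>
    simp only [out_cup, out_pos, out_nil]
    refine Finset.sum_congr rfl fun x _ => ?_
    congr 1; funext j; simp only [ins, posAct]; grind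
  | r1_cup_neg i =>
    simp only [out_cup, out_neg, out_nil]
    refine Finset.sum_congr rfl fun x _ => ?_
    congr 1; funext j; simp only [ins, negAct]; grind
  | r1_cap_pos i =>
    simp only [out_cap, out_pos, out_nil]
    have h : (posAct i f i = posAct i f (i + 1)) ↔ f i = f (i + 1) := by simp only [posAct]; grind
    simp only [h]
    split_ifs
    · congr 1; funext j; simp only [posAct, del]; grind
    · rfl
  | r1_cap_neg i =>
    simp only [out_cap, out_neg, out_nil]
    have h : (negAct i f i = negAct i f (i + 1)) ↔ f i = f (i + 1) := by simp only [negAct]; grind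
    simp only [h]
    split_ifs
    · congr 1; funext j; simp only [negAct, del]; grind
    · rfl
  | r2_pos_neg i =>
    simp only [out_pos, out_neg, out_nil]
    congr 1; funext j; simp only [posAct, negAct]; grind
  | r2_neg_pos i =>
    simp only [out_pos, out_neg, out_nil]
    congr 1; funext j; simp only [posAct, negAct]; grind
  | r3 i =>
    simp only [out_pos, out_nil]
    congr 1; funext j; simp only [posAct]; grind

theorem out_iso {m : ℕ} {w w' : List Slice} (h : Iso m w w') (f : ℕ → A) : out w f = out w' f := by
  induction h with
  | rel x y h =>
    obtain ⟨u, l, r, v, a, b, hm, -, -, -, rfl, rfl⟩ := h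
    simp only [out_append]
    congr 1
    exact Multiset.bind_congr fun g _ => out_localMove hm g
  | refl x => rfl
  | symm x y _ ih => exact ih.symm
  | trans x y z _ _ ih1 ih2 => exact ih1.trans ih2

omit [AddCommGroup A] [Fintype A] [DecidableEq A] in
theorem eqOn_ins {a i : ℕ} (x : A) {f g : ℕ → A} (h : ∀ j < a, f j = g j) (hi : i ≤ a) :
    ∀ j < a + 2, ins i x f j = ins i x g j := by
  intro j hj
  simp only [ins]
  split_ifs
  · exact h j (by omega)
  · rfl
  · exact h _ (by omega)

/-- The number of colourings only depends on the colours of the strands that enter the word. -/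
theorem card_out_congr {a b : ℕ} {w : List Slice} (hw : IsDiagram a w b) {f g : ℕ → A}
    (h : ∀ j < a, f j = g j) : (out w f).card = (out w g).card := by
  induction hw generalizing f g with
  | nil _ => simp
  | cons e i k w n _ ih =>
    cases e
    · simp only [out_cup, Multiset.card_sum]
      exact Finset.sum_congr rfl fun x _ => ih fun j hj =>
        eqOn_ins x h (by simp) j (by simp at hj ⊢; omega)
    · have h1 : f i = g i := h i (by simp; omega)
      have h2 : f (i + 1) = g (i + 1) := h (i + 1) (by simp; omega)
      simp only [out_cap, h1, h2]
      split_ifs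
      · refine ih fun j hj => ?_
        simp only [top_cap, bot_cap] at hj h
        simp only [del]
        split_ifs
        · exact h _ (by omega)
        · exact h _ (by omega)
      · rfl
    · simp only [out_pos]
      refine ih fun j hj => ?_
      simp only [top_pos, bot_pos] at hj h
      simp only [posAct, h i (by omega), h (i + 1) (by omega), h j hj]
    · simp only [out_neg]
      refine ih fun j hj => ?_
      simp only [top_neg, bot_neg] at hj h
      simp only [negAct, h i (by omega), h (i + 1) (by omega), h j hj]

theorem const_mem_act (s : Slice) (x : A) : (fun _ => x) ∈ act s (fun _ : ℕ => x) := by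
  obtain ⟨e, i⟩ := s
  cases e
  · simp only [act, Multiset.mem_map, Finset.mem_val, Finset.mem_univ, true_and]
    exact ⟨x, by funext j; simp [ins]⟩
  · rw [act, if_pos rfl, Multiset.mem_singleton]; funext j; simp [del]
  · simp only [act, Multiset.mem_singleton]; funext j; simp [posAct]
  · simp only [act, Multiset.mem_singleton]; funext j; simp [negAct]

theorem card_out_le_of_mem {s : Slice} {f g : ℕ → A} (w : List Slice) (h : g ∈ act s f) :
    (out w g).card ≤ (out (s :: w) f).card := by
  simp only [out, Multiset.card_bind]
  exact Multiset.single_le_sum (by simp) _ (Multiset.mem_map_of_mem _ h)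

theorem one_le_card_out_const (w : List Slice) (x : A) : 1 ≤ (out w fun _ => x).card := by
  induction w with
  | nil => simp
  | cons s w ih => exact ih.trans (card_out_le_of_mem w (const_mem_act s x))

/-! ### Diagrams with one endpoint at the bottom and one at the top -/

/-- The alternating sum of the first `n` colours. -/
def alt : ℕ → (ℕ → A) → A
  | 0, _ => 0
  | n + 1, f => f 0 - alt n fun j => f (j + 1)

omit [Fintype A] [DecidableEq A] in
theorem alt_ins (i n : ℕ) (x : A) (f : ℕ → A) (h : i ≤ n) :
    alt (n + 2) (ins i x f) = alt n f := by
  induction i generalizing n f with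
  | zero =>
    have : (fun j => ins 0 x f (j + 1 + 1)) = f := by funext j; simp [ins]
    simp [alt, this]
    simp [ins]
  | succ i ih =>
    obtain ⟨n, rfl⟩ := Nat.exists_eq_succ_of_ne_zero (by omega : n ≠ 0)
    have : (fun j => ins (i + 1) x f (j + 1)) = ins i x fun j => f (j + 1) := by
      funext j; simp only [ins]; grind
    rw [alt, this, ih _ _ (by omega), alt]
    simp [ins]

omit [Fintype A] [DecidableEq A] in
theorem alt_del (i n : ℕ) (f : ℕ → A) (h : i ≤ n) (hf : f i = f (i + 1)) :
    alt n (del i f) = alt (n + 2) f := by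
  have : f = ins i (f i) (del i f) := by funext j; simp only [ins, del]; grind
  rw [this, alt_ins i n _ _ h, ← this]

omit [Fintype A] [DecidableEq A] in
theorem alt_posAct (i n : ℕ) (f : ℕ → A) (h : i + 2 ≤ n) : alt n (posAct i f) = alt n f := by
  induction i generalizing n f with
  | zero =>
    obtain ⟨n, rfl⟩ := Nat.exists_eq_add_of_le' h
    have : (fun j => posAct 0 f (j + 1 + 1)) = fun j => f (j + 1 + 1) := by
      funext j; simp [posAct]
    simp only [alt, this]
    simp only [posAct]
    grind
  | succ i ih =>
    obtain ⟨n, rfl⟩ := Nat.exists_eq_succ_of_ne_zero (by omega : n ≠ 0)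
    have : (fun j => posAct (i + 1) f (j + 1)) = posAct i fun j => f (j + 1) := by
      funext j; simp only [posAct]; grind
    rw [alt, this, ih _ _ (by omega), alt]
    simp [posAct]

omit [Fintype A] [DecidableEq A] in
theorem alt_negAct (i n : ℕ) (f : ℕ → A) (h : i + 2 ≤ n) : alt n (negAct i f) = alt n f := by
  rw [← alt_posAct i n _ h]
  congr 1; funext j; simp only [posAct, negAct]; grind

/-- Each slice preserves the alternating sum of the colours at its ends and the colours of the
strands further right. With one endpoint at each end, the alternating sum is the colour itself, so a
1-1 tangle returns the colour that enters. -/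
theorem of_mem_out {a b : ℕ} {w : List Slice} (hw : IsDiagram a w b) {f g : ℕ → A}
    (h : g ∈ out w f) : alt b g = alt a f ∧ ∀ j, g (b + j) = f (a + j) := by
  induction hw generalizing f with
  | nil _ =>
    obtain rfl := Multiset.mem_singleton.1 h
    exact ⟨rfl, fun _ => rfl⟩
  | cons e i k w n _ ih =>
    obtain ⟨f', hf', hg⟩ := Multiset.mem_bind.1 h
    obtain ⟨h1, h2⟩ := ih hg
    rw [h1]
    cases e
    · obtain ⟨x, -, rfl⟩ := Multiset.mem_map.1 hf'
      constructor
      · have := alt_ins i (i + k) x f (by omega)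
        rw [add_right_comm] at this
        exact this
      · intro j; rw [h2]; simp only [ins, top_cup, bot_cup]; grind
    · simp only [act] at hf'
      split_ifs at hf' with hc
      · obtain rfl := Multiset.mem_singleton.1 hf'
        constructor
        · have := alt_del i (i + k) f (by omega) hc
          rw [add_right_comm] at this
          exact this
        · intro j; rw [h2]; simp only [del, top_cap, bot_cap]; grind
      · simp at hf'
    · obtain rfl := Multiset.mem_singleton.1 hf'
      refine ⟨alt_posAct i _ f (by simp), ?_⟩
      intro j; rw [h2]; simp only [posAct, top_pos, bot_pos]; grind
    · obtain rfl := Multiset.mem_singleton.1 hf'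
      refine ⟨alt_negAct i _ f (by simp), ?_⟩
      intro j; rw [h2]; simp only [negAct, top_neg, bot_neg]; grind

theorem eq_of_mem_out {t : List Slice} (ht : IsDiagram 1 t 1) {f g : ℕ → A}
    (h : g ∈ out t f) : g = f := by
  obtain ⟨h1, h2⟩ := of_mem_out ht h
  funext j
  cases j with
  | zero => simpa [alt] using h1
  | succ j => simpa [add_comm] using h2 j

theorem out_tangle {t : List Slice} (ht : IsDiagram 1 t 1) (f : ℕ → A) :
    out t f = Multiset.replicate (out t f).card f :=
  Multiset.eq_replicate_card.2 fun _ hg => eq_of_mem_out ht hg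

theorem card_out_closure (t : Diagram 1 1) (f : ℕ → A) :
    (out t.closure.word f).card = ∑ x : A, (out t.word fun _ => x).card := by
  simp only [Diagram.closure, out_cup, Multiset.card_sum]
  refine Finset.sum_congr rfl fun x _ => ?_
  have h1 : (out t.word fun _ => x).card = (out t.word (ins 0 x f)).card :=
    card_out_congr t.valid fun j hj => by simp [ins]; omega
  have h2 : (out [cap 0] (ins 0 x f)).card = 1 := by
    rw [out_cap, if_pos (by simp [ins])]; simp
  rw [out_append, out_tangle t.valid, Multiset.card_bind, h1]
  simp [h2]

/-- All colourings of `s` leave with the colour that entered, so each of them meets the same number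
of continuations through `t`. -/
theorem card_out_comp (s t : Diagram 1 1) (f : ℕ → A) :
    (out (s.comp t).word f).card = (out s.word f).card * (out t.word f).card := by
  simp only [Diagram.comp]
  rw [out_append, out_tangle s.valid, Multiset.card_bind]
  simp

theorem card_out_of_link_eq_unknot {D : Diagram 0 0} (h : D.link = unknot) (f : ℕ → A) :
    (out D.word f).card = Fintype.card A := by
  rw [out_iso (link_eq_iff.1 h), card_out_closure]
  simp

/-- A summand of the unknot has no more colourings than the unknot. -/
theorem card_out_le_of_comp_unknot {s t : Diagram 1 1} (h : (s.comp t).closure.link = unknot)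
    (f : ℕ → A) : (out s.closure.word f).card ≤ Fintype.card A := by
  rw [← card_out_of_link_eq_unknot h f, card_out_closure, card_out_closure]
  refine Finset.sum_le_sum fun x _ => ?_
  rw [card_out_comp]
  exact Nat.le_mul_of_pos_right _ (one_le_card_out_const _ _)

/-! ### Colourings of rational tangles -/

/-- The colours `g` of the four endpoints of a rational tangle with fraction `p / q`. -/
def Slope (p q : ℤ) (d : A) (g : ℕ → A) : Prop :=
  g 1 - g 0 = q • d ∧ g 2 - g 1 = p • d ∧ g 0 - g 1 + g 2 = g 3

omit [Fintype A] [DecidableEq A] in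
-- The half twists act on the pair `(p, q)` of colour differences by the integer transformations
-- that they induce on fractions of rational tangles.
theorem Slope.posAct_zero {p q : ℤ} {d : A} {g : ℕ → A} (h : Slope p q d g) :
    Slope (p + q) q d (posAct 0 g) := by
  obtain ⟨h1, h2, h3⟩ := h
  simp only [Slope, posAct, add_zsmul, sub_zsmul, ← h1, ← h2]
  norm_num
  grind

omit [Fintype A] [DecidableEq A] in
theorem Slope.negAct_zero {p q : ℤ} {d : A} {g : ℕ → A} (h : Slope p q d g) :
    Slope (p - q) q d (negAct 0 g) := by
  obtain ⟨h1, h2, h3⟩ := h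
  simp only [Slope, negAct, add_zsmul, sub_zsmul, ← h1, ← h2]
  norm_num
  grind

omit [Fintype A] [DecidableEq A] in
theorem Slope.posAct_one {p q : ℤ} {d : A} {g : ℕ → A} (h : Slope p q d g) :
    Slope p (q - p) d (posAct 1 g) := by
  obtain ⟨h1, h2, h3⟩ := h
  simp only [Slope, posAct, add_zsmul, sub_zsmul, ← h1, ← h2]
  norm_num
  grind

omit [Fintype A] [DecidableEq A] in
theorem Slope.negAct_one {p q : ℤ} {d : A} {g : ℕ → A} (h : Slope p q d g) :
    Slope p (q + p) d (negAct 1 g) := by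
  obtain ⟨h1, h2, h3⟩ := h
  simp only [Slope, negAct, add_zsmul, sub_zsmul, ← h1, ← h2]
  norm_num
  grind

theorem out_replicate {i : ℕ} {e : Piece} {φ : (ℕ → A) → ℕ → A}
    (he : ∀ g : ℕ → A, act ⟨e, i⟩ g = {φ g}) (n : ℕ) (g : ℕ → A) :
    out (List.replicate n ⟨e, i⟩) g = {φ^[n] g} := by
  induction n generalizing g with
  | zero => simp
  | succ n ih => simp [List.replicate_succ, out, he, ih]

omit [Fintype A] [DecidableEq A] in
theorem Slope.iterate {p q u v : ℤ} {d : A} {g : ℕ → A} {φ : (ℕ → A) → ℕ → A}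
    (hφ : ∀ (k : ℤ) g, Slope (p + k * u) (q + k * v) d g →
      Slope (p + (k + 1) * u) (q + (k + 1) * v) d (φ g))
    (h : Slope p q d g) (n : ℕ) : Slope (p + n * u) (q + n * v) d (φ^[n] g) := by
  induction n with
  | zero => simpa using h
  | succ n ih =>
    rw [Function.iterate_succ_apply']
    have := hφ n _ ih
    simpa using this

theorem out_halfTwists_zero {p q : ℤ} {d : A} {g : ℕ → A} (h : Slope p q d g) (a : ℤ) :
    ∃ g', out (halfTwists 0 a) g = {g'} ∧ Slope (a * q + p) q d g' := by
  unfold halfTwists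
  split_ifs with ha
  · refine ⟨_, out_replicate (φ := posAct 0) (fun _ => rfl) _ _, ?_⟩
    have := Slope.iterate (u := q) (v := 0) (φ := posAct 0) (fun k g hg => by
      have := hg.posAct_zero
      convert this using 1 <;> ring) h a.natAbs
    convert this using 1
    · rw [Int.natAbs_of_nonneg ha]; ring
    · ring
  · refine ⟨_, out_replicate (φ := negAct 0) (fun _ => rfl) _ _, ?_⟩
    have := Slope.iterate (u := -q) (v := 0) (φ := negAct 0) (fun k g hg => by
      have := hg.negAct_zero
      convert this using 1 <;> ring) h a.natAbs
    convert this using 1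
    · rw [Int.ofNat_natAbs_of_nonpos (by omega)]; ring
    · ring

theorem out_halfTwists_one {p q : ℤ} {d : A} {g : ℕ → A} (h : Slope p q d g) (a : ℤ) :
    ∃ g', out (halfTwists 1 (-a)) g = {g'} ∧ Slope p (a * p + q) d g' := by
  unfold halfTwists
  split_ifs with ha
  · refine ⟨_, out_replicate (φ := posAct 1) (fun _ => rfl) _ _, ?_⟩
    have := Slope.iterate (u := 0) (v := -p) (φ := posAct 1) (fun k g hg => by
      have := hg.posAct_one
      convert this using 1 <;> ring) h (-a).natAbs
    convert this using 1
    · ring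
    · rw [Int.natAbs_of_nonneg ha]; ring
  · refine ⟨_, out_replicate (φ := negAct 1) (fun _ => rfl) _ _, ?_⟩
    have := Slope.iterate (u := 0) (v := p) (φ := negAct 1) (fun k g hg => by
      have := hg.negAct_one
      convert this using 1 <;> ring) h (-a).natAbs
    convert this using 1
    · ring
    · rw [Int.ofNat_natAbs_of_nonpos (by omega)]; ring

theorem sum_bind {ι α β : Type*} (s : Finset ι) (M : ι → Multiset α) (h : α → Multiset β) :
    (∑ x ∈ s, M x).bind h = ∑ x ∈ s, (M x).bind h :=
  map_sum ({ toFun := fun t => t.bind h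
             map_zero' := Multiset.zero_bind h
             map_add' := fun t u => Multiset.add_bind t u h } : Multiset α →+ Multiset β) M s

/-- The two minima receive free colours `x` and `y`, and crossings add no choice. The colours at the
four endpoints then have slope given by the continued fraction, in units of `y - x`; the Boolean
decides which entry is the numerator. -/
theorem out_rationalWord (l : List ℤ) (b : Bool) (f : ℕ → A) :
    ∃ st : A → A → ℕ → A, out (rationalWord b l) f = ∑ x, ∑ y, {st x y} ∧
      ∀ x y, Slope (if b then (contFrac l).1 else (contFrac l).2)
        (if b then (contFrac l).2 else (contFrac l).1) (y - x) (st x y) := by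
  induction l generalizing b with
  | nil =>
    cases b
    · refine ⟨fun x y => ins 1 y (ins 0 x f), by simp [rationalWord, out_cup], fun x y => ?_⟩
      simp [Slope, contFrac, ins]
    · refine ⟨fun x y => ins 2 y (ins 0 x f), by simp [rationalWord, out_cup], fun x y => ?_⟩
      simp [Slope, contFrac, ins]
  | cons a l ih =>
    cases b
    · obtain ⟨st, h1, h2⟩ := ih true
      choose st' h3 h4 using fun x y => out_halfTwists_one (h2 x y) a
      refine ⟨st', ?_, fun x y => by simpa [contFrac] using h4 x y⟩
      simp only [rationalWord, out_append, h1, sum_bind, Multiset.singleton_bind, h3]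
    · obtain ⟨st, h1, h2⟩ := ih false
      choose st' h3 h4 using fun x y => out_halfTwists_zero (h2 x y) a
      refine ⟨st', ?_, fun x y => by simpa [contFrac] using h4 x y⟩
      simp only [rationalWord, out_append, h1, sum_bind, Multiset.singleton_bind, h3]

/-- The inner maximum asks for equal colours at the endpoints 1 and 2, whose difference is the
numerator times `d`, hence zero. The outer maximum then imposes nothing new, so `x` and `y` stay
free. -/
theorem card_out_conwayDiagram (l : List ℤ) (h : ∀ d : A, (contFrac l).1 • d = 0) (f : ℕ → A) :
    (out (conwayDiagram l).word f).card = Fintype.card A * Fintype.card A := by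
  obtain ⟨st, h1, h2⟩ := out_rationalWord (A := A) l true f
  simp only [conwayDiagram, Diagram.comp, rationalTangle, nestedCaps, out_append, h1]
  have h3 : ∀ x y, (out [cap 1, cap 0] (st x y)).card = 1 := by
    intro x y
    obtain ⟨-, h4, h5⟩ := h2 x y
    simp only [if_true, h, sub_eq_zero] at h4
    rw [out_cap, if_pos h4.symm, out_cap, if_pos]
    · simp
    · rw [h4] at h5; simpa [del] using h5
  simp only [sum_bind, Multiset.singleton_bind, Multiset.card_sum, h3]
  simp

end Coloring

/-! ### Nontriviality of the connected sum -/

open Coloring in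
/-- If the unknot has a 2-bridge link `S(q, p)` as a summand, then `q = ± 1`. -/
theorem natAbs_eq_one_of_isConnectedSum {p q : ℤ} {K₁ K₂ : Link} (h₁ : IsTwoBridge q p K₁)
    (h : IsConnectedSum K₁ K₂ unknot) : q.natAbs = 1 := by
  obtain ⟨l, ⟨hpq, hl⟩, rfl⟩ := h₁
  obtain ⟨s, t, hs, -, hst⟩ := h
  by_contra hq
  -- The modulus is |q| itself, or 2 in the case q = 0, where every modulus divides q.
  obtain ⟨n, hn, hnq⟩ : ∃ n : ℕ, 2 ≤ n ∧ (n : ℤ) ∣ q := by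
    by_cases h0 : q = 0
    · exact ⟨2, le_rfl, h0 ▸ dvd_zero _⟩
    · exact ⟨q.natAbs, by omega, Int.natAbs_dvd.2 dvd_rfl⟩
  have hdvd : (n : ℤ) ∣ (contFrac l).1 :=
    hnq.trans (hpq.dvd_of_dvd_mul_left ⟨_, hl.symm⟩)
  have : NeZero n := ⟨by omega⟩
  have h1 := card_out_le_of_comp_unknot (A := ZMod n) hst 0
  rw [out_iso (link_eq_iff.1 hs), card_out_conwayDiagram l, ZMod.card] at h1
  · nlinarith
  · intro d
    obtain ⟨c, hc⟩ := hdvd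
    simp [hc, mul_zsmul]

/-! ### Marked points of a tangle that closes up to the unknot -/

open Coloring

namespace Mark

open Classical in
/-- The colouring modulo 2 that picks out the component of the marked point. -/
noncomputable def color (M : Mark) (u v : List Slice) : ℕ → ZMod 2 := fun i =>
  if ∃ d, Valid ⟨u, v, i, d⟩ ∧ M.Equiv ⟨u, v, i, d⟩ then 1 else 0

theorem color_congr (M : Mark) {u v u' v' : List Slice} {i i' : ℕ} (c : Bool)
    (h : (∃ a, IsDiagram 0 u a ∧ i < a) ↔ ∃ a, IsDiagram 0 u' a ∧ i' < a)
    (he : ∀ d, (∃ a, IsDiagram 0 u a ∧ i < a) → Equiv ⟨u, v, i, d⟩ ⟨u', v', i', xor c d⟩) :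
    M.color u v i = M.color u' v' i' := by
  unfold color
  congr 1
  refine propext ⟨?_, ?_⟩
  · rintro ⟨d, h1, h2⟩
    exact ⟨xor c d, h.1 h1, h2.trans (he d h1)⟩
  · rintro ⟨d, h1, h2⟩
    refine ⟨xor c d, h.2 h1, h2.trans ?_⟩
    have := (he (xor c d) (h.2 h1)).symm
    simpa using this

/-- Modulo 2 the crossing rule says that colours simply follow the strands, and equivalence of marks
is preserved when a mark slides past a slice or round an extremum. -/
theorem color_mem_act (M : Mark) {u v : List Slice} {s : Slice} {n : ℕ}
    (hd : IsDiagram 0 (u ++ [s]) n) : M.color (u ++ [s]) v ∈ act s (M.color u (s :: v)) := by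
  obtain ⟨a, hu, hs⟩ := isDiagram_append_iff.1 hd
  obtain ⟨e, j⟩ := s
  rw [isDiagram_cons_iff, isDiagram_nil_iff] at hs
  obtain ⟨hj, rfl⟩ := hs
  have vu : ∀ i, (∃ b, IsDiagram 0 u b ∧ i < b) ↔ i < a := fun i =>
    ⟨fun ⟨b, h, h'⟩ => (hu.unique h) ▸ h', fun h => ⟨a, hu, h⟩⟩
  have vd : ∀ i, (∃ b, IsDiagram 0 (u ++ [⟨e, j⟩]) b ∧ i < b) ↔ i < a - e.bot + e.top := fun i =>
    ⟨fun ⟨b, h, h'⟩ => (hd.unique h) ▸ h', fun h => ⟨_, hd, h⟩⟩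
  have left : ∀ i < j, M.color (u ++ [⟨e, j⟩]) v i = M.color u (⟨e, j⟩ :: v) i := fun i hi =>
    M.color_congr false (by rw [vu, vd]; omega) fun d _ => by
      simpa using slide_left (v := v) hu d hj hi
  have right : ∀ i, j + e.bot ≤ i →
      M.color (u ++ [⟨e, j⟩]) v (i - e.bot + e.top) = M.color u (⟨e, j⟩ :: v) i := fun i hi =>
    M.color_congr false (by rw [vu, vd]; omega) fun d h => by
      rw [vd] at h
      simpa using slide_right (v := v) hu d (by omega) hi (by omega)
  have two : ∀ x y : ZMod 2, x + x - y = y := by decide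
  cases e
  · have h1 : M.color (u ++ [cup j]) v j = M.color (u ++ [cup j]) v (j + 1) :=
      M.color_congr true (by rw [vd, vd]; simp only [bot_cup, top_cup] at hj ⊢; omega) fun d _ => by
        simpa using slide_cup (v := v) hu (by simpa using hj) d
    refine Multiset.mem_map.2 ⟨M.color (u ++ [cup j]) v j, Finset.mem_univ _, ?_⟩
    funext i
    simp only [ins]
    split_ifs with h2 h3
    · exact (left i h2).symm
    · obtain rfl | rfl : i = j ∨ i = j + 1 := by omega
      · rfl
      · exact h1
    · rw [← right (i - 2) (by simp; omega)]
      congr 1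
      simp; omega
  · have h1 : M.color u (cap j :: v) j = M.color u (cap j :: v) (j + 1) :=
      M.color_congr true (by rw [vu, vu]; simp at hj ⊢; omega) fun d _ => by
        simpa using slide_cap (v := v) hu (by simpa using hj) d
    rw [act, if_pos h1, Multiset.mem_singleton]
    funext i
    simp only [del]
    split_ifs with h2
    · exact left i h2
    · rw [← right (i + 2) (by simp; omega)]
      simp
  all_goals
    rw [act, Multiset.mem_singleton]
    have h1 : M.color (u ++ [_]) v j = M.color u (_ :: v) (j + 1) :=
      M.color_congr false (by rw [vu, vd]; simp at hj ⊢; omega) fun d _ => by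
        simpa using slide_crossing_left (v := v) hu d (by simp) (by simpa using hj)
    have h2 : M.color (u ++ [_]) v (j + 1) = M.color u (_ :: v) j :=
      M.color_congr false (by rw [vu, vd]; simp at hj ⊢; omega) fun d _ => by
        simpa using slide_crossing_right (v := v) hu d (by simp) (by simpa using hj)
    funext i
    simp only [posAct, negAct, two]
    split_ifs with h3 h4
    · rw [h3, h1]
    · rw [h4, h2]
    · by_cases h5 : i < j
      · exact left i h5
      · rw [← right i (by simp; omega)]
        congr 1
        simp only [bot_pos, top_pos, bot_neg, top_neg]; omega

theorem one_le_card_out_color (M : Mark) {u v : List Slice} {n : ℕ}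
    (hd : IsDiagram 0 (u ++ v) n) : 1 ≤ (out v (M.color u v)).card := by
  induction v generalizing u with
  | nil => simp
  | cons s v ih =>
    have e : u ++ s :: v = u ++ [s] ++ v := by simp
    rw [e] at hd
    obtain ⟨b, hb, -⟩ := isDiagram_append_iff.1 hd
    exact (ih hd).trans (card_out_le_of_mem v (M.color_mem_act hb))

/-- At the first slice where the colour of the marked component appears, the zero colouring has two
distinct continuations, this colour and zero. Each extends to the top, the first by the marked
component and the second by constants. -/
theorem two_le_card_out (M : Mark) {x u v : List Slice} {n : ℕ}
    (hd : IsDiagram 0 (x ++ u ++ v) n) (h : M.color (x ++ u) v ≠ 0)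
    (h0 : M.color x (u ++ v) = 0) : 2 ≤ (out (u ++ v) (0 : ℕ → ZMod 2)).card := by
  induction u generalizing x with
  | nil => simp at h h0; exact absurd h0 h
  | cons s u ih =>
    have e : x ++ s :: u = x ++ [s] ++ u := by simp
    rw [e] at hd h
    have hd' := hd
    rw [List.append_assoc] at hd'
    obtain ⟨b, hb, -⟩ := isDiagram_append_iff.1 hd'
    have h1 := M.color_mem_act (v := u ++ v) hb
    rw [← List.cons_append, h0] at h1
    by_cases h2 : M.color (x ++ [s]) (u ++ v) = 0
    · exact (ih hd h h2).trans (card_out_le_of_mem _ (const_mem_act s 0))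
    · have h3 : ({M.color (x ++ [s]) (u ++ v), 0} : Multiset (ℕ → ZMod 2)) ≤ act s 0 := by
        rw [Multiset.le_iff_subset (by simpa using h2)]
        intro f hf
        simp only [Multiset.insert_eq_cons, Multiset.mem_cons, Multiset.mem_singleton] at hf
        rcases hf with rfl | rfl
        · exact h1
        · exact const_mem_act s 0
      obtain ⟨r, hr⟩ := Multiset.le_iff_exists_add.1 h3
      have h4 := M.one_le_card_out_color hd'
      have h5 := one_le_card_out_const (A := ZMod 2) (u ++ v) 0
      simp only [List.cons_append, out, hr, Multiset.card_bind, Multiset.map_add,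
        Multiset.sum_add, Multiset.insert_eq_cons, Multiset.map_cons, Multiset.sum_cons,
        Multiset.map_singleton, Multiset.sum_singleton]
      have h6 : (out (u ++ v) (0 : ℕ → ZMod 2)).card =
          (out (u ++ v) fun _ => (0 : ZMod 2)).card := rfl
      simp only [Function.comp_apply]
      omega

/-- If a tangle closes up to the unknot, every point of it can be slid to the boundary. -/
theorem exists_equiv_boundary {x u v : List Slice} {i : ℕ} {d : Bool} (hx : IsDiagram 0 x 4)
    (hT : IsDiagram 4 (u ++ v) 0) {D : Diagram 0 0} (hD : D.word = cup 0 :: cup 2 :: (u ++ v))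
    (hun : D.link = unknot) (hv : Valid ⟨x ++ u, v, i, d⟩) :
    ∃ i' d', Valid ⟨x, u ++ v, i', d'⟩ ∧
      Equiv ⟨x ++ u, v, i, d⟩ ⟨x, u ++ v, i', d'⟩ := by
  by_contra hcon
  push Not at hcon
  set M : Mark := ⟨x ++ u, v, i, d⟩
  have h0 : M.color x (u ++ v) = 0 := by
    funext j
    refine if_neg ?_
    rintro ⟨d', h1, h2⟩
    exact hcon j d' h1 h2
  have h1 : M.color (x ++ u) v ≠ 0 := by
    intro h
    have h2 : M.color (x ++ u) v i = 1 := if_pos ⟨d, hv, Equiv.refl _⟩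
    rw [h] at h2
    exact absurd h2 (by simp)
  -- If the mark could not reach the boundary of `T`, the zero colouring at the boundary would
  -- extend in two ways and the constant 1 in at least one. That is at least three colourings of
  -- T₀·T modulo 2, but the unknot has only two.
  have h2 := M.two_le_card_out (by simpa using hx.append hT) h1 h0
  have h3 := card_out_of_link_eq_unknot (A := ZMod 2) hun 0
  rw [hD, out_cup, Multiset.card_sum, ZMod.card] at h3
  simp only [out_cup, Multiset.card_sum] at h3
  have h4 : (out (u ++ v) (0 : ℕ → ZMod 2)).card
      = (out (u ++ v) (ins 2 (0 : ZMod 2) (ins 0 0 0))).card :=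
    card_out_congr hT fun j _ => by simp [ins]
  have h5 : (out (u ++ v) fun _ => (1 : ZMod 2)).card
      = (out (u ++ v) (ins 2 (1 : ZMod 2) (ins 0 1 0))).card :=
    card_out_congr hT fun j hj => by simp only [ins]; grind
  have h6 := one_le_card_out_const (A := ZMod 2) (u ++ v) 1
  have h7 : ∀ f : ZMod 2 → ℕ, ∑ x, f x = f 0 + f 1 := fun f => Fin.sum_univ_two f
  simp only [h7] at h3
  omega

end Mark

/-! ### Rational tangles: the action of the braid generators

`FareyAction` collects the properties of the half twists `s₀, s₁, s₂` of neighbouring endpoints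
acting on tangles with four endpoints, and of the two trivial tangles, that are used to classify
rational tangles by their fractions. -/

/-- Two braid generators acting on a set with two base points, of fractions `1/0` and `0/1`. -/
structure FareyAction (X : Type*) where
  s₀ : Equiv.Perm X
  s₁ : Equiv.Perm X
  inf : X
  zero : X
  braid : ∀ x, s₀ (s₁ (s₀ x)) = s₁ (s₀ (s₁ x))
  s₀_inf : s₀ inf = inf
  s₁_zero : s₁ zero = zero
  s₀_s₁_inf : s₀ (s₁ inf) = zero
  s₁_s₀_zero : s₁ (s₀ zero) = inf

namespace FareyAction

variable {X : Type*} (B : FareyAction X)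

theorem braid_inv (x : X) :
    B.s₀.symm (B.s₁.symm (B.s₀.symm x)) = B.s₁.symm (B.s₀.symm (B.s₁.symm x)) := by
  rw [Equiv.symm_apply_eq, Equiv.symm_apply_eq, Equiv.symm_apply_eq, B.braid]
  simp

/-- The action with all crossings changed. -/
def mirror : FareyAction X where
  s₀ := B.s₀.symm
  s₁ := B.s₁.symm
  inf := B.inf
  zero := B.zero
  braid := B.braid_inv
  s₀_inf := by rw [Equiv.symm_apply_eq, B.s₀_inf]
  s₁_zero := by rw [Equiv.symm_apply_eq, B.s₁_zero]
  s₀_s₁_inf := by rw [Equiv.symm_apply_eq, Equiv.symm_apply_eq, B.s₁_s₀_zero]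
  s₁_s₀_zero := by rw [Equiv.symm_apply_eq, Equiv.symm_apply_eq, B.s₀_s₁_inf]

@[simp] theorem mirror_s₀ : B.mirror.s₀ = B.s₀.symm := rfl
@[simp] theorem mirror_s₁ : B.mirror.s₁ = B.s₁.symm := rfl
@[simp] theorem mirror_inf : B.mirror.inf = B.inf := rfl
@[simp] theorem mirror_zero : B.mirror.zero = B.zero := rfl

/-- The element of fraction `p / q ≥ 0`, by the subtractive Euclidean algorithm. -/
def euclid (p q : ℕ) : X :=
  if q = 0 then B.inf else if p = 0 then B.zero
  else if q ≤ p then B.s₀ (euclid (p - q) q) else B.s₁.symm (euclid p (q - p))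
termination_by p + q

theorem euclid_zero_right (p : ℕ) : B.euclid p 0 = B.inf := by
  rw [euclid, if_pos rfl]

theorem euclid_zero_left {q : ℕ} (hq : q ≠ 0) : B.euclid 0 q = B.zero := by
  rw [euclid, if_neg hq, if_pos rfl]

theorem s₀_euclid (p q : ℕ) : B.s₀ (B.euclid p q) = B.euclid (p + q) q := by
  by_cases hq : q = 0
  · subst hq; rw [euclid_zero_right, euclid_zero_right, s₀_inf]
  · rw [euclid.eq_1 B (p + q), if_neg hq, if_neg (by omega), if_pos (by omega),
      Nat.add_sub_cancel]

theorem s₁_euclid {p q : ℕ} (h : p ≠ 0 ∨ q ≠ 0) : B.s₁ (B.euclid p (q + p)) = B.euclid p q := by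
  by_cases hp : p = 0
  · subst hp
    rw [add_zero, euclid_zero_left B (by simpa using h), s₁_zero]
  by_cases hq : q = 0
  · subst hq
    rw [euclid_zero_right, zero_add, euclid, if_neg hp, if_neg hp, if_pos le_rfl, Nat.sub_self,
      euclid_zero_left B hp, s₁_s₀_zero]
  · rw [euclid.eq_1 B p (q + p), if_neg (by omega), if_neg hp, if_neg (by omega),
      Nat.add_sub_cancel, Equiv.apply_symm_apply]

theorem s₁_inv_euclid {p q : ℕ} (h : p ≠ 0 ∨ q ≠ 0) :
    B.s₁.symm (B.euclid p q) = B.euclid p (q + p) := by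
  rw [Equiv.symm_apply_eq, s₁_euclid B h]

theorem euclid_induction {P : ℕ → ℕ → Prop} (h1 : ∀ p, p ≠ 0 → P p 0) (h2 : ∀ q, q ≠ 0 → P 0 q)
    (h3 : ∀ p q, q ≠ 0 → P p q → P (p + q) q)
    (h4 : ∀ p q, p ≠ 0 → P p q → P p (q + p)) {p q : ℕ}
    (h : p ≠ 0 ∨ q ≠ 0) : P p q := by
  induction hn : p + q using Nat.strong_induction_on generalizing p q with
  | _ n ih =>
    by_cases hq : q = 0
    · subst hq; exact h1 p (by simpa using h)
    by_cases hp : p = 0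
    · subst hp; exact h2 q hq
    by_cases hpq : q ≤ p
    · have := h3 (p - q) q hq (ih (p - q + q) (by omega) (Or.inr hq) rfl)
      rwa [Nat.sub_add_cancel hpq] at this
    · have := h4 p (q - p) hp (ih (p + (q - p)) (by omega) (Or.inl hp) rfl)
      rwa [Nat.sub_add_cancel (by omega)] at this

/-- The half twist of three strands acts on fractions by x ↦ -1/x, and conjugation by it exchanges
the two generators. It links the Euclidean algorithm for positive fractions with the mirrored one
for negative fractions. -/
theorem s₀_s₁_s₀_mirror_euclid {p q : ℕ} (h : p ≠ 0 ∨ q ≠ 0) :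
    B.s₀ (B.s₁ (B.s₀ (B.mirror.euclid p q))) = B.euclid q p := by
  refine euclid_induction (P := fun p q =>
    B.s₀ (B.s₁ (B.s₀ (B.mirror.euclid p q))) = B.euclid q p) ?_ ?_ ?_ ?_ h
  · intro p hp
    rw [euclid_zero_right, euclid_zero_left B hp]
    exact (congrArg (B.s₀ ∘ B.s₁) B.s₀_inf).trans B.s₀_s₁_inf
  · intro q hq
    rw [euclid_zero_right, euclid_zero_left B.mirror hq]
    exact (congrArg B.s₀ B.s₁_s₀_zero).trans B.s₀_inf
  · intro p q hq ih
    rw [← B.s₁_inv_euclid (Or.inl hq), ← ih, ← s₀_euclid, Equiv.eq_symm_apply, ← B.braid]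
    simp
  · intro p q hp ih
    rw [← B.s₀_euclid, ← ih, ← s₁_inv_euclid B.mirror (Or.inl hp)]
    simp only [mirror_s₁, Equiv.symm_symm]
    rw [← B.braid]

theorem s₀_s₁_s₀_euclid {p q : ℕ} (h : p ≠ 0 ∨ q ≠ 0) :
    B.s₀ (B.s₁ (B.s₀ (B.euclid p q))) = B.mirror.euclid q p := by
  refine euclid_induction (P := fun p q =>
    B.s₀ (B.s₁ (B.s₀ (B.euclid p q))) = B.mirror.euclid q p) ?_ ?_ ?_ ?_ h
  · intro p hp
    rw [euclid_zero_right, euclid_zero_left B.mirror hp]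
    exact (congrArg (B.s₀ ∘ B.s₁) B.s₀_inf).trans B.s₀_s₁_inf
  · intro q hq
    rw [euclid_zero_right, euclid_zero_left B hq]
    exact (congrArg B.s₀ B.s₁_s₀_zero).trans B.s₀_inf
  · intro p q hq ih
    rw [← B.mirror.s₁_inv_euclid (Or.inl hq), ← ih, ← s₀_euclid]
    simp only [mirror_s₁, Equiv.symm_symm]
    rw [← B.braid]
  · intro p q hp ih
    rw [← B.mirror.s₀_euclid, ← ih, ← B.s₁_inv_euclid (Or.inl hp)]
    simp only [mirror_s₀]
    rw [Equiv.eq_symm_apply, B.braid]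
    simp

theorem euclid_mul {k : ℕ} (hk : k ≠ 0) {p q : ℕ} (h : p ≠ 0 ∨ q ≠ 0) :
    B.euclid (k * p) (k * q) = B.euclid p q := by
  refine euclid_induction (P := fun p q => B.euclid (k * p) (k * q) = B.euclid p q) ?_ ?_ ?_ ?_ h
  · intro p _; simp [euclid_zero_right]
  · intro q hq; rw [mul_zero, euclid_zero_left B hq, euclid_zero_left B (by positivity)]
  · intro p q _ ih; rw [← s₀_euclid, ← ih, s₀_euclid, mul_add]
  · intro p q hp ih
    rw [← s₁_inv_euclid B (Or.inl hp), ← ih, s₁_inv_euclid B (Or.inl (by positivity)), mul_add]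

/-! ### Fractions of either sign -/

/-- The element of fraction `p / q`. -/
def frac (p q : ℤ) : X :=
  if 0 ≤ p * q then B.euclid p.natAbs q.natAbs else B.mirror.euclid p.natAbs q.natAbs

theorem frac_neg (p q : ℤ) : B.frac (-p) (-q) = B.frac p q := by simp [frac]

theorem frac_zero_right (p : ℤ) : B.frac p 0 = B.inf := by simp [frac, euclid_zero_right]

theorem frac_zero_left {q : ℤ} (hq : q ≠ 0) : B.frac 0 q = B.zero := by
  simp [frac, euclid_zero_left B (by simpa using hq : q.natAbs ≠ 0)]

theorem frac_natCast (p q : ℕ) : B.frac p q = B.euclid p q := by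
  rw [frac, if_pos (by positivity)]; rfl

theorem frac_neg_natCast {p q : ℕ} (h : p ≠ 0 ∨ q ≠ 0) :
    B.frac (-p) q = B.mirror.euclid p q := by
  rw [frac]
  split_ifs with h'
  · rcases eq_or_ne p 0 with rfl | hp
    · rw [euclid_zero_left _ (by simpa using h)]
      simp [euclid_zero_left B (by simpa using h : q ≠ 0)]
    rcases eq_or_ne q 0 with rfl | hq
    · simp [euclid_zero_right]
    · have : (0 : ℤ) < p * q := by positivity
      linarith
  · simp

theorem s₀_frac (p q : ℤ) : B.s₀ (B.frac p q) = B.frac (p + q) q := by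
  wlog hq : 0 ≤ q generalizing p q
  · have := this (-p) (-q) (by omega)
    rwa [frac_neg, ← neg_add, frac_neg] at this
  obtain ⟨q, rfl⟩ := Int.eq_ofNat_of_zero_le hq
  rcases eq_or_ne q 0 with rfl | hq0
  · simp [frac_zero_right, s₀_inf]
  by_cases hp : 0 ≤ p
  · obtain ⟨p, rfl⟩ := Int.eq_ofNat_of_zero_le hp
    rw [← Nat.cast_add, frac_natCast, frac_natCast, s₀_euclid]
  · obtain ⟨p, rfl⟩ : ∃ r : ℕ, p = -r := ⟨p.natAbs, by omega⟩
    rw [frac_neg_natCast B (Or.inr hq0)]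
    rcases le_or_gt q p with h | h
    · obtain ⟨r, rfl⟩ := Nat.exists_eq_add_of_le' h
      have e : -((r + q : ℕ) : ℤ) + q = -(r : ℤ) := by push_cast; ring
      rw [e, frac_neg_natCast B (Or.inr hq0), ← s₀_euclid]
      simp
    -- Adding 1 to -p/(r+p) gives the positive fraction r/(r+p). Both Euclidean expansions are
    -- brought to the fraction -p/r, where the half twist and the braid relation compare them.
    · obtain ⟨r, rfl⟩ := Nat.exists_eq_add_of_le' h.le
      have e : -(p : ℤ) + (r + p : ℕ) = (r : ℕ) := by push_cast; ring
      have hp0 : p ≠ 0 := by omega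
      have e' : B.euclid r (r + p) = B.s₁.symm (B.euclid r p) := by
        rw [s₁_inv_euclid B (Or.inr hp0), add_comm]
      rw [e, frac_natCast, e', ← s₁_inv_euclid B.mirror (Or.inl hp0),
        ← s₀_s₁_s₀_mirror_euclid B (Or.inl hp0), braid]
      simp

theorem s₁_frac {p q : ℤ} (h : p ≠ 0 ∨ q ≠ 0) : B.s₁ (B.frac p q) = B.frac p (q - p) := by
  wlog hp : 0 ≤ p generalizing p q
  · have := this (p := -p) (q := -q) (by omega) (by omega)
    rwa [frac_neg, ← neg_sub', frac_neg] at this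
  obtain ⟨p, rfl⟩ := Int.eq_ofNat_of_zero_le hp
  rcases eq_or_ne p 0 with rfl | hp0
  · have hq : q ≠ 0 := by simpa using h
    simp [frac_zero_left B hq, s₁_zero]
  by_cases hq : 0 ≤ q
  · obtain ⟨q, rfl⟩ := Int.eq_ofNat_of_zero_le hq
    rw [frac_natCast]
    rcases le_or_gt p q with h | h
    · obtain ⟨r, rfl⟩ := Nat.exists_eq_add_of_le' h
      have e : ((r + p : ℕ) : ℤ) - p = (r : ℕ) := by push_cast; ring
      rw [e, frac_natCast, s₁_euclid B (Or.inl hp0)]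
    · obtain ⟨r, rfl⟩ := Nat.exists_eq_add_of_le' h.le
      have e : (q : ℤ) - (r + q : ℕ) = -(r : ℕ) := by push_cast; ring
      have hr : r ≠ 0 := by omega
      have h1 := s₀_s₁_s₀_euclid B (p := r) (q := q) (Or.inl hr)
      rw [s₀_euclid, ← Equiv.eq_symm_apply] at h1
      rw [e, h1, ← frac_neg, neg_neg, frac_neg_natCast B (Or.inr hr), add_comm r q, ← s₀_euclid]
      rfl
  · obtain ⟨r, rfl⟩ : ∃ r : ℕ, q = -r := ⟨q.natAbs, by omega⟩
    have hr : r ≠ 0 := by omega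
    have e : -(-(r : ℤ) - p) = (r + p : ℕ) := by push_cast; ring
    rw [← frac_neg, neg_neg, ← frac_neg B p, e, frac_neg_natCast B (Or.inl hp0),
      frac_neg_natCast B (Or.inl hp0), ← s₁_inv_euclid B.mirror (Or.inl hp0)]
    rfl

theorem s₀_zpow_frac (a p q : ℤ) : (B.s₀ ^ a) (B.frac p q) = B.frac (a * q + p) q := by
  induction a using Int.induction_on with
  | zero => simp
  | succ n ih =>
    rw [add_comm, zpow_add, Equiv.Perm.mul_apply, ih, zpow_one, s₀_frac]
    congr 1; ring
  | pred n ih =>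
    have : (B.s₀ ^ (-(n : ℤ) - 1)) (B.frac p q) = B.s₀.symm ((B.s₀ ^ (-(n : ℤ))) (B.frac p q)) := by
      rw [sub_eq_neg_add, zpow_add, Equiv.Perm.mul_apply, zpow_neg_one]; rfl
    rw [this, ih, Equiv.symm_apply_eq, s₀_frac]
    congr 1; ring

theorem s₁_zpow_frac (a : ℤ) {p q : ℤ} (h : p ≠ 0 ∨ q ≠ 0) :
    (B.s₁ ^ (-a)) (B.frac p q) = B.frac p (a * p + q) := by
  have h' : ∀ c : ℤ, p ≠ 0 ∨ c * p + q ≠ 0 := by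
    intro c
    by_cases hp : p = 0
    · right; simpa [hp] using h
    · exact Or.inl hp
  induction a using Int.induction_on with
  | zero => simp
  | succ n ih =>
    have : (B.s₁ ^ (-((n : ℤ) + 1))) (B.frac p q)
        = B.s₁.symm ((B.s₁ ^ (-(n : ℤ))) (B.frac p q)) := by
      rw [neg_add_rev, zpow_add, Equiv.Perm.mul_apply, zpow_neg_one]; rfl
    rw [this, ih, Equiv.symm_apply_eq, s₁_frac B (h' _)]
    congr 1; ring
  | pred n ih =>
    have e : -(-(n : ℤ) - 1) = 1 + -(-(n : ℤ)) := by ring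
    rw [e, zpow_add, Equiv.Perm.mul_apply, ih, zpow_one, s₁_frac B (h' _)]
    congr 1; ring

theorem frac_mul {k : ℤ} (hk : k ≠ 0) {p q : ℤ} (h : p ≠ 0 ∨ q ≠ 0) :
    B.frac (k * p) (k * q) = B.frac p q := by
  have h' : p.natAbs ≠ 0 ∨ q.natAbs ≠ 0 := by simpa using h
  have hk' : k.natAbs ≠ 0 := by simpa using hk
  have hpos : 0 ≤ k * p * (k * q) ↔ 0 ≤ p * q := by
    rw [mul_mul_mul_comm]
    exact mul_nonneg_iff_of_pos_left (mul_self_pos.2 hk)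
  simp only [frac, hpos, Int.natAbs_mul, euclid_mul _ hk' h']

/-- The element only depends on the quotient. -/
theorem frac_eq_frac {p q r s : ℤ} (h : p ≠ 0 ∨ q ≠ 0) (h' : r ≠ 0 ∨ s ≠ 0)
    (hpq : p * s = q * r) : B.frac p q = B.frac r s := by
  by_cases hr : r = 0
  · subst hr
    have hs : s ≠ 0 := by simpa using h'
    obtain rfl : p = 0 := by simpa [hs] using hpq
    rw [frac_zero_left B hs, frac_zero_left B (by simpa using h)]
  · have hp : p ≠ 0 := by
      rintro rfl
      simp [hr] at hpq
      simp [hpq] at h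
    -- Both fractions are expanded to a common pair, by the factors `r` and `p`.
    rw [← frac_mul B hr h, ← frac_mul B hp h', mul_comm r q, ← hpq, mul_comm r p]

end FareyAction

/-! ### Tangles with four endpoints at the top -/

/-- Words of tangle diagrams with four endpoints at the top, up to isotopy. -/
def tangleSetoid : Setoid {w : List Slice // IsDiagram 0 w 4} where
  r x y := Iso 0 x.1 y.1
  iseqv := ⟨fun _ => Iso.refl _, Iso.symm, Iso.trans⟩

/-- Tangles with four endpoints at the top. -/
def Tangle : Type := Quotient tangleSetoid

namespace Tangle

/-- The tangle represented by a word. -/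
def mk (w : List Slice) (hw : IsDiagram 0 w 4) : Tangle := Quotient.mk tangleSetoid ⟨w, hw⟩

theorem mk_eq_mk {w w' : List Slice} {hw : IsDiagram 0 w 4} {hw' : IsDiagram 0 w' 4} :
    mk w hw = mk w' hw' ↔ Iso 0 w w' := by
  constructor
  · intro h; exact Quotient.exact h
  · intro h; exact Quotient.sound h

theorem exists_mk (x : Tangle) : ∃ w hw, x = mk w hw := by
  induction x using Quotient.inductionOn with
  | h w => exact ⟨w.1, w.2, rfl⟩

theorem isDiagram_crossing {e : Piece} (he : e.bot = 2 ∧ e.top = 2) {i : ℕ} (hi : i ≤ 2) :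
    IsDiagram 4 [⟨e, i⟩] 4 :=
  IsDiagram.cons' e i (2 - i) (IsDiagram.nil _) (by omega) (by omega)

/-- Adding a crossing at the top. -/
def cross (e : Piece) (he : e.bot = 2 ∧ e.top = 2) (i : ℕ) (hi : i ≤ 2) : Tangle → Tangle :=
  Quotient.lift (fun w => mk (w.1 ++ [⟨e, i⟩]) (w.2.append (isDiagram_crossing he hi)))
    fun _ _ h => mk_eq_mk.2 (Iso.append_right h _)

/-- A half twist of two neighbouring endpoints. -/
def twist (i : ℕ) (hi : i ≤ 2) : Equiv.Perm Tangle where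
  toFun := cross .pos ⟨rfl, rfl⟩ i hi
  invFun := cross .neg ⟨rfl, rfl⟩ i hi
  left_inv x := by
    induction x using Quotient.inductionOn with
    | h w =>
      have := Iso.append_left w.2 (iso_pos_neg (m := 4) i (by omega))
      exact Quotient.sound (show Iso 0 (w.1 ++ [pos i] ++ [neg i]) w.1 by simpa using this)
  right_inv x := by
    induction x using Quotient.inductionOn with
    | h w =>
      have := Iso.append_left w.2 (iso_neg_pos (m := 4) i (by omega))
      exact Quotient.sound (show Iso 0 (w.1 ++ [neg i] ++ [pos i]) w.1 by simpa using this)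

theorem twist_mk (i : ℕ) (hi : i ≤ 2) {w : List Slice} (hw : IsDiagram 0 w 4) :
    twist i hi (mk w hw) = mk (w ++ [pos i]) (hw.append (isDiagram_crossing ⟨rfl, rfl⟩ hi)) := rfl

theorem twist_symm_mk (i : ℕ) (hi : i ≤ 2) {w : List Slice} (hw : IsDiagram 0 w 4) :
    (twist i hi).symm (mk w hw)
      = mk (w ++ [neg i]) (hw.append (isDiagram_crossing ⟨rfl, rfl⟩ hi)) := rfl

/-- The twist of the endpoints `0, 1`. -/
def t₀ : Equiv.Perm Tangle := twist 0 (by omega)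
/-- The twist of the endpoints `1, 2`. -/
def t₁ : Equiv.Perm Tangle := twist 1 (by omega)
/-- The twist of the endpoints `2, 3`. -/
def t₂ : Equiv.Perm Tangle := twist 2 (by omega)

theorem isDiagram_inf : IsDiagram 0 [cup 0, cup 2] 4 := trivialTangle.valid

theorem isDiagram_zero : IsDiagram 0 [cup 0, cup 1] 4 := isDiagram_rationalWord [] false

/-- The tangle of fraction `1/0`. -/
def inf : Tangle := mk _ isDiagram_inf

/-- The tangle of fraction `0/1`. -/
def zero : Tangle := mk _ isDiagram_zero

theorem t₀_t₁_t₀ (x : Tangle) : t₀ (t₁ (t₀ x)) = t₁ (t₀ (t₁ x)) := by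
  obtain ⟨w, hw, rfl⟩ := exists_mk x
  have : Iso 0 (w ++ [pos 0, pos 1, pos 0]) (w ++ [pos 1, pos 0, pos 1]) :=
    Iso.append_left hw (iso_r3 0 (by omega))
  simpa only [t₀, t₁, t₂, twist_mk, mk_eq_mk, List.append_assoc, List.cons_append,
    List.nil_append] using this

theorem t₁_t₂_t₁ (x : Tangle) : t₁ (t₂ (t₁ x)) = t₂ (t₁ (t₂ x)) := by
  obtain ⟨w, hw, rfl⟩ := exists_mk x
  have : Iso 0 (w ++ [pos 1, pos 2, pos 1]) (w ++ [pos 2, pos 1, pos 2]) :=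
    Iso.append_left hw (iso_r3 1 (by omega))
  simpa only [t₀, t₁, t₂, twist_mk, mk_eq_mk, List.append_assoc, List.cons_append,
    List.nil_append] using this

theorem t₀_t₂ (x : Tangle) : t₀ (t₂ x) = t₂ (t₀ x) := by
  obtain ⟨w, hw, rfl⟩ := exists_mk x
  have : Iso 0 (w ++ [pos 2, pos 0]) (w ++ [pos 0, pos 2]) :=
    Iso.append_left hw (iso_exchange .pos .pos 0 0 (by simp)).symm
  simpa only [t₀, t₁, t₂, twist_mk, mk_eq_mk, List.append_assoc, List.cons_append,
    List.nil_append] using this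

theorem isDiagram_cup_zero : IsDiagram 0 [cup 0] 2 := isDiagram_cups 1

theorem t₀_inf : t₀ inf = inf := by
  refine mk_eq_mk.2 ?_
  have a : Iso 0 [cup 0, cup 2, pos 0] [cup 0, pos 0, cup 2] :=
    (Iso.append_left isDiagram_cup_zero (iso_exchange (m := 2) .pos .cup 0 0 (by simp))).symm
  have b : Iso 0 [cup 0, pos 0, cup 2] [cup 0, cup 2] :=
    (iso_r1_cup_pos (m := 0) 0 le_rfl).append_right [cup 2]
  exact a.trans b

theorem t₂_inf : t₂ inf = inf := by
  refine mk_eq_mk.2 ?_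
  exact (Iso.append_left isDiagram_cup_zero (iso_r1_cup_pos 2 le_rfl) :
    Iso 0 ([cup 0] ++ [cup 2, pos 2]) ([cup 0] ++ [cup 2]))

theorem t₁_zero : t₁ zero = zero := by
  refine mk_eq_mk.2 ?_
  exact (Iso.append_left isDiagram_cup_zero (iso_r1_cup_pos 1 (by omega)) :
    Iso 0 ([cup 0] ++ [cup 1, pos 1]) ([cup 0] ++ [cup 1]))

theorem t₁_inf : t₁ inf = t₂.symm zero := by
  refine mk_eq_mk.2 ?_
  exact (Iso.append_left isDiagram_cup_zero (iso_cup_neg (m := 2) 1 (by omega))).symm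

theorem t₀_zero : t₀ zero = t₂ zero := mk_eq_mk.2 (iso_nested_pos 0 le_rfl)

theorem t₂_t₁_inf : t₂ (t₁ inf) = zero := by rw [t₁_inf, Equiv.apply_symm_apply]

theorem t₀_t₁_inf : t₀ (t₁ inf) = zero := by
  rw [t₁_inf, ← t₂.apply_eq_iff_eq, ← t₀_t₂, Equiv.apply_symm_apply, t₀_zero]

theorem t₁_t₀_zero : t₁ (t₀ zero) = inf := by
  refine mk_eq_mk.2 ?_
  have a : Iso 0 [cup 0, cup 1, pos 0, pos 1] [cup 0, cup 0, neg 1, pos 1] :=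
    (Iso.append_both isDiagram_cup_zero (iso_cup_neg (m := 2) 0 (by omega)) [pos 1]).symm
  have b : Iso 0 [cup 0, cup 0, neg 1, pos 1] [cup 0, cup 0] :=
    Iso.append_left (n := 4) (u := [cup 0, cup 0])
      (by simp [isDiagram_cons_iff, isDiagram_nil_iff]) (iso_neg_pos 1 (by omega))
  have c : Iso 0 [cup 0, cup 2] [cup 0, cup 0] := iso_exchange .cup .cup 0 0 (by simp)
  exact a.trans (b.trans c.symm)

/-- The twists act on tangles as the braid generators act on fractions. -/
def farey : FareyAction Tangle where
  s₀ := t₀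
  s₁ := t₁
  inf := inf
  zero := zero
  braid := t₀_t₁_t₀
  s₀_inf := t₀_inf
  s₁_zero := t₁_zero
  s₀_s₁_inf := t₀_t₁_inf
  s₁_s₀_zero := t₁_t₀_zero

/-- The rational tangle of fraction `p / q`. -/
def frac (p q : ℤ) : Tangle := farey.frac p q

theorem t₀_frac (p q : ℤ) : t₀ (frac p q) = frac (p + q) q := farey.s₀_frac p q

theorem t₁_frac {p q : ℤ} (h : p ≠ 0 ∨ q ≠ 0) : t₁ (frac p q) = frac p (q - p) :=
  farey.s₁_frac h

theorem frac_one_zero : frac 1 0 = inf := farey.frac_zero_right 1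

theorem frac_zero_one : frac 0 1 = zero := farey.frac_zero_left one_ne_zero

theorem frac_neg (p q : ℤ) : frac (-p) (-q) = frac p q := farey.frac_neg p q

/-- Rational tangles: those obtained from the trivial tangle by twists of the endpoints
`0, 1` and `1, 2`. -/
def IsRational (x : Tangle) : Prop := ∃ p q : ℤ, (p ≠ 0 ∨ q ≠ 0) ∧ x = frac p q

theorem isRational_inf : IsRational inf := ⟨1, 0, by simp, frac_one_zero.symm⟩

theorem IsRational.twist₀ {x : Tangle} (h : IsRational x) : IsRational (t₀ x) := by
  obtain ⟨p, q, h, rfl⟩ := h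
  exact ⟨p + q, q, by omega, t₀_frac p q⟩

theorem IsRational.twist₁ {x : Tangle} (h : IsRational x) : IsRational (t₁ x) := by
  obtain ⟨p, q, h, rfl⟩ := h
  exact ⟨p, q - p, by omega, t₁_frac h⟩

theorem IsRational.twist₀_symm {x : Tangle} (h : IsRational x) : IsRational (t₀.symm x) := by
  obtain ⟨p, q, h, rfl⟩ := h
  refine ⟨p - q, q, by omega, ?_⟩
  rw [Equiv.symm_apply_eq, t₀_frac]; congr 1; ring

theorem IsRational.twist₁_symm {x : Tangle} (h : IsRational x) : IsRational (t₁.symm x) := by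
  obtain ⟨p, q, h, rfl⟩ := h
  refine ⟨p, q + p, by omega, ?_⟩
  rw [Equiv.symm_apply_eq, t₁_frac (by omega)]; congr 1; ring

/-! ### Flypes -/

/-- The twists of the endpoints `0, 1` and `2, 3` agree on `x` and on `t₁ x`. -/
def Flypes (x : Tangle) : Prop := t₀ x = t₂ x ∧ t₀ (t₁ x) = t₂ (t₁ x)

/-- The second condition in `Flypes` makes the property inductive: the braid relation turns a
statement about `t₁` of the new tangle into the two conditions on the old one. -/
theorem Flypes.twist₀ {x : Tangle} (h : Flypes x) : Flypes (t₀ x) := by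
  obtain ⟨h0, h1⟩ := h
  refine ⟨?_, ?_⟩
  · rw [← t₀_t₂, h0]
  · rw [t₀_t₁_t₀, h1, h0, ← t₁_t₂_t₁]

theorem Flypes.twist₀_symm {x : Tangle} (h : Flypes x) : Flypes (t₀.symm x) := by
  obtain ⟨h0, h1⟩ := h
  have h2 : t₀.symm x = t₂.symm x := by
    rw [Equiv.symm_apply_eq, ← t₂.apply_eq_iff_eq, ← t₀_t₂, Equiv.apply_symm_apply, h0]
  refine ⟨?_, ?_⟩
  · rw [Equiv.apply_symm_apply, h2, Equiv.apply_symm_apply]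
  · rw [← t₁.apply_eq_iff_eq, ← t₀_t₁_t₀, Equiv.apply_symm_apply, h1, h2, t₁_t₂_t₁,
      Equiv.apply_symm_apply]

/-- The property is checked for `t₀ (t₁ x)`, where the braid relation applies, and `t₀` is then
undone. -/
theorem Flypes.twist₁ {x : Tangle} (h : Flypes x) : Flypes (t₁ x) := by
  have h3 : Flypes (t₀ (t₁ x)) := by
    refine ⟨?_, ?_⟩
    · rw [← t₀_t₂, h.2]
    · rw [← t₀_t₁_t₀, ← t₀_t₂, h.twist₀.2]
  have := h3.twist₀_symm
  rwa [Equiv.symm_apply_apply] at this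

theorem t₀_t₁_symm_t₀_symm (x : Tangle) :
    t₀ (t₁.symm (t₀.symm x)) = t₁.symm (t₀.symm (t₁ x)) := by
  rw [← Equiv.eq_symm_apply, Equiv.symm_apply_eq, Equiv.symm_apply_eq, ← t₁.apply_eq_iff_eq,
    ← t₀_t₁_t₀]
  simp

theorem t₂_t₁_symm_t₂_symm (x : Tangle) :
    t₂ (t₁.symm (t₂.symm x)) = t₁.symm (t₂.symm (t₁ x)) := by
  rw [← Equiv.eq_symm_apply, Equiv.symm_apply_eq, Equiv.symm_apply_eq, ← t₁.apply_eq_iff_eq,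
    t₁_t₂_t₁]
  simp

theorem t₂_symm_eq {x : Tangle} (h : t₀ x = t₂ x) : t₂.symm (t₀ x) = x := by
  rw [h, Equiv.symm_apply_apply]

theorem t₀_symm_eq {x : Tangle} (h : t₀ x = t₂ x) : t₀.symm x = t₂.symm x := by
  rw [Equiv.symm_apply_eq, ← t₂.apply_eq_iff_eq, ← t₀_t₂, Equiv.apply_symm_apply, h]

/-- The conjugated braid relations at `t₀ x` express `t₀` and `t₂` of `t₁.symm x` by inverse twists
of tangles on which these already agree. -/
theorem Flypes.twist₁_symm {x : Tangle} (h : Flypes x) : Flypes (t₁.symm x) := by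
  refine ⟨?_, ?_⟩
  · have h1 := t₀_t₁_symm_t₀_symm (t₀ x)
    have h2 := t₂_t₁_symm_t₂_symm (t₀ x)
    rw [← t₀_symm_eq h.twist₀.1, ← t₀_symm_eq h.twist₀.2, ← h1] at h2
    rw [Equiv.symm_apply_apply] at h2
    exact h2.symm
  · rw [Equiv.apply_symm_apply]; exact h.1

theorem flypes_inf : Flypes inf :=
  ⟨by rw [t₀_inf, t₂_inf], by rw [t₀_t₁_inf, t₂_t₁_inf]⟩

theorem flypes_zero : Flypes zero := by
  rw [← t₀_t₁_inf]; exact flypes_inf.twist₁.twist₀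

theorem IsRational.flypes {x : Tangle} (h : IsRational x) : Flypes x := by
  obtain ⟨p, q, h, rfl⟩ := h
  have h' : p.natAbs ≠ 0 ∨ q.natAbs ≠ 0 := by simpa using h
  unfold frac FareyAction.frac
  split_ifs
  · refine FareyAction.euclid_induction (P := fun p q => Flypes (farey.euclid p q)) ?_ ?_ ?_ ?_ h'
    · intro p _; rw [FareyAction.euclid_zero_right]; exact flypes_inf
    · intro q hq; rw [FareyAction.euclid_zero_left _ hq]; exact flypes_zero
    · intro p q _ ih; rw [← FareyAction.s₀_euclid]; exact ih.twist₀
    · intro p q hp ih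
      rw [← FareyAction.s₁_inv_euclid _ (Or.inl hp)]; exact ih.twist₁_symm
  · refine FareyAction.euclid_induction (P := fun p q => Flypes (farey.mirror.euclid p q))
      ?_ ?_ ?_ ?_ h'
    · intro p _; rw [FareyAction.euclid_zero_right]; exact flypes_inf
    · intro q hq; rw [FareyAction.euclid_zero_left _ hq]; exact flypes_zero
    · intro p q _ ih; rw [← FareyAction.s₀_euclid]; exact ih.twist₀_symm
    · intro p q hp ih
      rw [← FareyAction.s₁_inv_euclid _ (Or.inl hp)]; exact ih.twist₁

theorem IsRational.t₀_eq_t₂ {x : Tangle} (h : IsRational x) : t₀ x = t₂ x := h.flypes.1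

/-- Exchanging the endpoints `0, 1` with the endpoints `2, 3` does not change a rational tangle. -/
theorem IsRational.exchange {x : Tangle} (h : IsRational x) :
    t₁ (t₂ (t₀ (t₁ (t₂ (t₀ x))))) = x := by
  -- Flypes turn every `t₂` into `t₀`, and the rest is arithmetic: p/q ↦ (p+2q)/q ↦ -(p+2q)/(p+q) ↦
  -- p/(p+q) ↦ p/q.
  rw [← h.twist₀.t₀_eq_t₂, ← h.twist₀.twist₀.twist₁.twist₀.t₀_eq_t₂]
  obtain ⟨p, q, h, rfl⟩ := h
  rw [t₀_frac, t₀_frac, t₁_frac (by omega), t₀_frac, t₀_frac, t₁_frac (by omega), ← frac_neg]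
  congr 1 <;> ring

/-- The twists come in the order opposite to `IsRational.exchange`, because the relation is turned
upside down before it is applied to the two maxima. -/
theorem exchange_inf : t₀ (t₂ (t₁ (t₀ (t₂ (t₁ inf))))) = inf := by
  have h := isRational_inf.twist₁
  rw [← h.t₀_eq_t₂, ← h.twist₀.twist₀.twist₁.t₀_eq_t₂, ← frac_one_zero, t₁_frac (by omega),
    t₀_frac, t₀_frac, t₁_frac (by omega), t₀_frac, t₀_frac, ← frac_neg]
  congr 1

/-! ### Conway notation -/

theorem mk_replicate {w : List Slice} (hw : IsDiagram 0 w 4) {s : Slice}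
    {φ : Equiv.Perm Tangle} (hφ : ∀ w hw, ∃ hw', φ (mk w hw) = mk (w ++ [s]) hw') (n : ℕ) :
    ∃ hw', (φ ^ n) (mk w hw) = mk (w ++ List.replicate n s) hw' := by
  induction n with
  | zero => exact ⟨by simpa using hw, by simp⟩
  | succ n ih =>
    obtain ⟨h1, h2⟩ := ih
    obtain ⟨h3, h4⟩ := hφ _ h1
    refine ⟨by simpa [List.replicate_succ'] using h3, ?_⟩
    rw [pow_succ', Equiv.Perm.mul_apply, h2, h4]
    simp [List.replicate_succ']

theorem twist_zpow_mk {w : List Slice} (hw : IsDiagram 0 w 4) {i : ℕ} (hi : i ≤ 2) (a : ℤ)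
    (hw' : IsDiagram 0 (w ++ halfTwists i a) 4) :
    (twist i hi ^ a) (mk w hw) = mk (w ++ halfTwists i a) hw' := by
  unfold halfTwists at hw' ⊢
  split_ifs with ha
  · obtain ⟨_, h⟩ := mk_replicate hw (s := pos i) (φ := twist i hi)
      (fun w hw => ⟨_, twist_mk i hi hw⟩) a.natAbs
    simp only [ha, if_true] at hw'
    rw [← h, ← zpow_natCast, Int.natAbs_of_nonneg ha]
  · obtain ⟨_, h⟩ := mk_replicate hw (s := neg i) (φ := (twist i hi).symm)
      (fun w hw => ⟨_, twist_symm_mk i hi hw⟩) a.natAbs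
    have e : (twist i hi).symm ^ a.natAbs = twist i hi ^ a := by
      rw [← Equiv.Perm.inv_def, inv_pow, ← zpow_natCast, ← zpow_neg,
        Int.ofNat_natAbs_of_nonpos (by omega), neg_neg]
    rw [← e, h]

theorem contFrac_ne_zero (l : List ℤ) : (contFrac l).1 ≠ 0 ∨ (contFrac l).2 ≠ 0 := by
  induction l with
  | nil => simp [contFrac]
  | cons a l ih =>
    simp only [contFrac]
    by_cases h : (contFrac l).1 = 0
    · left; simpa [h] using ih
    · exact Or.inr h

theorem mk_append_halfTwists_zero {w : List Slice} (hw : IsDiagram 0 w 4) {p q : ℤ}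
    (h : mk w hw = frac p q) (a : ℤ) :
    mk (w ++ halfTwists 0 a) (hw.append (isDiagram_halfTwists 0 2 a)) = frac (a * q + p) q := by
  rw [← twist_zpow_mk hw (by omega), h]
  exact farey.s₀_zpow_frac a p q

theorem mk_append_halfTwists_one {w : List Slice} (hw : IsDiagram 0 w 4) {p q : ℤ}
    (h0 : p ≠ 0 ∨ q ≠ 0) (h : mk w hw = frac p q) (a : ℤ) :
    mk (w ++ halfTwists 1 (-a)) (hw.append (isDiagram_halfTwists 1 1 (-a)))
      = frac p (a * p + q) := by
  rw [← twist_zpow_mk hw (by omega), h]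
  exact farey.s₁_zpow_frac a h0

/-- A block of twists performs one step of the continued fraction. For `b = false` the twists start
with the other pair of endpoints, and numerator and denominator exchange their roles. -/
theorem mk_rationalWord (l : List ℤ) (b : Bool) :
    mk (rationalWord b l) (isDiagram_rationalWord l b) =
      if b then frac (contFrac l).1 (contFrac l).2 else frac (contFrac l).2 (contFrac l).1 := by
  induction l generalizing b with
  | nil =>
    cases b
    · exact frac_zero_one.symm
    · exact frac_one_zero.symm
  | cons a l ih =>
    cases b
    · exact mk_append_halfTwists_one _ (contFrac_ne_zero l) (ih true) a
    · exact mk_append_halfTwists_zero _ (ih false) a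

end Tangle

/-! ### Braids on the first three of four strands -/

/-- All pieces are crossings of the strands `0, 1` or `1, 2`. -/
def IsThreeBraid (w : List Slice) : Prop :=
  ∀ s ∈ w, (s.piece = Piece.pos ∨ s.piece = Piece.neg) ∧ s.left ≤ 1

namespace IsThreeBraid

variable {w w' : List Slice}

theorem isBraid (h : IsThreeBraid w) : IsBraid w := fun s hs => (h s hs).1

theorem append (h : IsThreeBraid w) (h' : IsThreeBraid w') : IsThreeBraid (w ++ w') :=
  fun s hs => (List.mem_append.1 hs).elim (h s) (h' s)

theorem mirror (h : IsThreeBraid w) : IsThreeBraid (mirror w) := by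
  intro s hs
  refine ⟨h.isBraid.mirror s hs, ?_⟩
  simp only [HTwo.mirror, List.mem_map] at hs
  obtain ⟨s', hs', rfl⟩ := hs
  exact (h s' hs').2

theorem reverse (h : IsThreeBraid w) : IsThreeBraid w.reverse :=
  fun s hs => h s (List.mem_reverse.1 hs)

theorem inv (h : IsThreeBraid w) : IsThreeBraid (inv w) := h.mirror.reverse

theorem no_cup (h : IsThreeBraid w) : ∀ s ∈ w, s.piece ≠ Piece.cup := by
  intro s hs; rcases (h s hs).1 with h | h <;> simp [h]

theorem no_cap (h : IsThreeBraid w) : ∀ s ∈ w, s.piece ≠ Piece.cap := by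
  intro s hs; rcases (h s hs).1 with h | h <;> simp [h]

theorem isDiagram (h : IsThreeBraid w) : IsDiagram 4 w 4 := by
  induction w with
  | nil => exact IsDiagram.nil _
  | cons s w ih =>
    obtain ⟨e, i⟩ := s
    have hw := ih fun s hs => h s (by simp [hs])
    obtain ⟨he, hi⟩ := h ⟨e, i⟩ (by simp)
    simp only at he hi
    have hb : e.bot = 2 ∧ e.top = 2 := by rcases he with rfl | rfl <;> simp
    exact IsDiagram.cons' e i (2 - i) hw (by omega) (by omega)

end IsThreeBraid

theorem isThreeBraid_halfTwists {i : ℕ} (hi : i ≤ 1) (a : ℤ) : IsThreeBraid (halfTwists i a) := by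
  intro s hs
  unfold halfTwists at hs
  split_ifs at hs <;> obtain rfl := List.eq_of_mem_replicate hs <;> simp [hi]

theorem mirror_halfTwists (i : ℕ) (a : ℤ) : mirror (halfTwists i a) = halfTwists i (-a) := by
  unfold halfTwists
  rcases lt_trichotomy a 0 with h | rfl | h
  · rw [if_neg (by omega), if_pos (by omega)]; simp [mirror, Piece.mirror]
  · simp
  · rw [if_pos (by omega), if_neg (by omega)]; simp [mirror, Piece.mirror]

open Tangle

theorem IsThreeBraid.isRational {u w : List Slice} {hu : IsDiagram 0 u 4} (hw : IsThreeBraid w)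
    (h : IsRational (mk u hu)) : IsRational (mk (u ++ w) (hu.append hw.isDiagram)) := by
  induction w generalizing u with
  | nil => simpa using h
  | cons s w ih =>
    obtain ⟨e, i⟩ := s
    have hw' : IsThreeBraid w := fun s hs => hw s (by simp [hs])
    obtain ⟨he, hi⟩ := hw ⟨e, i⟩ (by simp)
    simp only at he hi
    have hb : e.bot = 2 ∧ e.top = 2 := by rcases he with rfl | rfl <;> simp
    have hd := isDiagram_crossing hb (show i ≤ 2 by omega)
    have h1 : IsRational (mk (u ++ [⟨e, i⟩]) (hu.append hd)) := by
      obtain rfl | rfl : i = 0 ∨ i = 1 := by omega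
      · rcases he with rfl | rfl
        · exact h.twist₀
        · exact h.twist₀_symm
      · rcases he with rfl | rfl
        · exact h.twist₁
        · exact h.twist₁_symm
    have := ih hw' h1
    simpa using this

theorem IsThreeBraid.isRational_inf {w : List Slice} (hw : IsThreeBraid w) :
    IsRational (mk ([cup 0, cup 2] ++ w) (isDiagram_inf.append hw.isDiagram)) :=
  hw.isRational Tangle.isRational_inf

/-- A rational tangle is a braid on top of the trivial tangle; the mirror image of the braid gives
the tangle of the negative fraction. -/
theorem exists_isThreeBraid (l : List ℤ) (b : Bool) :
    ∃ β, ∃ hβ : IsThreeBraid β, Iso 0 ([cup 0, cup 2] ++ β) (rationalWord b l) ∧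
      mk ([cup 0, cup 2] ++ mirror β) (isDiagram_inf.append hβ.mirror.isDiagram) =
        if b then frac (-(contFrac l).1) (contFrac l).2
        else frac (-(contFrac l).2) (contFrac l).1 := by
  induction l generalizing b with
  | nil =>
    cases b
    -- The innermost tangle may be the one of fraction 0/1. Two crossings bring 1/0 to 0/1, and so
    -- do the two mirrored crossings.
    · refine ⟨[pos 1, pos 0], by intro s hs; fin_cases hs <;> simp, ?_, ?_⟩
      · have h := t₀_t₁_inf
        exact mk_eq_mk.1 h
      · have h : t₀.symm (t₁.symm inf) = zero := by
          rw [Equiv.symm_apply_eq, Equiv.symm_apply_eq, t₁_t₀_zero]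
        exact h.trans frac_zero_one.symm
    · refine ⟨[], by intro s hs; simp at hs, Iso.refl _, ?_⟩
      have : frac (-(contFrac []).1) (contFrac []).2 = inf := by
        rw [← frac_neg]; exact frac_one_zero
      rw [if_pos rfl, this]; rfl
  | cons a l ih =>
    cases b
    · obtain ⟨β, hβ, h1, h2⟩ := ih true
      refine ⟨β ++ halfTwists 1 (-a), hβ.append (isThreeBraid_halfTwists le_rfl _), ?_, ?_⟩
      · have := h1.append_right (halfTwists 1 (-a))
        simpa [rationalWord] using this
      · have := mk_append_halfTwists_one _ (by have := contFrac_ne_zero l; omega) h2 (-a)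
        simp only [mirror_append, mirror_halfTwists, ← List.append_assoc]
        rw [this]
        simp [contFrac]
    · obtain ⟨β, hβ, h1, h2⟩ := ih false
      refine ⟨β ++ halfTwists 0 a, hβ.append (isThreeBraid_halfTwists (by omega) _), ?_, ?_⟩
      · have := h1.append_right (halfTwists 0 a)
        simpa [rationalWord] using this
      · have := mk_append_halfTwists_zero _ h2 (-a)
        simp only [mirror_append, mirror_halfTwists, ← List.append_assoc]
        rw [this]
        simp only [contFrac, if_true]
        congr 1; ring

/-! ### Diagrams of 2-bridge links -/

theorem rot_append {m a : ℕ} {u v : List Slice} (hu : IsDiagram m u a) :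
    rot m (u ++ v) = rot a v ++ rot m u := by
  induction hu with
  | nil _ => simp [rot]
  | cons e i k w n _ ih =>
    have e1 : i + e.bot + k - e.bot + e.top = i + e.top + k := by omega
    simp only [List.cons_append, rot, e1, ih, List.append_assoc]

theorem IsThreeBraid.rot_eq {w : List Slice} (hw : IsThreeBraid w) :
    rot 4 w = (w.map fun s => (⟨s.piece, 2 - s.left⟩ : Slice)).reverse := by
  induction w with
  | nil => rfl
  | cons s w ih =>
    obtain ⟨e, i⟩ := s
    obtain ⟨he, hi⟩ := hw ⟨e, i⟩ (by simp)
    simp only at he hi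
    rw [rot, List.map_cons, List.reverse_cons]
    rcases he with rfl | rfl
    · simp only [bot_pos, top_pos]
      rw [ih fun s hs => hw s (by simp [hs])]
      simp only [Piece.dual]
      congr 3; omega
    · simp only [bot_neg, top_neg]
      rw [ih fun s hs => hw s (by simp [hs])]
      simp only [Piece.dual]
      congr 3; omega

/-- On the trivial tangle, a braid on the first three strands may be replaced by the corresponding
braid on the last three strands. -/
theorem IsThreeBraid.iso_reflect {w : List Slice} (hw : IsThreeBraid w) :
    Iso 0 ([cup 0, cup 2] ++ w.map fun s => (⟨s.piece, 2 - s.left⟩ : Slice))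
      ([cup 0, cup 2] ++ w) := by
  induction w using List.reverseRecOn with
  | nil => exact Iso.refl _
  | append_singleton w s ih =>
    have hw' : IsThreeBraid w := fun s hs => hw s (by simp [hs])
    obtain ⟨e, i⟩ := s
    obtain ⟨he, hi⟩ := hw ⟨e, i⟩ (by simp)
    simp only at he hi
    rw [List.map_append, ← List.append_assoc, ← List.append_assoc]
    refine ((ih hw').append_right _).trans ?_
    have hr := hw'.isRational_inf
    obtain rfl | rfl : i = 0 ∨ i = 1 := by omega
    · rcases he with rfl | rfl
      · exact mk_eq_mk.1 hr.t₀_eq_t₂.symm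
      · exact mk_eq_mk.1 (t₀_symm_eq hr.t₀_eq_t₂).symm
    · exact Iso.refl _

theorem iso_caps_exchange : Iso 4 [cap 0, cap 0] [cap 2, cap 0] :=
  iso_exchange .cap .cap 0 0 (by simp)

theorem iso_inf : Iso 0 [cup 0, cup 2] [cup 0, cup 0] := iso_exchange .cup .cup 0 0 (by simp)

/-- Turned upside down, this is the fact that the half twist of three strands takes 0/1 to 1/0. -/
theorem iso_nestedCaps : Iso 4 [pos 0, pos 1, pos 0, cap 1, cap 0] [cap 2, cap 0] := by
  have h : t₀ (t₁ (t₀ zero)) = inf := by rw [t₁_t₀_zero, t₀_inf]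
  have h1 : Iso 0 [cup 0, cup 1, pos 0, pos 1, pos 0] [cup 0, cup 2] := mk_eq_mk.1 h
  exact h1.flip (n := 4) (by simp [isDiagram_cons_iff, isDiagram_nil_iff])

/-- The diagram of the 2-bridge link `S(q, p)` used for the band surgery. -/
theorem iso_conwayDiagram {p q : ℤ} {l l₁ : List ℤ} (hl : IsContFrac p q l)
    (hl₁ : IsContFrac q p l₁) {β : List Slice} (hβ : IsThreeBraid β)
    (h : mk ([cup 0, cup 2] ++ mirror β) (isDiagram_inf.append hβ.mirror.isDiagram) =
      frac (-(contFrac l).1) (contFrac l).2) :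
    Iso 0 (conwayDiagram l₁).word ([cup 0, cup 2] ++ inv β ++ [cap 2, cap 0]) := by
  have hp : q ≠ 0 ∨ p ≠ 0 := by
    by_contra hc
    push Not at hc
    have := hl.1
    rw [hc.1, hc.2] at this
    exact not_isCoprime_zero_zero this
  -- The half twist x ↦ -1/x takes the fraction -p/q of the mirrored braid to q/p. The same three
  -- crossings turn the nested maxima into maxima side by side, so they disappear from the closed
  -- diagram.
  have hR : t₀ (t₁ (t₀ (frac (-(contFrac l).1) (contFrac l).2)))
      = frac (contFrac l₁).1 (contFrac l₁).2 := by
    have h0 := contFrac_ne_zero l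
    rw [t₀_frac, t₁_frac (by omega), t₀_frac]
    have e1 : frac (contFrac l).2 (contFrac l).1 = frac q p :=
      farey.frac_eq_frac (by omega) hp (by linarith [hl.2])
    have e2 : frac (contFrac l₁).1 (contFrac l₁).2 = frac q p :=
      farey.frac_eq_frac (contFrac_ne_zero l₁) hp (by linarith [hl₁.2])
    rw [e2, ← e1]
    congr 1 <;> ring
  have hW : IsDiagram 4 [pos 0, pos 1, pos 0] 4 := by
    simp [isDiagram_cons_iff, isDiagram_nil_iff]
  have h1 : Iso 0 (rationalWord true l₁) ([cup 0, cup 2] ++ mirror β ++ [pos 0, pos 1, pos 0]) := by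
    rw [← h] at hR
    have h2 := mk_rationalWord l₁ true
    rw [if_pos rfl, ← hR] at h2
    have h3 := mk_eq_mk.1 h2
    simp only [List.append_assoc] at h3 ⊢
    exact h3
  have hm : IsDiagram 0 ([cup 0, cup 2] ++ mirror β) 4 :=
    isDiagram_inf.append hβ.mirror.isDiagram
  have h2 : Iso 0 (conwayDiagram l₁).word ([cup 0, cup 2] ++ mirror β ++ [cap 2, cap 0]) := by
    have a := h1.append_right [cap 1, cap 0]
    have b := Iso.append_left hm iso_nestedCaps
    rw [List.append_assoc _ [pos 0, pos 1, pos 0]] at a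
    exact a.trans b
  have hcap : IsDiagram 4 [cap 2, cap 0] 0 := by simp [isDiagram_cons_iff, isDiagram_nil_iff]
  -- Rotation by π reverses the mirrored braid, which makes it the inverse of `β`, but puts it on
  -- the last three strands. On the trivial tangle flypes bring it back to the first three.
  have h3 := iso_rot (hm.append hcap)
  rw [rot_append hm, rot_append isDiagram_inf, hβ.mirror.rot_eq] at h3
  have e1 : rot 4 [cap 2, cap 0] = [cup 0, cup 0] := rfl
  have e2 : rot 0 [cup 0, cup 2] = [cap 0, cap 0] := rfl
  rw [e1, e2] at h3
  have h4 := (iso_inf.symm.append_right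
    ((mirror β).map fun s => (⟨s.piece, 2 - s.left⟩ : Slice)).reverse).append_right [cap 0, cap 0]
  rw [← List.map_reverse] at h3 h4
  have h5 := hβ.inv.iso_reflect.append_right [cap 0, cap 0]
  have h6 := Iso.append_left (isDiagram_inf.append hβ.inv.isDiagram) iso_caps_exchange
  simp only [List.append_assoc] at h2 h3 h4 h5 h6 ⊢
  exact h2.trans (h3.trans (h4.trans (h5.trans h6)))

/-! ### The symmetries of a 2-bridge link -/

namespace Mark

/-- All four points at the maxima of a 2-bridge diagram are equivalent. -/
theorem equiv_maxima {γ : List Slice} (hγ : IsThreeBraid γ) {j : ℕ} (hj : j < 4) :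
    Equiv ⟨[cup 0, cup 2] ++ γ, [cap 2, cap 0], 0, true⟩
      ⟨[cup 0, cup 2] ++ γ, [cap 2, cap 0], j, true⟩ := by
  have hr := hγ.isRational_inf
  set R := [cup 0, cup 2] ++ γ with hRdef
  have hR : IsDiagram 0 R 4 := isDiagram_inf.append hγ.isDiagram
  have cr : ∀ {u : List Slice} (e : Piece) (i : ℕ), IsDiagram 0 u 4 →
      (e = Piece.pos ∨ e = Piece.neg) → i ≤ 2 → IsDiagram 0 (u ++ [⟨e, i⟩]) 4 := by
    intro u e i hu he hi
    exact hu.append (isDiagram_crossing (by rcases he with rfl | rfl <;> simp) hi)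
  have h01 : Equiv ⟨R, [cap 2, cap 0], 0, true⟩ ⟨R, [cap 2, cap 0], 1, true⟩ := by
    -- By a flype the pair `pos 0`, `neg 2` may be inserted on top of `R`. The mark passes through
    -- the first crossing and changes its strand, after which the maxima absorb both crossings as
    -- kinks.
    have a : Iso 0 (R ++ [pos 0] ++ [neg 2]) R := by
      have : t₂.symm (t₀ (Tangle.mk R hR)) = Tangle.mk R hR := t₂_symm_eq hr.t₀_eq_t₂
      exact mk_eq_mk.1 this
    have h0 := cr .pos 0 hR (by simp) (by omega)
    have s0 := slide_left (v := [cap 2, cap 0]) h0 (e := .neg) (i := 0) (j := 2) true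
      (by simp) (by omega)
    have s1 := slide_crossing_left (v := [neg 2, cap 2, cap 0]) hR (e := .pos) (j := 0) true
      (by simp) (by omega)
    have b : Iso 4 [pos 0, neg 2, cap 2, cap 0] [cap 2, cap 0] := by
      have b1 : Iso 4 [pos 0, neg 2, cap 2, cap 0] [pos 0, cap 2, cap 0] :=
        Iso.append_both (isDiagram_crossing (e := .pos) ⟨rfl, rfl⟩ (show 0 ≤ 2 by omega))
          (iso_r1_cap_neg 2 (by omega)) [cap 0]
      have b2 : Iso 4 [pos 0, cap 2, cap 0] [cap 2, pos 0, cap 0] :=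
        (iso_exchange (m := 4) .pos .cap 0 0 (by simp)).append_right [cap 0]
      have b3 : Iso 4 [cap 2, pos 0, cap 0] [cap 2, cap 0] :=
        Iso.append_left (u := [cap 2]) (n := 2) (by simp [isDiagram_cons_iff, isDiagram_nil_iff])
          (iso_r1_cap_pos 0 le_rfl)
      exact b1.trans (b2.trans b3)
    exact (equiv_of_iso_below 0 true a).symm.trans
      (s0.trans (s1.trans (equiv_of_iso_above hR (by omega) true b)))
  have h23 : Equiv ⟨R, [cap 2, cap 0], 2, true⟩ ⟨R, [cap 2, cap 0], 3, true⟩ := by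
    have a : Iso 0 (R ++ [pos 2] ++ [neg 0]) R := by
      have : t₀.symm (t₂ (Tangle.mk R hR)) = Tangle.mk R hR := by
        rw [← hr.t₀_eq_t₂, Equiv.symm_apply_apply]
      exact mk_eq_mk.1 this
    have h0 := cr .pos 2 hR (by simp) (by omega)
    have s0 := slide_right (v := [cap 2, cap 0]) h0 (e := .neg) (i := 2) (i' := 2) (j := 0) true
      (by omega) (by simp) (by simp)
    have s1 := slide_crossing_left (v := [neg 0, cap 2, cap 0]) hR (e := .pos) (j := 2) true
      (by simp) (by omega)
    have b : Iso 4 [pos 2, neg 0, cap 2, cap 0] [cap 2, cap 0] := by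
      have b1 : Iso 4 [pos 2, neg 0, cap 2, cap 0] [pos 2, cap 2, neg 0, cap 0] :=
        Iso.append_both (isDiagram_crossing (e := .pos) ⟨rfl, rfl⟩ (show 2 ≤ 2 by omega))
          (iso_exchange .neg .cap 0 0 (by simp)) [cap 0]
      have b2 : Iso 4 [pos 2, cap 2, neg 0, cap 0] [cap 2, neg 0, cap 0] :=
        (iso_r1_cap_pos (m := 4) 2 (by simp)).append_right [neg 0, cap 0]
      have b3 : Iso 4 [cap 2, neg 0, cap 0] [cap 2, cap 0] :=
        Iso.append_left (u := [cap 2]) (n := 2) (by simp [isDiagram_cons_iff, isDiagram_nil_iff])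
          (iso_r1_cap_neg 0 le_rfl)
      exact b1.trans (b2.trans b3)
    exact (equiv_of_iso_below 2 true a).symm.trans
      (s0.trans (s1.trans (equiv_of_iso_above hR (by omega) true b)))
  have h03 : Equiv ⟨R, [cap 2, cap 0], 0, true⟩ ⟨R, [cap 2, cap 0], 3, true⟩ := by
    -- The six crossings form a half twist of all four strands, which reverses their order. Both the
    -- rational tangle and the two maxima absorb it, and the mark is taken from one outer strand to
    -- the other.
    have a : Iso 0 (R ++ [pos 0] ++ [pos 2] ++ [pos 1] ++ [pos 0] ++ [pos 2] ++ [pos 1]) R :=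
      mk_eq_mk.1 hr.exchange
    have h0 := cr .pos 0 hR (by simp) (by omega)
    have h1 := cr .pos 2 h0 (by simp) (by omega)
    have h2 := cr .pos 1 h1 (by simp) (by omega)
    have h3 := cr .pos 0 h2 (by simp) (by omega)
    have h4 := cr .pos 2 h3 (by simp) (by omega)
    have s0 := slide_left (v := [cap 2, cap 0]) h4 (e := .pos) (i := 0) (j := 1) true
      (by simp) (by omega)
    have s1 := slide_left (v := [pos 1, cap 2, cap 0]) h3 (e := .pos) (i := 0) (j := 2) true
      (by simp) (by omega)
    have s2 := slide_crossing_left (v := [pos 2, pos 1, cap 2, cap 0]) h2 (e := .pos) (j := 0) true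
      (by simp) (by omega)
    have s3 := slide_crossing_left (v := [pos 0, pos 2, pos 1, cap 2, cap 0]) h1 (e := .pos)
      (j := 1) true (by simp) (by omega)
    have s4 := slide_crossing_left (v := [pos 1, pos 0, pos 2, pos 1, cap 2, cap 0]) h0
      (e := .pos) (j := 2) true (by simp) (by omega)
    have s5 := slide_right (v := [pos 2, pos 1, pos 0, pos 2, pos 1, cap 2, cap 0]) hR
      (e := .pos) (i := 3) (i' := 3) (j := 0) true (by omega) (by simp) (by simp)
    have b : Iso 4 [pos 0, pos 2, pos 1, pos 0, pos 2, pos 1, cap 2, cap 0] [cap 2, cap 0] := by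
      have h : Iso 0 [cup 0, cup 2, pos 1, pos 2, pos 0, pos 1, pos 2, pos 0] [cup 0, cup 2] :=
        mk_eq_mk.1 exchange_inf
      exact h.flip (n := 4) (by simp [isDiagram_cons_iff, isDiagram_nil_iff])
    exact (equiv_of_iso_below 0 true a).symm.trans (s0.trans (s1.trans (s2.trans (s3.trans
      (s4.trans (s5.trans (equiv_of_iso_above hR (by omega) true b)))))))
  interval_cases j
  · exact Equiv.refl _
  · exact h01
  · exact h03.trans h23.symm
  · exact h03

end Mark

/-! ### Sliding marked points to the minima and the maxima -/

namespace Mark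

theorem valid_closure_below (s : Diagram 1 1) : Valid ⟨cup 0 :: s.word, [cap 0], 0, true⟩ :=
  ⟨2, isDiagram_cup_zero.append (s.valid.add_right 1), by simp⟩

theorem valid_closure_above (t : Diagram 1 1) : Valid ⟨[cup 0], t.word ++ [cap 0], 0, true⟩ :=
  ⟨2, isDiagram_cup_zero, by simp⟩

/-- Marked points at the two minima `cup 0`, `cup 2` may be directed upwards. -/
theorem exists_equiv_up_cups {v : List Slice} {i : ℕ} {d : Bool}
    (h : Valid ⟨[cup 0, cup 2], v, i, d⟩) :
    ∃ j < 4, Equiv ⟨[cup 0, cup 2], v, i, d⟩ ⟨[cup 0, cup 2], v, j, true⟩ := by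
  obtain ⟨a, ha, hi⟩ := h
  obtain rfl := isDiagram_inf.unique ha
  simp only at hi
  cases d
  swap
  · exact ⟨i, hi, Equiv.refl _⟩
  have hl : ∀ i d, i < 2 → Equiv ⟨[cup 0, cup 2], v, i, d⟩ ⟨[cup 0], cup 2 :: v, i, d⟩ :=
    fun i d hi => slide_left isDiagram_cup_zero (e := .cup) (j := 2) d (by simp) hi
  have h0 := fun d => slide_cup (v := cup 2 :: v) (IsDiagram.nil 0) (j := 0) le_rfl d
  have h2 := fun d => slide_cup (v := v) isDiagram_cup_zero (j := 2) le_rfl d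
  interval_cases i
  · exact ⟨1, by omega, (hl 0 _ (by omega)).trans ((h0 false).trans (hl 1 _ (by omega)).symm)⟩
  · exact ⟨0, by omega, (hl 1 _ (by omega)).trans ((h0 true).symm.trans (hl 0 _ (by omega)).symm)⟩
  · exact ⟨3, by omega, h2 false⟩
  · exact ⟨2, by omega, (h2 true).symm⟩

/-- Marked points at the two maxima `cap 2`, `cap 0` may be directed upwards. -/
theorem exists_equiv_up_caps {u : List Slice} (hu : IsDiagram 0 u 4) {i : ℕ} {d : Bool}
    (h : Valid ⟨u, [cap 2, cap 0], i, d⟩) :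
    ∃ j < 4, Equiv ⟨u, [cap 2, cap 0], i, d⟩ ⟨u, [cap 2, cap 0], j, true⟩ := by
  obtain ⟨a, ha, hi⟩ := h
  obtain rfl := hu.unique ha
  simp only at hi
  cases d
  swap
  · exact ⟨i, hi, Equiv.refl _⟩
  have hu2 : IsDiagram 0 (u ++ [cap 2]) 2 :=
    hu.append (by simp [isDiagram_cons_iff, isDiagram_nil_iff])
  have hl : ∀ i d, i < 2 →
      Equiv ⟨u, [cap 2, cap 0], i, d⟩ ⟨u ++ [cap 2], [cap 0], i, d⟩ :=
    fun i d hi => (slide_left hu (e := .cap) (j := 2) d (by simp) hi).symm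
  have h0 := fun d => slide_cap (v := []) hu2 (j := 0) (by omega) d
  have h2 := fun d => slide_cap (v := [cap 0]) hu (j := 2) (by omega) d
  interval_cases i
  · exact ⟨1, by omega, (hl 0 _ (by omega)).trans ((h0 false).trans (hl 1 _ (by omega)).symm)⟩
  · exact ⟨0, by omega, (hl 1 _ (by omega)).trans ((h0 true).symm.trans (hl 0 _ (by omega)).symm)⟩
  · exact ⟨3, by omega, h2 false⟩
  · exact ⟨2, by omega, (h2 true).symm⟩

/-- Every marked point of a braid between two minima and two maxima is equivalent to every upward
point below the maxima. -/
theorem equiv_of_twoBridge {γ w : List Slice} (hγ : IsThreeBraid γ)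
    (h : Iso 0 w ([cup 0, cup 2] ++ γ ++ [cap 2, cap 0])) (M : Mark)
    (hM : M.below ++ M.above = w) (hv : M.Valid) {j : ℕ} (hj : j < 4) :
    M.Equiv ⟨[cup 0, cup 2] ++ γ, [cap 2, cap 0], j, true⟩ := by
  have hR : IsDiagram 0 ([cup 0, cup 2] ++ γ) 4 := isDiagram_inf.append hγ.isDiagram
  obtain ⟨⟨u, v, i, d⟩, h1, h2, h3⟩ := exists_equiv_of_iso h M hM hv
  have key : ∃ i', Valid ⟨[cup 0, cup 2] ++ γ, [cap 2, cap 0], i', d⟩ ∧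
      Equiv ⟨u, v, i, d⟩ ⟨[cup 0, cup 2] ++ γ, [cap 2, cap 0], i', d⟩ := by
    rcases List.append_eq_append_iff.1 h1 with ⟨z, hz, rfl⟩ | ⟨z, rfl, hz⟩
    · rw [hz] at hR ⊢
      refine exists_slide_up_word hR h2 fun s hs => ?_
      have : s ∈ [cup 0, cup 2] ++ γ := hz ▸ List.mem_append_right u hs
      rcases List.mem_append.1 this with h | h
      · fin_cases h <;> simp
      · exact hγ.no_cap s h
    · rw [hz]
      refine exists_slide_down_word h2 fun s hs => ?_
      have : s ∈ [cap 2, cap 0] := hz ▸ List.mem_append_left v hs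
      fin_cases this <;> simp
  obtain ⟨i', h4, h5⟩ := key
  obtain ⟨j', hj', h6⟩ := exists_equiv_up_caps hR h4
  exact h3.trans (h5.trans (h6.trans ((equiv_maxima hγ hj').symm.trans (equiv_maxima hγ hj))))

/-- If the tangle `T` closes the trivial tangle to the unknot, then every marked point of `T` on top
of a rational tangle is equivalent to an upward point at the minima of the rational tangle. -/
theorem exists_equiv_minima {β w : List Slice} (hβ : IsThreeBraid β) (T : Diagram 4 0)
    (hT : (trivialTangle.comp T).link = unknot)
    (h : Iso 0 w ([cup 0, cup 2] ++ (β ++ T.word))) (M : Mark)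
    (hM : M.below ++ M.above = w) (hv : M.Valid) :
    ∃ j < 4, M.Equiv ⟨[cup 0, cup 2], β ++ T.word, j, true⟩ := by
  obtain ⟨⟨u, v, i, d⟩, h1, h2, h3⟩ := exists_equiv_of_iso h M hM hv
  have key : ∃ i' d', Valid ⟨[cup 0, cup 2], β ++ T.word, i', d'⟩ ∧
      Equiv ⟨u, v, i, d⟩ ⟨[cup 0, cup 2], β ++ T.word, i', d'⟩ := by
    rcases List.append_eq_append_iff.1 h1 with ⟨z, hz, rfl⟩ | ⟨z, rfl, hz⟩
    · rw [hz]
      obtain ⟨i', h4⟩ := exists_slide_up_word (hz ▸ isDiagram_inf) h2 fun s hs => by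
        have : s ∈ [cup 0, cup 2] := hz ▸ List.mem_append_right u hs
        fin_cases this <;> simp
      exact ⟨i', d, h4⟩
    · rcases List.append_eq_append_iff.1 hz.symm with ⟨y, rfl, rfl⟩ | ⟨y, rfl, hy⟩
      · obtain ⟨i', h4, h5⟩ := exists_slide_down_word h2 fun s hs => hβ.no_cup s (by simp [hs])
        exact ⟨i', d, by simpa using h4, by simpa using h5⟩
      · rw [← List.append_assoc] at h2 ⊢
        have hx : IsDiagram 0 ([cup 0, cup 2] ++ β) 4 := isDiagram_inf.append hβ.isDiagram
        -- A mark inside `T` reaches the lower boundary of `T` because T₀·T is the unknot; below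
        -- that, the braid has no minima to stop it.
        obtain ⟨i', d', h4, h5⟩ := exists_equiv_boundary hx (hy ▸ T.valid)
          (D := trivialTangle.comp T) (by rw [← hy]; rfl) hT h2
        obtain ⟨i'', h6, h7⟩ := exists_slide_down_word h4 hβ.no_cup
        rw [hy]
        exact ⟨i'', d', h6, h5.trans h7⟩
  obtain ⟨i', d', h4, h5⟩ := key
  obtain ⟨j, hj, h6⟩ := exists_equiv_up_cups h4
  exact ⟨j, hj, h3.trans (h5.trans h6)⟩

/-- A point at the two minima is a point above one of them, the other one being born later. -/
theorem exists_equiv_cup_zero {B : List Slice} {j : ℕ} (hj : j < 4) :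
    ∃ i < 2, ∃ c, (c = 0 ∨ c = 2) ∧
      Equiv ⟨[cup 0, cup 2], B, j, true⟩ ⟨[cup 0], cup c :: B, i, true⟩ := by
  by_cases h : j < 2
  · exact ⟨j, h, 2, Or.inr rfl,
      slide_left isDiagram_cup_zero (e := .cup) (j := 2) true (by simp) h⟩
  -- The heights of the two minima are interchanged, so that the marked one is born first; the other
  -- one then appears to its left, with `c = 0`.
  · refine ⟨j - 2, by omega, 0, Or.inl rfl, (equiv_of_iso_below j true iso_inf).trans ?_⟩
    exact slide_right isDiagram_cup_zero (e := .cup) (j := 0) true (by omega) (by simp)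
      (by simp; omega)

/-- A point at one of two maxima is a point below two maxima at the same height. -/
theorem exists_equiv_cap_zero {R : List Slice} (hR : IsDiagram 0 R 4) {i c : ℕ} (hi : i < 2)
    (hc : c = 0 ∨ c = 2) : ∃ j < 4,
      Equiv ⟨R, [cap 2, cap 0], j, true⟩ ⟨R ++ [cap c], [cap 0], i, true⟩ := by
  rcases hc with rfl | rfl
  · refine ⟨2 + i, by omega, ?_⟩
    exact (equiv_of_iso_above hR (by omega) true iso_caps_exchange.symm).trans
      (slide_right hR (e := .cap) (j := 0) true (by omega) (by simp) (by simp; omega)).symm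
  · exact ⟨i, by omega, (slide_left hR (e := .cap) (j := 2) true (by simp) hi).symm⟩

/-- All marked points of diagrams of the unknot are equivalent. -/
theorem equiv_of_link_eq_unknot {D : Diagram 0 0} (hD : D.link = unknot) (M : Mark)
    (hM : M.below ++ M.above = D.word) (hv : M.Valid) :
    M.Equiv ⟨[cup 0], [cap 0], 0, true⟩ := by
  obtain ⟨⟨u, v, i, d⟩, h1, h2, h3⟩ := exists_equiv_of_iso (link_eq_iff.1 hD) M hM hv
  have key : ∃ i', Valid ⟨[cup 0], [cap 0], i', d⟩ ∧
      Equiv ⟨u, v, i, d⟩ ⟨[cup 0], [cap 0], i', d⟩ := by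
    have h1' : u ++ v = [cup 0] ++ [cap 0] := h1
    rcases List.append_eq_append_iff.1 h1' with ⟨z, hz, rfl⟩ | ⟨z, rfl, hz⟩
    · rw [hz]
      refine exists_slide_up_word (hz ▸ isDiagram_cup_zero) h2 fun s hs => ?_
      have : s ∈ [cup 0] := hz ▸ List.mem_append_right u hs
      fin_cases this; simp
    · rw [hz]
      refine exists_slide_down_word h2 fun s hs => ?_
      have : s ∈ [cap 0] := hz ▸ List.mem_append_left v hs
      fin_cases this; simp
  obtain ⟨i', ⟨a, ha, hi⟩, h5⟩ := key
  obtain rfl := isDiagram_cup_zero.unique ha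
  simp only at hi
  have h01 := fun d => slide_cap (v := []) isDiagram_cup_zero (j := 0) (by omega) d
  -- A kink inserted at the minimum and absorbed by the maximum moves the mark from the right leg to
  -- the left one without changing its direction.
  have h00 : Equiv ⟨[cup 0], [cap 0], 1, true⟩ ⟨[cup 0], [cap 0], 0, true⟩ := by
    have a := equiv_below_crossing (v := [cap 0]) (IsDiagram.nil 0) 1 true
      (iso_r1_cup_pos 0 le_rfl)
    have b := slide_crossing_right (v := [cap 0]) isDiagram_cup_zero (e := .pos) (j := 0) true
      (by simp) (by omega)
    have c := equiv_of_iso_above isDiagram_cup_zero (i := 0) (by omega) true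
      (iso_r1_cap_pos (m := 2) 0 (by omega))
    exact a.symm.trans (b.trans c)
  refine h3.trans (h5.trans ?_)
  cases d <;> interval_cases i'
  · exact (h01 false).trans h00
  · exact (h01 true).symm
  · exact Equiv.refl _
  · exact h00

end Mark

/-! ### Connected sums -/

/-- A tangle with two endpoints at the bottom may be opened up to a tangle with one endpoint at the
bottom and one at the top. -/
theorem exists_open {X : List Slice} (hX : IsDiagram 2 X 0) {i : ℕ} (hi : i < 2) :
    ∃ t : Diagram 1 1, Iso 2 (shift i t.word ++ [cap 0]) X ∧
      ∀ s, IsDiagram 1 s 1 →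
        Iso 0 ([cup 0] ++ (shift i s ++ X)) (cup 0 :: (s ++ t.word) ++ [cap 0]) := by
  have hc : IsDiagram 1 [cup 1] 3 := by simp [isDiagram_cons_iff, isDiagram_nil_iff]
  have hv : ∀ {X}, IsDiagram 2 X 0 → IsDiagram 1 (cup 1 :: X) 1 := fun hX =>
    hc.append (hX.add_right 1)
  -- Opening means that the second endpoint of `X` is bent upwards by a minimum; closing again on
  -- the right straightens the resulting zigzag.
  have hz : ∀ {X}, IsDiagram 2 X 0 → Iso 2 (cup 1 :: X ++ [cap 0]) X := by
    intro X hX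
    have h1 : Iso 4 (X ++ [cap 0]) (cap 2 :: X) := iso_slice_right hX .cap 0 (by simp)
    have h2 : IsDiagram 2 [cup 1] 4 := hc.add_right 1
    exact (Iso.append_left h2 h1).trans ((iso_zigzag_left (m := 2) 1 le_rfl).append_right X)
  obtain rfl | rfl : i = 0 ∨ i = 1 := by omega
  · refine ⟨⟨_, hv hX⟩, by simpa using hz hX, fun s hs => ?_⟩
    have := Iso.append_left (isDiagram_cup_zero.append (hs.add_right 1)) (hz hX)
    simpa using this.symm
  -- When the summand sits on the right strand, a kink is added to `X` so that the opening can again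
  -- be made at the left strand.
  · have hp : IsDiagram 2 [pos 0] 2 := by simp [isDiagram_cons_iff, isDiagram_nil_iff]
    have hn : IsDiagram 2 [neg 0] 2 := by simp [isDiagram_cons_iff, isDiagram_nil_iff]
    have hX' : IsDiagram 2 (pos 0 :: X) 0 := hp.append hX
    refine ⟨⟨_, hv hX'⟩, ?_, fun s hs => ?_⟩
    · have h1 := Iso.append_left ((hv hX').shift 1) (iso_r1_cap_neg (m := 2) 0 le_rfl)
      have h2 := (iso_tangle_neg (hv hX')).append_right [cap 0]
      have h3 := Iso.append_left hn (hz hX')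
      have h4 := (iso_neg_pos (m := 2) 0 le_rfl).append_right X
      rw [List.append_assoc] at h2
      exact h1.symm.trans (h2.trans (h3.trans h4))
    · have h1 := (iso_r1_cup_pos (m := 0) 0 le_rfl).append_right (shift 1 s ++ X)
      have h2 := Iso.append_both isDiagram_cup_zero (iso_pos_tangle hs) X
      have h3 := Iso.append_left (isDiagram_cup_zero.append (hs.add_right 1)) (hz hX')
      simp only [List.append_assoc, List.cons_append, List.nil_append] at h1 h2 h3 ⊢
      exact h1.symm.trans (h2.trans h3.symm)

theorem closure_comp_word (s t : Diagram 1 1) :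
    (s.comp t).closure.word = cup 0 :: (s.word ++ t.word) ++ [cap 0] := rfl

/-- A connected sum with the unknot changes nothing. -/
theorem eq_of_isConnectedSum_unknot {K₂ K : Link} (h : IsConnectedSum unknot K₂ K) : K = K₂ := by
  obtain ⟨s, t, hs, rfl, rfl⟩ := h
  have h1 := Mark.equiv_of_link_eq_unknot hs _ rfl (Mark.valid_closure_below s) t.word t.valid
  refine link_eq_iff.2 ?_
  simpa [Mark.fill, Mark.orient, Diagram.closure, Diagram.comp, shift_zero] using h1

/-- The 2-bridge links `S(1, p)` are trivial. -/
theorem eq_unknot_of_isTwoBridge {p q : ℤ} {K : Link} (h : IsTwoBridge q p K)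
    (hq : q.natAbs = 1) : K = unknot := by
  obtain ⟨l, ⟨-, hl⟩, rfl⟩ := h
  obtain ⟨n, hn⟩ : ∃ n : ℤ, mk (rationalWord true l) (isDiagram_rationalWord l true)
      = frac 1 n := by
    rw [mk_rationalWord, if_pos rfl]
    -- Since q = ±1, the fraction q/p is 1/(qp): the tangle consists of twists of the endpoints 1
    -- and 2, and the inner maximum absorbs them.
    refine ⟨q * p, farey.frac_eq_frac (contFrac_ne_zero l) (by omega) ?_⟩
    obtain h | h := Int.natAbs_eq_iff.1 hq
    · subst h; push_cast at hl ⊢; linarith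
    · subst h; push_cast at hl ⊢; linarith
  have h1 := mk_append_halfTwists_one isDiagram_inf (by omega) frac_one_zero.symm n
  rw [mul_one, add_zero, ← hn, mk_eq_mk] at h1
  have h2 : ∀ n : ℤ, Iso 4 (halfTwists 1 n ++ [cap 1, cap 0]) [cap 1, cap 0] := by
    intro n
    unfold halfTwists
    generalize n.natAbs = k
    split_ifs
    · induction k with
      | zero => exact Iso.refl _
      | succ k ih =>
        rw [List.replicate_succ', List.append_assoc]
        refine Iso.trans (Iso.append_both ?_ (iso_r1_cap_pos (m := 4) 1 (by omega)) [cap 0]) ih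
        simpa [halfTwists] using isDiagram_halfTwists 1 1 k
    · induction k with
      | zero => exact Iso.refl _
      | succ k ih =>
        rw [List.replicate_succ', List.append_assoc]
        refine Iso.trans (Iso.append_both ?_ (iso_r1_cap_neg (m := 4) 1 (by omega)) [cap 0]) ih
        clear ih
        induction k with
        | zero => exact IsDiagram.nil _
        | succ k ih => exact IsDiagram.cons' _ 1 1 ih rfl rfl
  have h3 := Iso.append_left isDiagram_inf (h2 (-n))
  have h4 : Iso 0 ([cup 0] ++ ([cup 2, cap 1] ++ [cap 0])) ([cup 0] ++ ([] ++ [cap 0])) :=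
    Iso.append_both isDiagram_cup_zero (iso_zigzag_right (m := 2) 1 le_rfl) [cap 0]
  refine link_eq_iff.2 ?_
  have h5 := h1.symm.append_right [cap 1, cap 0]
  rw [List.append_assoc] at h5
  exact h5.trans (h3.trans h4)

/-- A connected sum of the 2-bridge link `S(q, p)` and a `(p, q)`-tangle unknotting number one link
is changed into the unknot by one band surgery. -/
theorem hTwoMove_of_isConnectedSum {p q : ℤ} {K₁ K₂ K : Link} (h₁ : IsTwoBridge q p K₁)
    (h₂ : IsTangleUnknottingOne p q K₂) (hK : IsConnectedSum K₁ K₂ K) : HTwoMove K unknot := by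
  obtain ⟨l₁, hl₁, rfl⟩ := h₁
  obtain ⟨l, T, hl, rfl, hT⟩ := h₂
  obtain ⟨s, t, hs, ht, rfl⟩ := hK
  obtain ⟨β, hβ, hβl, hβm⟩ := exists_isThreeBraid l true
  rw [if_pos rfl] at hβm
  have hs' := (link_eq_iff.1 hs).trans (iso_conwayDiagram hl hl₁ hβ hβm)
  have ht' : Iso 0 t.closure.word ([cup 0, cup 2] ++ (β ++ T.word)) := by
    have := hβl.symm.append_right T.word
    rw [List.append_assoc] at this
    exact (link_eq_iff.1 ht).trans this
  obtain ⟨j, hj, hlow⟩ := Mark.exists_equiv_minima hβ T hT ht' _ rfl (Mark.valid_closure_above t)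
  obtain ⟨i, hi, c, hc, hlow'⟩ := Mark.exists_equiv_cup_zero (B := β ++ T.word) hj
  have hR : IsDiagram 0 ([cup 0, cup 2] ++ inv β) 4 := isDiagram_inf.append hβ.inv.isDiagram
  -- The point at the minima of K₂ dictates `i` and `c`. Since all four points at the maxima of K₁
  -- are equivalent, the one that fits can be chosen.
  obtain ⟨j', hj', hup'⟩ := Mark.exists_equiv_cap_zero hR hi hc
  have hup := Mark.equiv_of_twoBridge hβ.inv hs' _ rfl (Mark.valid_closure_below s) hj'
  have hB : IsDiagram 4 (β ++ T.word) 0 := hβ.isDiagram.append T.valid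
  have hX : IsDiagram 2 (cup c :: (β ++ T.word)) 0 :=
    IsDiagram.cons' .cup c (2 - c) hB (by simp; omega) (by simp; omega)
  have hRc : IsDiagram 0 ([cup 0, cup 2] ++ inv β ++ [cap c]) 2 :=
    hR.append (IsDiagram.cons' .cap c (2 - c) (IsDiagram.nil 2) (by simp; omega) (by simp; omega))
  -- The diagram of K₂ is opened at the chosen minimum into a 1-1 tangle `t'`, which can be tied
  -- into K₁ at the chosen maximum. Thus both marks may be moved, one after the other.
  obtain ⟨t', ht₁, ht₂⟩ := exists_open hX hi
  have e1 := (hlow.trans hlow') s.word s.valid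
  have e2 := ht₂ s.word s.valid
  have e3 := (hup.trans hup') t'.word t'.valid
  have e4 := Iso.append_left hRc ht₁
  have e5 : Iso 0 (s.comp t).closure.word
      ([cup 0, cup 2] ++ inv β ++ [cap c] ++ cup c :: (β ++ T.word)) := by
    rw [closure_comp_word]
    simp only [Mark.fill, Mark.orient, if_true, shift_zero, List.append_assoc, List.cons_append,
      List.nil_append] at e1 e2 e3 e4 ⊢
    exact e1.trans (e2.trans (e3.trans e4))
  -- After the surgery the inverse braid meets `β` directly and cancels, leaving T₀·T.
  have e6 : Iso 0 ([cup 0, cup 2] ++ inv β ++ (β ++ T.word)) ([cup 0, cup 2] ++ T.word) := by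
    have := Iso.append_both isDiagram_inf (hβ.isBraid.iso_inv_append hβ.isDiagram) T.word
    simpa using this
  refine ⟨⟨_, hRc.append hX⟩, ⟨_, hR.append hB⟩, ?_, ?_, Or.inr ⟨_, _, c, rfl, by simp⟩⟩
  · exact link_eq_iff.2 e5.symm
  · rw [← hT]; exact link_eq_iff.2 e6

end HTwo

/-! ### The H(2)-unknotting number of the connected sum -/

theorem proposition1p3 (p q : ℤ) (K₁ K₂ K : HTwo.Link)
    (h₁ : HTwo.IsTwoBridge q p K₁) (h₂ : HTwo.IsTangleUnknottingOne p q K₂)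
    (hK : HTwo.IsConnectedSum K₁ K₂ K)
    (hnt : K₁ ≠ HTwo.unknot ∨ K₂ ≠ HTwo.unknot) :
    HTwo.unknottingNumber K = 1 := by
  have hne : K ≠ HTwo.unknot := by
    rintro rfl
    -- A trivial sum forces the 2-bridge summand to be trivial; a sum with the unknot is the other
    -- summand, so both would be trivial.
    have h := HTwo.eq_unknot_of_isTwoBridge h₁ (HTwo.natAbs_eq_one_of_isConnectedSum h₁ hK)
    subst h
    have := HTwo.eq_of_isConnectedSum_unknot hK
    simp [this.symm] at hnt
  refine le_antisymm ?_ (le_iInf₂ fun n hn => ?_)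
  · exact iInf₂_le_of_le 1 ⟨_, HTwo.hTwoMove_of_isConnectedSum h₁ h₂ hK, rfl⟩ (by simp)
  · cases n with
    | zero => exact absurd hn hne
    | succ n => simp
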